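/- Let $\varepsilon,\eta>0$ with $\varepsilon+\eta=1$, let $a,b>0$, and set $$\phi(\xi)=4\pi^2\eta\,\xi^2-a|\xi|^{4/3}+i\,b\,\xi|\xi|^{1/3},\qquad \xi\in\mathbf R.$$ With $\mathcal F f(\xi)=\int_{\mathbf R}e^{-2i\pi x\xi}f(x)\,dx$, let $D(t,\cdot)=\mathcal F^{-1}(e^{-t\phi})$ and $X^tv=D(t,\cdot)*v$ for $t>0$, $X^0v=v$; this is the evolution operator of the linear part $\partial_t v+\mathcal I[v]-\eta\,\partial_x^2v=0$ of the Fowler equation, $\mathcal I$ being the Fourier multiplier with symbol $-a|\xi|^{4/3}+ib\,\xi|\xi|^{1/3}$. Let $G(t,x)=(4\pi\varepsilon t)^{-1/2}e^{-x^2/(4\varepsilon t)}$. For real-valued $u\in L^2(\mathbf R)$ let $Y^tu=w(t)$, where $w\in C([0,\infty);L^2(\mathbf R))$ is the mild solution of the viscous Burgers equation $\partial_tw+\partial_x(w^2/2)-\varepsilon\,\partial_x^2w=0$, $w(0)=u$, that is, $$w(t)=G(t,\cdot)*u-\frac12\int_0^t\partial_xG(t-s,\cdot)*w(s)^2\,ds\qquad(t>0).$$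 Let $Z_L^t=X^tY^t$ be the Lie splitting operator, and let $\|f\|_{H^n}=\left(\int_{\mathbf R}(1+|\xi|^2)^n|\mathcal Ff(\xi)|^2\,d\xi\right)^{1/2}$. Functions are real-valued. For every $u\in L^2(\mathbf R)$ the mild solution $w$ exists and is unique, so that $Y^t$ and $Z_L^t$ are well defined on $L^2(\mathbf R)$ for $t\ge 0$, and: 1. The minimum of $\operatorname{Re}\phi$ is attained, $\beta_0:=-\min\operatorname{Re}\phi>0$, and for all $u\in L^2(\mathbf R)$ and all $t>0$, $Z_L^tu\in L^2(\mathbf R)$ and $$\|Z_L^tu\|_{L^2(\mathbf R)}\le e^{\beta_0t}\|u\|_{L^2(\mathbf R)}.$$ 2. For every integer $n\ge1$ (and fixed $\varepsilon,\eta,a,b$) there is a positive function $C(T,\alpha)$ of $T>0$, $\alpha\ge0$, nondecreasing in each argument, such that for all $T>0$, all $u\in H^n(\mathbf R)$ and all $t\in[0,T]$, $Z_L^tu\in H^n(\mathbf R)$ and $$\|Z_L^tu\|_{H^n(\mathbf R)}\le e^{C(T,\|u\|_{L^2(\mathbf R)})\,t}\,\|u\|_{H^n(\mathbf R)}.$$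 -/

import Mathlib

open MeasureTheory FourierTransform
open scoped ENNReal

noncomputable section

/-- The space `L²(ℝ)` of (classes of) real-valued square integrable functions. -/
abbrev L2R : Type := Lp ℝ 2 (volume : Measure ℝ)

/-- The symbol `φ(ξ) = 4π²ηξ² - a|ξ|^{4/3} + i b ξ|ξ|^{1/3}` of the linear operator
`𝓘 - η∂ₓ²`. -/
def linSymbol (η a b ξ : ℝ) : ℂ :=
  ((4 * Real.pi ^ 2 * η * ξ ^ 2 - a * |ξ| ^ (4 / 3 : ℝ) : ℝ) : ℂ)
    + Complex.I * ((b * ξ * |ξ| ^ (1 / 3 : ℝ) : ℝ) : ℂ)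

/-- The growth rate `β₀ = - min Re φ`. -/
def growthRate (η a b : ℝ) : ℝ :=
  -sInf (Set.range fun ξ : ℝ => (linSymbol η a b ξ).re)

/-- The kernel `D(t,·) = 𝓕⁻¹(e^{-tφ})` (for `t > 0`), with the normalization
`𝓕 f(ξ) = ∫ e^{-2iπxξ} f(x) dx`. The inverse transform is real-valued (`linKernel_eq` below), and is
therefore recorded as a real function. -/
def linKernel (η a b t x : ℝ) : ℝ :=
  (𝓕⁻ (fun ξ : ℝ => Complex.exp (-(t : ℂ) * linSymbol η a b ξ)) x).re

theorem linSymbol_neg (η a b ξ : ℝ) :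
    linSymbol η a b (-ξ) = (starRingEnd ℂ) (linSymbol η a b ξ) := by
  simp only [linSymbol, map_add, map_mul, Complex.conj_I, Complex.conj_ofReal, abs_neg, neg_sq]
  push_cast
  ring

theorem linKernel_eq (η a b t x : ℝ) :
    ((linKernel η a b t x : ℝ) : ℂ)
      = 𝓕⁻ (fun ξ : ℝ => Complex.exp (-(t : ℂ) * linSymbol η a b ξ)) x := by
  rw [linKernel]
  apply Complex.conj_eq_iff_re.mp
  rw [Real.fourierInv_eq', ← integral_conj, ← integral_neg_eq_self]
  congr 1
  ext ξ
  rw [smul_eq_mul, smul_eq_mul, map_mul, ← Complex.exp_conj, ← Complex.exp_conj, linSymbol_neg]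
  simp only [map_mul, map_neg, Complex.conj_conj, Complex.conj_ofReal, Complex.conj_I,
    inner_neg_left]
  push_cast
  congr 2
  ring

/-- Convolution on `ℝ` of real-valued functions. -/
def conv (f g : ℝ → ℝ) : ℝ → ℝ :=
  convolution f g (ContinuousLinearMap.mul ℝ ℝ) volume

/-- The linear evolution operator `X^t v = D(t,·) ∗ v` of `v_t + 𝓘[v] - η v_xx = 0`, with
`X^0 = id`. -/
def linFlow (η a b t : ℝ) (v : ℝ → ℝ) : ℝ → ℝ :=
  if t = 0 then v else conv (linKernel η a b t) v

/-- The heat kernel `G(t,x) = (4πεt)^{-1/2} e^{-x²/(4εt)}`. -/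
def heatKernel (ε t x : ℝ) : ℝ :=
  1 / Real.sqrt (4 * Real.pi * ε * t) * Real.exp (-x ^ 2 / (4 * ε * t))

/-- `w ∈ C([0,∞); L²(ℝ))` is a (global) mild solution of the viscous Burgers equation
`w_t + (w²/2)_x - ε w_xx = 0`, `w(0) = u`, i.e. it satisfies Duhamel's formula
`w(t) = G(t) ∗ u - ½ ∫₀ᵗ ∂ₓG(t-s) ∗ w(s)² ds` for all `t > 0`. -/
structure IsBurgersMildSolution (ε : ℝ) (u : L2R) (w : ℝ → L2R) : Prop where
  continuousOn : ContinuousOn w (Set.Ici 0)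
  initial : w 0 = u
  duhamel : ∀ t : ℝ, 0 < t → ∀ᵐ x : ℝ,
    w t x = conv (heatKernel ε t) u x
      - 1 / 2 * ∫ s in (0 : ℝ)..t,
          conv (deriv (heatKernel ε (t - s))) (fun y => (w s y) ^ 2) x

open Classical in
/-- The nonlinear evolution operator `Y^t`: `Y^t u = w(t)`, where `w` is the mild solution of the
viscous Burgers equation with initial datum `u`. -/
def burgersFlow (ε t : ℝ) (u : L2R) : L2R :=
  if h : ∃ w : ℝ → L2R, IsBurgersMildSolution ε u w then h.choose t else 0

/-- The Lie splitting operator `Z_L^t = X^t Y^t`. -/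
def lieSplitting (ε η a b t : ℝ) (u : L2R) : ℝ → ℝ :=
  linFlow η a b t (burgersFlow ε t u)

/-- A real-valued `L²` function seen as a complex-valued one. -/
def toComplexL2 (f : L2R) : Lp ℂ 2 (volume : Measure ℝ) :=
  Complex.ofRealCLM.compLp f

/-- Membership in the Sobolev space `Hⁿ(ℝ)`. -/
def MemHn (n : ℕ) (f : L2R) : Prop :=
  TemperedDistribution.MemSobolev (n : ℝ) 2
    (Lp.toTemperedDistribution (toComplexL2 f) : TemperedDistribution ℝ ℂ)

/-- The Sobolev norm `‖f‖_{Hⁿ} = (∫ (1 + |ξ|²)ⁿ |𝓕 f(ξ)|² dξ)^{1/2}`. -/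
def hnNorm (n : ℕ) (f : L2R) : ℝ≥0∞ :=
  (∫⁻ ξ : ℝ, ENNReal.ofReal ((1 + ξ ^ 2) ^ n) * ‖(𝓕 (toComplexL2 f)) ξ‖ₑ ^ 2) ^ (1 / 2 : ℝ)

end

open MeasureTheory FourierTransform Set Filter
open scoped ENNReal SchwartzMap

noncomputable section

/-! The proof works on the Fourier side, in `L2C` regarded as a real Hilbert space. With c = 4π²ε, a
mild solution becomes a solution of p(t) = e^{-cξ²t} û - iπξ ∫₀ᵗ e^{-cξ²(t-s)} (p(s) ∗ p(s)) ds
(`IsFourierMild`, `isBurgersMildSolution_iff`). This equation needs no regularity: for p in L² the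
function p ∗ p is continuous and bounded by ‖p‖².

Stability (`IsFourierMild.exists_norm_sub_le`). When differences are weighted by e^{-ls}, the time
integral of the heat factor turns ξ into |ξ|/(cξ² + l), whose L² norm tends to 0 as l → ∞. Hence the
difference of two bounded solutions with the same datum absorbs itself. If the solutions are
truncated at different frequencies, only a tail beyond the common cutoff remains. This one estimate
gives both uniqueness and the convergence of truncated solutions.

Existence. Truncating to |ξ| ≤ N leaves an ordinary differential equation in L² with a bounded
linear and a bounded quadratic term. On transforms of real functions the quadratic term is
orthogonal to the solution (∫ v² ∂ₓv = 0, `integral_mul_cconv_neg_eq_zero`) and the linear term is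
dissipative, so the norm does not grow and the solution is global
(`exists_solution_of_dissipative`). The limit N → ∞ is the solution, with ‖w(t)‖ ≤ ‖u‖.

Sobolev bound. Let d be the weighted solution (1 + ξ²)^{n/2} v. The factor ξ of the nonlinearity is
moved to the other argument, and the trilinear form is at most a constant times ‖v‖₂ ‖ξd‖₂ ‖d‖_{L¹}.
Cauchy-Schwarz bounds ‖d‖_{L¹} by a large multiple of ‖d‖₂ plus a small multiple of ‖ξd‖₂. The
dissipation c‖ξd‖₂² then absorbs every term in ‖ξd‖₂, leaving a growth rate `sobRate` that depends
on the datum only through its L² norm. It is uniform in N, and Fatou's lemma carries the bound to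
the limit.

Finally X^t is multiplication by e^{-tφ}, of modulus at most e^{β₀t}, so it costs e^{β₀t} in every
Hⁿ norm, and the two rates add up. -/

/-- The space `L²(ℝ)` of complex-valued square integrable functions. -/
abbrev L2C : Type := Lp ℂ 2 (volume : Measure ℝ)

/-! ### Pairing, convolution and multipliers on L² -/

theorem L2C.integrable_mul (f g : L2C) : Integrable (fun x => f x * g x) :=
  (Lp.memLp f).integrable_mul (Lp.memLp g)

theorem lintegral_enorm_sq_eq (f : L2C) : ∫⁻ x, ‖f x‖ₑ ^ 2 = ‖f‖ₑ ^ 2 := by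
  rw [Lp.enorm_def, eLpNorm_eq_lintegral_rpow_enorm_toReal (by norm_num) (by norm_num),
    ← ENNReal.rpow_natCast, ← ENNReal.rpow_mul]
  simp

/-- The Cauchy-Schwarz inequality for the product of two `L²` functions. -/
theorem lintegral_enorm_mul_le (f g : L2C) : ∫⁻ x, ‖f x‖ₑ * ‖g x‖ₑ ≤ ‖f‖ₑ * ‖g‖ₑ := by
  have h := ENNReal.lintegral_mul_le_Lp_mul_Lq (volume : Measure ℝ) Real.HolderConjugate.two_two
    (Lp.aestronglyMeasurable f).enorm (Lp.aestronglyMeasurable g).enorm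
  simp only [Pi.mul_apply] at h
  refine h.trans_eq ?_
  rw [Lp.enorm_def, Lp.enorm_def, eLpNorm_eq_lintegral_rpow_enorm_toReal (by norm_num) (by norm_num),
    eLpNorm_eq_lintegral_rpow_enorm_toReal (by norm_num) (by norm_num)]
  simp

theorem norm_integral_mul_le (f g : L2C) : ‖∫ x, f x * g x‖ ≤ ‖f‖ * ‖g‖ := by
  have h : ‖∫ x, f x * g x‖ₑ ≤ ‖f‖ₑ * ‖g‖ₑ := by
    refine (enorm_integral_le_lintegral_enorm _).trans ?_
    simpa only [enorm_mul] using lintegral_enorm_mul_le f g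
  simpa [ENNReal.toReal_mul] using ENNReal.toReal_mono (by finiteness) h

/-- The bilinear pairing `(f, g) ↦ ∫ f g` on `L²(ℝ; ℂ)`. -/
def l2Pairing : L2C →L[ℂ] L2C →L[ℂ] ℂ :=
  (ContinuousLinearMap.mul ℂ ℂ).lpPairing volume 2 2

theorem l2Pairing_apply (f g : L2C) : l2Pairing f g = ∫ x, f x * g x := by
  rw [l2Pairing, ContinuousLinearMap.lpPairing_eq_integral]
  rfl

/-- The isometry `g ↦ g (ξ - ·)` of `L²`. -/
def reflectAt (ξ : ℝ) : L2C →ₗᵢ[ℂ] L2C :=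
  Lp.compMeasurePreservingₗᵢ ℂ (fun η => ξ - η) (volume.measurePreserving_sub_left ξ)

theorem coeFn_reflectAt (ξ : ℝ) (g : L2C) : reflectAt ξ g =ᵐ[volume] fun η => g (ξ - η) :=
  Lp.coeFn_compMeasurePreserving g (volume.measurePreserving_sub_left ξ)

/-- The convolution of two functions of `L²(ℝ; ℂ)`, a bounded function. -/
def cconv (f g : L2C) (ξ : ℝ) : ℂ := ∫ η, f η * g (ξ - η)

theorem cconv_eq_pairing (f g : L2C) (ξ : ℝ) : cconv f g ξ = l2Pairing f (reflectAt ξ g) := by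
  rw [l2Pairing_apply]
  refine integral_congr_ae ?_
  filter_upwards [coeFn_reflectAt ξ g] with η h
  rw [h]

theorem norm_cconv_le (f g : L2C) (ξ : ℝ) : ‖cconv f g ξ‖ ≤ ‖f‖ * ‖g‖ := by
  rw [cconv_eq_pairing, l2Pairing_apply, ← (reflectAt ξ).norm_map g]
  exact norm_integral_mul_le _ _

theorem cconv_sub_left (f₁ f₂ g : L2C) (ξ : ℝ) :
    cconv (f₁ - f₂) g ξ = cconv f₁ g ξ - cconv f₂ g ξ := by
  simp [cconv_eq_pairing]

theorem cconv_sub_right (f g₁ g₂ : L2C) (ξ : ℝ) :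
    cconv f (g₁ - g₂) ξ = cconv f g₁ ξ - cconv f g₂ ξ := by
  simp [cconv_eq_pairing]

theorem cconv_add_left (f₁ f₂ g : L2C) (ξ : ℝ) :
    cconv (f₁ + f₂) g ξ = cconv f₁ g ξ + cconv f₂ g ξ := by
  simp [cconv_eq_pairing]

theorem cconv_add_right (f g₁ g₂ : L2C) (ξ : ℝ) :
    cconv f (g₁ + g₂) ξ = cconv f g₁ ξ + cconv f g₂ ξ := by
  simp [cconv_eq_pairing]

theorem cconv_smul_left (a : ℂ) (f g : L2C) (ξ : ℝ) : cconv (a • f) g ξ = a * cconv f g ξ := by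
  simp [cconv_eq_pairing]

theorem cconv_smul_right (a : ℂ) (f g : L2C) (ξ : ℝ) : cconv f (a • g) ξ = a * cconv f g ξ := by
  simp [cconv_eq_pairing]

theorem norm_cconv_self_sub_le (f g : L2C) (ξ : ℝ) :
    ‖cconv f f ξ - cconv g g ξ‖ ≤ (‖f‖ + ‖g‖) * ‖f - g‖ := by
  have h : cconv f f ξ - cconv g g ξ = cconv f (f - g) ξ + cconv (f - g) g ξ := by
    rw [cconv_sub_left, cconv_sub_right]; ring
  rw [h]
  refine (norm_add_le _ _).trans ?_
  nlinarith [norm_cconv_le f (f - g) ξ, norm_cconv_le (f - g) g ξ]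

theorem continuous_cconv_apply (ξ : ℝ) : Continuous fun p : L2C × L2C => cconv p.1 p.2 ξ := by
  simp only [cconv_eq_pairing]
  have := (reflectAt ξ).continuous
  fun_prop

/-- Multiplication by an essentially bounded function, as an operator on `L²`. -/
def mulOp (m : ℝ → ℂ) (hm : MemLp m ∞) : L2C →L[ℂ] L2C :=
  (ContinuousLinearMap.mul ℂ ℂ).holderL volume ∞ 2 2 (hm.toLp m)

theorem coeFn_mulOp (m : ℝ → ℂ) (hm : MemLp m ∞) (f : L2C) :
    mulOp m hm f =ᵐ[volume] fun x => m x * f x := by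
  filter_upwards [(ContinuousLinearMap.mul ℂ ℂ).coeFn_holder (r := 2) (hm.toLp m) f, hm.coeFn_toLp]
    with x h₁ h₂
  rw [← h₂]
  exact h₁

theorem memLp_top_fourierChar (ξ : ℝ) :
    MemLp (fun x : ℝ => (Real.fourierChar (x * ξ) : ℂ)) ∞ :=
  memLp_top_of_bound (Continuous.aestronglyMeasurable
    (continuous_subtype_val.comp (Real.continuous_fourierChar.comp (by fun_prop)))) 1
    (.of_forall fun _ => (Circle.norm_coe _).le)

/-! ### The Fourier transform on L²: convolution theorem and agreement with L¹ -/

theorem SchwartzMap.dense_toLp : DenseRange (fun φ : 𝓢(ℝ, ℂ) => φ.toLp 2 (volume : Measure ℝ)) :=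
  SchwartzMap.denseRange_toLpCLM ENNReal.ofNat_ne_top

theorem SchwartzMap.cconv_fourierInv (φ ψ : 𝓢(ℝ, ℂ)) (x : ℝ) :
    ∫ y, (𝓕⁻ φ) y * (𝓕⁻ ψ) (x - y) = 𝓕⁻ (fun y => φ y * ψ y) x := by
  have h := SchwartzMap.convolution_apply (ContinuousLinearMap.mul ℂ ℂ) (𝓕⁻ φ) (𝓕⁻ ψ) x
  have h2 : 𝓕⁻ (SchwartzMap.pairing (ContinuousLinearMap.mul ℂ ℂ) φ ψ)
      = SchwartzMap.convolution (ContinuousLinearMap.mul ℂ ℂ) (𝓕⁻ φ) (𝓕⁻ ψ) := by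
    rw [← fourierInv_fourier_eq (E := 𝓢(ℝ, ℂ)) (F := 𝓢(ℝ, ℂ))
        (SchwartzMap.convolution (ContinuousLinearMap.mul ℂ ℂ) (𝓕⁻ φ) (𝓕⁻ ψ)),
      SchwartzMap.fourier_convolution]
    simp
  rw [← h2, SchwartzMap.fourierInv_coe] at h
  exact h.symm

theorem SchwartzMap.cconv_fourier (φ ψ : 𝓢(ℝ, ℂ)) (x : ℝ) :
    ∫ y, (𝓕 φ) y * (𝓕 ψ) (x - y) = 𝓕 (fun y => φ y * ψ y) x := by
  have h := SchwartzMap.cconv_fourierInv φ ψ (-x)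
  simp only [SchwartzMap.fourierInv_coe, Real.fourierInv_eq_fourier_neg, neg_neg] at h
  rw [← h, ← integral_neg_eq_self]
  refine integral_congr_ae (.of_forall fun y => ?_)
  simp only [SchwartzMap.fourier_coe]
  rw [show -(-x - y) = x - -y by ring]

/-- The Fourier transform of a product of `L²` functions is the convolution of the transforms. -/
theorem fourier_mul_eq_cconv (f g : L2C) (ξ : ℝ) :
    𝓕 (fun x => f x * g x) ξ = cconv (𝓕 f) (𝓕 g) ξ := by
  -- At a fixed frequency the transform is a pairing with a modulated factor, hence continuous in
  -- (f, g); density of Schwartz functions then suffices.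
  have h₁ : ∀ f g : L2C, 𝓕 (fun x => f x * g x) ξ
      = l2Pairing (mulOp _ (memLp_top_fourierChar (-ξ)) f) g := by
    intro f g
    rw [l2Pairing_apply, Real.fourier_real_eq]
    refine integral_congr_ae ?_
    filter_upwards [coeFn_mulOp _ (memLp_top_fourierChar (-ξ)) f] with x hx
    rw [hx, Circle.smul_def, smul_eq_mul, mul_neg, mul_assoc]
  refine SchwartzMap.dense_toLp.induction_on₂ (p := fun f g : L2C =>
    𝓕 (fun x => f x * g x) ξ = cconv (𝓕 f) (𝓕 g) ξ) ?_ ?_ f g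
  · simp only [h₁]
    refine isClosed_eq (by fun_prop) ?_
    exact (continuous_cconv_apply ξ).comp (((Lp.fourierTransformₗᵢ ℝ ℂ).continuous.comp
      continuous_fst).prodMk ((Lp.fourierTransformₗᵢ ℝ ℂ).continuous.comp continuous_snd))
  · intro φ ψ
    rw [cconv, SchwartzMap.toLp_fourier_eq, SchwartzMap.toLp_fourier_eq]
    trans 𝓕 (fun x => φ x * ψ x) ξ
    · refine Real.fourier_congr_ae ?_ ξ
      filter_upwards [φ.coeFn_toLp 2 volume, ψ.coeFn_toLp 2 volume] with x h1 h2
      rw [h1, h2]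
    · rw [← SchwartzMap.cconv_fourier]
      refine integral_congr_ae ?_
      filter_upwards [(𝓕 φ).coeFn_toLp 2 volume,
        (Measure.measurePreserving_sub_left volume ξ).quasiMeasurePreserving.ae
          ((𝓕 ψ).coeFn_toLp 2 volume)] with x h1 h2
      rw [h1, h2]

theorem fourierInv_mul_eq_cconv (f g : L2C) (ξ : ℝ) :
    𝓕⁻ (fun x => f x * g x) ξ = cconv (𝓕⁻ f) (𝓕⁻ g) ξ := by
  have h₁ : ∀ f g : L2C, 𝓕⁻ (fun x => f x * g x) ξ
      = l2Pairing (mulOp _ (memLp_top_fourierChar ξ) f) g := by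
    intro f g
    rw [l2Pairing_apply, Real.fourierInv_eq_fourier_neg, Real.fourier_real_eq]
    refine integral_congr_ae ?_
    filter_upwards [coeFn_mulOp _ (memLp_top_fourierChar ξ) f] with x hx
    rw [hx, Circle.smul_def, smul_eq_mul, mul_neg, neg_neg, mul_assoc]
  refine SchwartzMap.dense_toLp.induction_on₂ (p := fun f g : L2C =>
    𝓕⁻ (fun x => f x * g x) ξ = cconv (𝓕⁻ f) (𝓕⁻ g) ξ) ?_ ?_ f g
  · simp only [h₁]
    refine isClosed_eq (by fun_prop) ?_
    exact (continuous_cconv_apply ξ).comp (((Lp.fourierTransformₗᵢ ℝ ℂ).symm.continuous.comp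
      continuous_fst).prodMk ((Lp.fourierTransformₗᵢ ℝ ℂ).symm.continuous.comp continuous_snd))
  · intro φ ψ
    rw [cconv, SchwartzMap.toLp_fourierInv_eq, SchwartzMap.toLp_fourierInv_eq]
    trans 𝓕⁻ (fun x => φ x * ψ x) ξ
    · refine Real.fourierInv_congr_ae ?_ ξ
      filter_upwards [φ.coeFn_toLp 2 volume, ψ.coeFn_toLp 2 volume] with x h1 h2
      rw [h1, h2]
    · rw [← SchwartzMap.cconv_fourierInv]
      refine integral_congr_ae ?_
      filter_upwards [(𝓕⁻ φ).coeFn_toLp 2 volume,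
        (Measure.measurePreserving_sub_left volume ξ).quasiMeasurePreserving.ae
          ((𝓕⁻ ψ).coeFn_toLp 2 volume)] with x h1 h2
      rw [h1, h2]

/-- The convolution is the Fourier transform of an integrable function, a product of two L²
functions. -/
theorem continuous_cconv (f g : L2C) : Continuous (cconv f g) := by
  have h : cconv f g = 𝓕 (fun x => (𝓕⁻ f : L2C) x * (𝓕⁻ g : L2C) x) := by
    ext ξ
    rw [fourier_mul_eq_cconv]
    simp
  rw [h]
  exact VectorFourier.fourierIntegral_continuous Real.continuous_fourierChar (by fun_prop)
    (L2C.integrable_mul _ _)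

/-- Smooth compactly supported functions are Schwartz, so Schwartz test functions separate locally
integrable functions. This is how transforms defined in different ways are identified below. -/
theorem ae_eq_of_integral_schwartz_mul_eq {f g : ℝ → ℂ} (hf : LocallyIntegrable f)
    (hg : LocallyIntegrable g) (h : ∀ φ : 𝓢(ℝ, ℂ), ∫ x, φ x * f x = ∫ x, φ x * g x) :
    f =ᵐ[volume] g := by
  have key : ∀ᵐ x, (f - g) x = 0 := by
    refine ae_eq_zero_of_integral_contDiff_smul_eq_zero (hf.sub hg) ?_
    intro φ φ_smooth φ_cpt
    have h₁ : HasCompactSupport (Complex.ofRealCLM ∘ φ) := φ_cpt.comp_left rfl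
    have h₂ : ContDiff ℝ (⊤ : ℕ∞) (Complex.ofRealCLM ∘ φ) := by fun_prop
    have h₃ := h (h₁.toSchwartzMap h₂)
    have hi : ∀ {u : ℝ → ℂ}, LocallyIntegrable u → Integrable fun x => φ x • u x := fun hu =>
      hu.integrable_smul_left_of_hasCompactSupport φ_smooth.continuous φ_cpt
    simp only [Pi.sub_apply, smul_sub]
    rw [integral_sub (hi hf) (hi hg), sub_eq_zero]
    simpa using h₃
  filter_upwards [key] with x hx
  exact sub_eq_zero.mp hx

/-- The transform on L² is an abstract extension, without an integral formula; this duality,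
extended by density from Schwartz functions, replaces the formula. -/
theorem integral_schwartz_mul_fourier (φ : 𝓢(ℝ, ℂ)) (f : L2C) :
    ∫ x, φ x * (𝓕 f) x = ∫ x, (𝓕 φ) x * f x := by
  have h : ∀ (φ : 𝓢(ℝ, ℂ)) (f : L2C), ∫ x, φ x * f x = l2Pairing (φ.toLp 2) f := by
    intro φ f
    rw [l2Pairing_apply]
    refine integral_congr_ae ?_
    filter_upwards [φ.coeFn_toLp 2 volume] with x h1
    rw [h1]
  refine SchwartzMap.dense_toLp.induction_on (p := fun f : L2C =>
    ∫ x, φ x * (𝓕 f) x = ∫ x, (𝓕 φ) x * f x) f ?_ ?_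
  · simp only [h]
    exact isClosed_eq (by fun_prop) (by fun_prop)
  · intro ψ
    rw [SchwartzMap.toLp_fourier_eq]
    trans ∫ x, (𝓕 φ) x * ψ x
    · rw [SchwartzMap.integral_fourier_mul_eq]
      refine integral_congr_ae ?_
      filter_upwards [(𝓕 ψ).coeFn_toLp 2 volume] with x h1
      rw [h1]
    · refine integral_congr_ae ?_
      filter_upwards [ψ.coeFn_toLp 2 volume] with x h1
      rw [h1]

theorem integral_schwartz_mul_fourier_of_integrable (φ : 𝓢(ℝ, ℂ)) {f : ℝ → ℂ} (hf : Integrable f) :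
    ∫ x, φ x * 𝓕 f x = ∫ x, (𝓕 φ) x * f x := by
  have h := VectorFourier.integral_fourierIntegral_smul_eq_flip (μ := volume) (ν := volume)
    (L := innerₗ ℝ) Real.continuous_fourierChar continuous_inner φ.integrable hf
  rw [flip_innerₗ] at h
  exact h.symm

theorem L2C.locallyIntegrable (f : L2C) : LocallyIntegrable f :=
  (Lp.memLp f).locallyIntegrable (by norm_num)

theorem continuous_fourier_of_integrable {f : ℝ → ℂ} (hf : Integrable f) : Continuous (𝓕 f) :=
  VectorFourier.fourierIntegral_continuous Real.continuous_fourierChar (by fun_prop) hf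

/-- The Fourier transforms on `L¹` and on `L²` agree. -/
theorem fourier_ae_eq_fourier {f : ℝ → ℂ} (hf : Integrable f) {h : L2C} (hfh : f =ᵐ[volume] h) :
    𝓕 f =ᵐ[volume] (𝓕 h : L2C) := by
  refine ae_eq_of_integral_schwartz_mul_eq
    (continuous_fourier_of_integrable hf).locallyIntegrable (L2C.locallyIntegrable _) fun φ => ?_
  rw [integral_schwartz_mul_fourier, integral_schwartz_mul_fourier_of_integrable φ hf]
  refine integral_congr_ae ?_
  filter_upwards [hfh] with x hx
  rw [hx]

/-- An integrable function whose Fourier transform is that of an `L²` function agrees with it. -/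
theorem ae_eq_of_fourier_ae_eq {f : ℝ → ℂ} (hf : Integrable f) {h : L2C}
    (hfh : 𝓕 f =ᵐ[volume] (𝓕 h : L2C)) : f =ᵐ[volume] h := by
  refine ae_eq_of_integral_schwartz_mul_eq hf.locallyIntegrable (L2C.locallyIntegrable _) fun φ => ?_
  have h₁ := integral_schwartz_mul_fourier (𝓕⁻ φ) h
  have h₂ := integral_schwartz_mul_fourier_of_integrable (𝓕⁻ φ) hf
  rw [fourier_fourierInv_eq] at h₁ h₂
  rw [← h₁, ← h₂]
  refine integral_congr_ae ?_
  filter_upwards [hfh] with x hx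
  rw [hx]

/-! ### Transforms of real-valued functions -/

theorem toComplexL2_ae (f : L2R) : toComplexL2 f =ᵐ[volume] fun x => (f x : ℂ) :=
  ContinuousLinearMap.coeFn_compLp _ f

theorem norm_toComplexL2 (f : L2R) : ‖toComplexL2 f‖ = ‖f‖ := by
  rw [Lp.norm_def, Lp.norm_def]
  congr 1
  refine eLpNorm_congr_norm_ae ?_
  filter_upwards [toComplexL2_ae f] with x hx
  rw [hx, Complex.norm_real]

/-- The Fourier transform of a real-valued `L²` function. -/
def realFourier : L2R →L[ℝ] L2C :=
  ((Lp.fourierTransformₗᵢ ℝ ℂ).toContinuousLinearEquiv.toContinuousLinearMap.restrictScalars ℝ)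
    ∘L Complex.ofRealCLM.compLpL 2 volume

theorem realFourier_apply (f : L2R) : realFourier f = 𝓕 (toComplexL2 f) := rfl

theorem norm_realFourier (f : L2R) : ‖realFourier f‖ = ‖f‖ := by
  rw [realFourier_apply, Lp.norm_fourier_eq, norm_toComplexL2]

theorem realFourier_injective : Function.Injective realFourier := by
  refine (injective_iff_map_eq_zero _).2 fun f hf => ?_
  rw [← norm_eq_zero, ← norm_realFourier, hf, norm_zero]

/-- The conjugate-linear involution `v ↦ conj v(-·)` on `L²`, that is, complex conjugation seen on
the Fourier side. -/
def hermReflect : L2C →L[ℝ] L2C :=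
  ((Lp.fourierTransformₗᵢ ℝ ℂ).toContinuousLinearEquiv.toContinuousLinearMap.restrictScalars ℝ)
    ∘L (Complex.conjCLE : ℂ →L[ℝ] ℂ).compLpL 2 volume
    ∘L ((Lp.fourierTransformₗᵢ ℝ ℂ).symm.toContinuousLinearEquiv.toContinuousLinearMap.restrictScalars ℝ)

theorem hermReflect_fourier (f : L2C) :
    hermReflect (𝓕 f) = 𝓕 ((Complex.conjCLE : ℂ →L[ℝ] ℂ).compLpL 2 volume f : L2C) := by
  change 𝓕 ((Complex.conjCLE : ℂ →L[ℝ] ℂ).compLpL 2 volume (𝓕⁻ (𝓕 f) : L2C)) = _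
  rw [fourierInv_fourier_eq]

/-- For Schwartz functions this is conjugation under the Fourier integral; both sides are continuous
in v, so density gives the rest. -/
theorem coeFn_hermReflect (v : L2C) :
    hermReflect v =ᵐ[volume] fun ξ => (starRingEnd ℂ) (v (-ξ)) := by
  let neg : L2C →ₗᵢ[ℂ] L2C :=
    Lp.compMeasurePreservingₗᵢ ℂ (fun η : ℝ => -η) (Measure.measurePreserving_neg volume)
  have hneg : ∀ v : L2C, neg v =ᵐ[volume] fun ξ => v (-ξ) := fun v =>
    Lp.coeFn_compMeasurePreserving v (Measure.measurePreserving_neg volume)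
  have hconj : ∀ v : L2C, (Complex.conjCLE : ℂ →L[ℝ] ℂ).compLpL 2 volume v =ᵐ[volume]
      fun ξ => (starRingEnd ℂ) (v ξ) := fun v => ContinuousLinearMap.coeFn_compLpL _ v
  have key : ∀ v : L2C,
      hermReflect v = (Complex.conjCLE : ℂ →L[ℝ] ℂ).compLpL 2 volume (neg v) := by
    intro v
    obtain ⟨f, rfl⟩ : ∃ f : L2C, 𝓕 f = v := ⟨𝓕⁻ v, by simp⟩
    refine SchwartzMap.dense_toLp.induction_on (p := fun f : L2C =>
      hermReflect (𝓕 f) = (Complex.conjCLE : ℂ →L[ℝ] ℂ).compLpL 2 volume (neg (𝓕 f))) f ?_ ?_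
    · have := (Lp.fourierTransformₗᵢ ℝ ℂ).continuous
      exact isClosed_eq (hermReflect.continuous.comp this)
        ((ContinuousLinearMap.continuous _).comp (neg.continuous.comp this))
    · intro φ
      rw [hermReflect_fourier]
      refine Lp.ext ?_
      have h₁ : Integrable fun x => (starRingEnd ℂ) (φ x) :=
        (Complex.conjCLE : ℂ →L[ℝ] ℂ).integrable_comp φ.integrable
      refine (fourier_ae_eq_fourier h₁ ?_).symm.trans ?_
      · filter_upwards [hconj (φ.toLp 2), φ.coeFn_toLp 2 volume] with x h2 h3
        rw [h2, h3]
      · rw [SchwartzMap.toLp_fourier_eq]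
        filter_upwards [hconj (neg ((𝓕 φ).toLp 2)), hneg ((𝓕 φ).toLp 2),
          (Measure.measurePreserving_neg volume).quasiMeasurePreserving.ae
            ((𝓕 φ).coeFn_toLp 2 volume)] with ξ h2 h3 h4
        rw [h2, h3, h4, SchwartzMap.fourier_coe, Real.fourier_real_eq_integral_exp_smul,
          Real.fourier_real_eq_integral_exp_smul, ← integral_conj]
        refine integral_congr_ae (.of_forall fun x => ?_)
        simp only [smul_eq_mul, map_mul, ← Complex.exp_conj, Complex.conj_I, Complex.conj_ofReal]
        congr 2
        push_cast
        ring
  rw [key]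
  filter_upwards [hconj (neg v), hneg v] with ξ h2 h3
  rw [h2, h3]

theorem hermReflect_realFourier (f : L2R) : hermReflect (realFourier f) = realFourier f := by
  rw [realFourier_apply, hermReflect_fourier]
  congr 1
  refine Lp.ext ?_
  filter_upwards [ContinuousLinearMap.coeFn_compLpL (p := 2) (μ := volume)
      (Complex.conjCLE : ℂ →L[ℝ] ℂ) (toComplexL2 f), toComplexL2_ae f] with x hx h2
  rw [hx, h2]
  simp

/-- Hermitian symmetry says that the inverse transform equals its conjugate, so its real part is the
required function. This is what brings solutions found on the Fourier side back to real-valued ones.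
-/
theorem exists_realFourier_eq {v : L2C} (hv : hermReflect v = v) : ∃ f : L2R, realFourier f = v := by
  refine ⟨Complex.reCLM.compLpL 2 volume (𝓕⁻ v : L2C), ?_⟩
  have h : (Complex.conjCLE : ℂ →L[ℝ] ℂ).compLpL 2 volume (𝓕⁻ v : L2C) = 𝓕⁻ v := by
    have h2 := hermReflect_fourier (𝓕⁻ v)
    rw [fourier_fourierInv_eq, hv] at h2
    have h3 := congrArg (fun w : L2C => (𝓕⁻ w : L2C)) h2
    simp only [fourierInv_fourier_eq] at h3
    exact h3.symm
  rw [realFourier_apply]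
  conv_rhs => rw [← fourier_fourierInv_eq (F := L2C) (E := L2C) v]
  congr 1
  refine Lp.ext ?_
  filter_upwards [toComplexL2_ae (Complex.reCLM.compLpL 2 volume (𝓕⁻ v : L2C)),
    ContinuousLinearMap.coeFn_compLpL (p := 2) (μ := volume) Complex.reCLM (𝓕⁻ v : L2C),
    ContinuousLinearMap.coeFn_compLpL (p := 2) (μ := volume)
      (Complex.conjCLE : ℂ →L[ℝ] ℂ) (𝓕⁻ v : L2C)] with x h1 h2 h3
  rw [h] at h3
  rw [h1, h2]
  exact Complex.conj_eq_iff_re.mp h3.symm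

/-! ### Duhamel's formula on the Fourier side and its stability -/

/-- Duhamel's formula for the viscous Burgers equation on the Fourier side (`c = 4π²ε`), for
solutions on `[0, T]` and with the frequencies restricted to `S`. -/
structure IsFourierMild (c : ℝ) (S : Set ℝ) (T : ℝ) (u : L2C) (p : ℝ → L2C) : Prop where
  continuousOn : ContinuousOn p (Icc 0 T)
  duhamel : ∀ t ∈ Icc 0 T, ∀ᵐ ξ : ℝ, p t ξ = S.indicator (fun ξ =>
    Real.exp (-(c * ξ ^ 2) * t) • u ξ - (Real.pi * ξ * Complex.I) *
      ∫ s in (0 : ℝ)..t, Real.exp (-(c * ξ ^ 2) * (t - s)) • cconv (p s) (p s) ξ) ξ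

/-- The gain 1/(r + l) of the heat factor against a source growing like e^{ls}. It is used with r =
cξ², with l > 0 for the self-absorbing estimate and l = 0 for the frequency tail. -/
theorem norm_integral_exp_smul_le {r l t G : ℝ} (hrl : 0 < r + l) (ht : 0 ≤ t) (hG : 0 ≤ G)
    {g : ℝ → ℂ} (hg : ∀ s ∈ Icc 0 t, ‖g s‖ ≤ G * Real.exp (l * s)) :
    ‖∫ s in (0 : ℝ)..t, Real.exp (-r * (t - s)) • g s‖ ≤ G * Real.exp (l * t) / (r + l) := by
  have h₁ : ‖∫ s in (0 : ℝ)..t, Real.exp (-r * (t - s)) • g s‖ ≤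
      ∫ s in (0 : ℝ)..t, G * Real.exp (-r * t) * Real.exp ((r + l) * s) := by
    refine intervalIntegral.norm_integral_le_of_norm_le ht (.of_forall fun s hs => ?_)
      ((by fun_prop : Continuous fun s => G * Real.exp (-r * t) * Real.exp ((r + l) * s)
        ).intervalIntegrable 0 t)
    rw [norm_smul, Real.norm_eq_abs, abs_of_pos (Real.exp_pos _)]
    calc _ ≤ Real.exp (-r * (t - s)) * (G * Real.exp (l * s)) := by
          gcongr; exact hg s ⟨hs.1.le, hs.2⟩
      _ = G * (Real.exp (-r * (t - s)) * Real.exp (l * s)) := by ring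
      _ = G * (Real.exp (-r * t) * Real.exp ((r + l) * s)) := by
          rw [← Real.exp_add, ← Real.exp_add]; ring_nf
      _ = _ := by ring
  refine h₁.trans ?_
  rw [intervalIntegral.integral_const_mul, intervalIntegral.integral_comp_mul_left _ hrl.ne',
    integral_exp, mul_zero, Real.exp_zero, smul_eq_mul]
  have h₂ : Real.exp (-r * t) * Real.exp ((r + l) * t) = Real.exp (l * t) := by
    rw [← Real.exp_add]; ring_nf
  rw [le_div_iff₀ hrl]
  calc _ = G * (Real.exp (-r * t) * Real.exp ((r + l) * t) - Real.exp (-r * t)) := by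
        field_simp
    _ ≤ G * Real.exp (l * t) := by
        rw [h₂]
        gcongr
        linarith [Real.exp_pos (-r * t)]

theorem integrable_inv_add_sq {k : ℝ} (hk : 0 < k) : Integrable fun ξ : ℝ => (k ^ 2 + ξ ^ 2)⁻¹ := by
  have h := (integrable_inv_one_add_sq.comp_mul_left' (inv_ne_zero hk.ne')).const_mul (k ^ 2)⁻¹
  refine h.congr (.of_forall fun ξ => ?_)
  simp only
  field_simp

theorem integral_inv_add_sq {k : ℝ} (hk : 0 < k) : ∫ ξ : ℝ, (k ^ 2 + ξ ^ 2)⁻¹ = Real.pi / k := by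
  have h : ∀ ξ : ℝ, (k ^ 2 + ξ ^ 2)⁻¹ = (k ^ 2)⁻¹ * (1 + (k⁻¹ * ξ) ^ 2)⁻¹ := fun ξ => by field_simp
  simp only [h]
  rw [integral_const_mul, Measure.integral_comp_mul_left (fun x : ℝ => (1 + x ^ 2)⁻¹),
    integral_univ_inv_one_add_sq, abs_of_pos (by positivity), smul_eq_mul]
  field_simp

theorem lintegral_inv_add_sq {k : ℝ} (hk : 0 < k) :
    ∫⁻ ξ : ℝ, ENNReal.ofReal (k ^ 2 + ξ ^ 2)⁻¹ = ENNReal.ofReal (Real.pi / k) := by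
  rw [← integral_inv_add_sq hk, ofReal_integral_eq_lintegral_ofReal (integrable_inv_add_sq hk)]
  exact .of_forall fun ξ => by positivity

theorem eLpNorm_two_sq {α : Type*} [MeasurableSpace α] {F : Type*} [NormedAddCommGroup F]
    (f : α → F) (μ : Measure α) :
    eLpNorm f 2 μ ^ 2 = ∫⁻ x, ‖f x‖ₑ ^ 2 ∂μ := by
  rw [eLpNorm_eq_lintegral_rpow_enorm_toReal (by norm_num) (by norm_num),
    ← ENNReal.rpow_natCast, ← ENNReal.rpow_mul]
  simp

/-- The `L²` norm of `ξ / (cξ² + l)` is small for large `l`. -/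
theorem exists_eLpNorm_abs_div_le {c δ : ℝ} (hc : 0 < c) (hδ : 0 < δ) :
    ∃ l : ℝ, 0 < l ∧
      eLpNorm (fun ξ : ℝ => |ξ| / (c * ξ ^ 2 + l)) 2 volume ≤ ENNReal.ofReal δ := by
  -- With l = ck² the squared integrand is at most c⁻²/(k² + ξ²), whose integral π/(c²k) equals δ²
  -- for this k.
  set k : ℝ := Real.pi / (c ^ 2 * δ ^ 2) with hk_def
  have hk : 0 < k := by positivity
  refine ⟨c * k ^ 2, by positivity, ?_⟩
  rw [← ENNReal.pow_le_pow_left_iff (two_ne_zero), eLpNorm_two_sq]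
  calc _ ≤ ∫⁻ ξ : ℝ, ENNReal.ofReal (c ^ 2)⁻¹ * ENNReal.ofReal (k ^ 2 + ξ ^ 2)⁻¹ := by
        refine lintegral_mono fun ξ => ?_
        rw [← ENNReal.ofReal_mul (by positivity), Real.enorm_eq_ofReal (by positivity),
          ← ENNReal.ofReal_pow (by positivity)]
        refine ENNReal.ofReal_le_ofReal ?_
        rw [div_pow, sq_abs, ← mul_inv, ← one_div, div_le_div_iff₀ (by positivity) (by positivity)]
        have : (c * ξ ^ 2 + c * k ^ 2) ^ 2 = c ^ 2 * (k ^ 2 + ξ ^ 2) * (k ^ 2 + ξ ^ 2) := by ring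
        rw [this, mul_comm, one_mul]
        gcongr
        nlinarith [sq_nonneg k]
    _ = _ := by
        rw [lintegral_const_mul _ (by fun_prop), lintegral_inv_add_sq hk,
          ← ENNReal.ofReal_mul (by positivity), ← ENNReal.ofReal_pow (by positivity), hk_def]
        congr 1
        field_simp

/-- A bound for the contribution of the frequencies beyond `N`. -/
def highFreq (c R : ℝ) (u : L2C) (N : ℝ) : ℝ → ℝ :=
  {ξ : ℝ | N < |ξ|}.indicator fun ξ => ‖u ξ‖ + Real.pi * R ^ 2 / (c * |ξ|)

theorem IsFourierMild.continuousOn_cconv {c T : ℝ} {S : Set ℝ} {u : L2C} {p : ℝ → L2C}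
    (hp : IsFourierMild c S T u p) (ξ : ℝ) :
    ContinuousOn (fun s => cconv (p s) (p s) ξ) (Icc 0 T) :=
  (continuous_cconv_apply ξ).comp_continuousOn (hp.continuousOn.prodMk hp.continuousOn)

/-- The time integral of the heat factor gains 1/(cξ²) and the derivative loses |ξ|; the resulting
decay 1/|ξ| is square integrable at infinity. -/
theorem norm_mul_integral_exp_cconv_le {c R t ξ : ℝ} {p : ℝ → L2C} (hc : 0 < c) (hξ : ξ ≠ 0)
    (ht : 0 ≤ t) (hpR : ∀ s ∈ Icc 0 t, ‖p s‖ ≤ R) :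
    ‖(Real.pi * ξ * Complex.I) *
      ∫ s in (0 : ℝ)..t, Real.exp (-(c * ξ ^ 2) * (t - s)) • cconv (p s) (p s) ξ‖
      ≤ Real.pi * R ^ 2 / (c * |ξ|) := by
  have hR : 0 ≤ R := (norm_nonneg _).trans (hpR 0 ⟨le_rfl, ht⟩)
  have h := norm_integral_exp_smul_le (r := c * ξ ^ 2) (l := 0) (G := R ^ 2)
    (g := fun s => cconv (p s) (p s) ξ) (by positivity) ht (by positivity) (fun s hs => by
      simp only [zero_mul, Real.exp_zero, mul_one]
      refine (norm_cconv_le _ _ _).trans ?_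
      rw [sq]
      gcongr <;> exact hpR s hs)
  rw [norm_mul, norm_mul, norm_mul, Complex.norm_I, Complex.norm_real, Complex.norm_real,
    Real.norm_eq_abs, Real.norm_eq_abs, abs_of_pos Real.pi_pos]
  have hξ' : 0 < |ξ| := abs_pos.mpr hξ
  calc _ ≤ Real.pi * |ξ| * 1 * (R ^ 2 * Real.exp (0 * t) / (c * ξ ^ 2 + 0)) := by gcongr
    _ = _ := by
      rw [← sq_abs ξ, zero_mul, Real.exp_zero]
      field_simp
      ring

/-- A frequency kept by both truncations sees only the difference of the quadratic terms. A
frequency kept by just one lies beyond N, where that solution alone is bounded by `highFreq`. -/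
theorem IsFourierMild.norm_apply_sub_le {c R T N l M t ξ : ℝ} {S₁ S₂ : Set ℝ} {u : L2C}
    {p q : ℝ → L2C} (hc : 0 < c) (hl : 0 < l) (hM : 0 ≤ M)
    (hN : 0 < N) (hS₁ : Icc (-N) N ⊆ S₁) (hS₂ : Icc (-N) N ⊆ S₂)
    (hp : IsFourierMild c S₁ T u p) (hq : IsFourierMild c S₂ T u q)
    (hpR : ∀ s ∈ Icc 0 T, ‖p s‖ ≤ R) (hqR : ∀ s ∈ Icc 0 T, ‖q s‖ ≤ R)
    (hd : ∀ s ∈ Icc 0 T, ‖p s - q s‖ ≤ M * Real.exp (l * s)) (ht : t ∈ Icc 0 T)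
    (hpξ : p t ξ = S₁.indicator (fun ξ =>
      Real.exp (-(c * ξ ^ 2) * t) • u ξ - (Real.pi * ξ * Complex.I) *
        ∫ s in (0 : ℝ)..t, Real.exp (-(c * ξ ^ 2) * (t - s)) • cconv (p s) (p s) ξ) ξ)
    (hqξ : q t ξ = S₂.indicator (fun ξ =>
      Real.exp (-(c * ξ ^ 2) * t) • u ξ - (Real.pi * ξ * Complex.I) *
        ∫ s in (0 : ℝ)..t, Real.exp (-(c * ξ ^ 2) * (t - s)) • cconv (q s) (q s) ξ) ξ) :
    ‖p t ξ - q t ξ‖ ≤ highFreq c R u N ξ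
      + 2 * Real.pi * R * M * Real.exp (l * t) * (|ξ| / (c * ξ ^ 2 + l)) := by
  have hR : 0 ≤ R := (norm_nonneg _).trans (hpR t ht)
  have htT : Icc 0 t ⊆ Icc 0 T := Icc_subset_Icc le_rfl ht.2
  have hhigh : 0 ≤ highFreq c R u N ξ := indicator_nonneg (fun ξ _ => by positivity) ξ
  have hrest : 0 ≤ 2 * Real.pi * R * M * Real.exp (l * t) * (|ξ| / (c * ξ ^ 2 + l)) := by
    positivity
  have hexp : Real.exp (-(c * ξ ^ 2) * t) ≤ 1 := by
    rw [Real.exp_le_one_iff]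
    nlinarith [mul_nonneg (mul_nonneg hc.le (sq_nonneg ξ)) ht.1]
  have hsingle : ∀ (S : Set ℝ) (r : ℝ → L2C), (∀ s ∈ Icc 0 T, ‖r s‖ ≤ R) → ξ ∉ Icc (-N) N →
      ‖Real.exp (-(c * ξ ^ 2) * t) • u ξ - (Real.pi * ξ * Complex.I) *
        ∫ s in (0 : ℝ)..t, Real.exp (-(c * ξ ^ 2) * (t - s)) • cconv (r s) (r s) ξ‖
        ≤ highFreq c R u N ξ := by
    intro S r hr hξN
    have hNξ : N < |ξ| := by
      by_contra h
      exact hξN (abs_le.mp (not_lt.mp h))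
    have hξ : ξ ≠ 0 := abs_pos.mp (hN.trans hNξ)
    rw [highFreq, indicator_of_mem (by exact hNξ)]
    refine (norm_sub_le _ _).trans (add_le_add ?_
      (norm_mul_integral_exp_cconv_le hc hξ ht.1 fun s hs => hr s (htT hs)))
    rw [norm_smul, Real.norm_eq_abs, abs_of_pos (Real.exp_pos _)]
    exact mul_le_of_le_one_left (norm_nonneg _) hexp
  by_cases h₁ : ξ ∈ S₁ <;> by_cases h₂ : ξ ∈ S₂
  · rw [hpξ, hqξ, indicator_of_mem h₁, indicator_of_mem h₂]
    have hint : ∀ r : ℝ → L2C, ContinuousOn (fun s => cconv (r s) (r s) ξ) (Icc 0 T) →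
        IntervalIntegrable (fun s => Real.exp (-(c * ξ ^ 2) * (t - s)) • cconv (r s) (r s) ξ)
          volume 0 t := by
      intro r hr
      refine ContinuousOn.intervalIntegrable ?_
      rw [uIcc_of_le ht.1]
      exact (by fun_prop : Continuous fun s => Real.exp (-(c * ξ ^ 2) * (t - s))).continuousOn.smul
        (hr.mono htT)
    rw [sub_sub_sub_cancel_left, ← mul_sub, ← intervalIntegral.integral_sub
      (hint q (hq.continuousOn_cconv ξ)) (hint p (hp.continuousOn_cconv ξ))]
    simp only [← smul_sub]
    have h := norm_integral_exp_smul_le (r := c * ξ ^ 2) (l := l) (G := 2 * R * M)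
      (g := fun s => cconv (q s) (q s) ξ - cconv (p s) (p s) ξ) (by positivity) ht.1 (by positivity)
      (fun s hs => by
        refine (norm_cconv_self_sub_le _ _ _).trans ?_
        rw [norm_sub_rev (q s), mul_assoc]
        refine mul_le_mul ?_ (hd s (htT hs)) (norm_nonneg _) (by positivity)
        linarith [hpR s (htT hs), hqR s (htT hs)])
    refine le_trans ?_ (le_add_of_nonneg_left hhigh)
    rw [norm_mul, norm_mul, norm_mul, Complex.norm_I, Complex.norm_real, Complex.norm_real,
      Real.norm_eq_abs, Real.norm_eq_abs, abs_of_pos Real.pi_pos]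
    calc _ ≤ Real.pi * |ξ| * 1 * (2 * R * M * Real.exp (l * t) / (c * ξ ^ 2 + l)) := by gcongr
      _ = _ := by ring
  · rw [hpξ, hqξ, indicator_of_mem h₁, indicator_of_notMem h₂, sub_zero]
    exact (hsingle S₁ p hpR fun h => h₂ (hS₂ h)).trans (le_add_of_nonneg_right hrest)
  · rw [hpξ, hqξ, indicator_of_notMem h₁, indicator_of_mem h₂, zero_sub, norm_neg]
    exact (hsingle S₂ q hqR fun h => h₁ (hS₁ h)).trans (le_add_of_nonneg_right hrest)
  · rw [hpξ, hqξ, indicator_of_notMem h₁, indicator_of_notMem h₂, sub_zero, norm_zero]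
    positivity

/-- Beyond N > 0 the function 1/|ξ| is at most √2 (N² + ξ²)^{-1/2}. -/
theorem memLp_highFreq {c R : ℝ} (hc : 0 < c) (u : L2C) {N : ℝ} (hN : 0 < N) :
    MemLp (highFreq c R u N) 2 := by
  have hmeas : MeasurableSet {ξ : ℝ | N < |ξ|} := measurableSet_lt (by fun_prop) (by fun_prop)
  have h₁ : MemLp (fun ξ : ℝ => √((N ^ 2 + ξ ^ 2)⁻¹)) 2 := by
    rw [memLp_two_iff_integrable_sq (by fun_prop)]
    refine (integrable_inv_add_sq hN).congr (.of_forall fun ξ => ?_)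
    simp only
    rw [Real.sq_sqrt (by positivity)]
  have h₂ : MemLp ({ξ : ℝ | N < |ξ|}.indicator fun ξ : ℝ => |ξ|⁻¹) 2 := by
    refine h₁.of_le_mul (c := √2) ((by fun_prop : Measurable fun ξ : ℝ => |ξ|⁻¹).indicator
      hmeas).aestronglyMeasurable (.of_forall fun ξ => ?_)
    by_cases hξ : ξ ∈ {ξ : ℝ | N < |ξ|}
    · have hξ' : N < |ξ| := hξ
      have hpos : 0 < |ξ| := hN.trans hξ'
      rw [indicator_of_mem hξ, Real.norm_of_nonneg (by positivity),
        Real.norm_of_nonneg (by positivity), ← Real.sqrt_mul (by norm_num)]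
      refine Real.le_sqrt_of_sq_le ?_
      rw [inv_pow, sq_abs, ← div_eq_mul_inv, ← one_div, div_le_div_iff₀ (by nlinarith [sq_abs ξ])
        (by positivity)]
      nlinarith [sq_abs ξ]
    · rw [indicator_of_notMem hξ, norm_zero]
      positivity
  have h₃ : highFreq c R u N = ({ξ : ℝ | N < |ξ|}.indicator fun ξ => ‖u ξ‖)
      + (Real.pi * R ^ 2 / c) • {ξ : ℝ | N < |ξ|}.indicator fun ξ : ℝ => |ξ|⁻¹ := by
    ext ξ
    by_cases hξ : ξ ∈ {ξ : ℝ | N < |ξ|}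
    · simp only [highFreq, indicator_of_mem hξ, Pi.add_apply, Pi.smul_apply, smul_eq_mul]
      congr 1
      field_simp
    · simp only [highFreq, indicator_of_notMem hξ, Pi.add_apply, Pi.smul_apply, smul_eq_mul]
      ring
  rw [h₃]
  exact ((Lp.memLp u).norm.indicator hmeas).add (h₂.const_smul _)

theorem tendsto_eLpNorm_highFreq {c R : ℝ} (hc : 0 < c) (u : L2C) :
    Filter.Tendsto (fun N => eLpNorm (highFreq c R u N) 2 volume) Filter.atTop (nhds 0) := by
  have hlim : Filter.Tendsto (fun N => ∫⁻ ξ, ‖highFreq c R u N ξ‖ₑ ^ 2) Filter.atTop (nhds 0) := by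
    have h := tendsto_lintegral_filter_of_dominated_convergence (μ := volume)
      (l := (Filter.atTop : Filter ℝ))
      (F := fun N ξ => ‖highFreq c R u N ξ‖ₑ ^ 2) (f := fun _ => 0)
      (fun ξ => ‖highFreq c R u 1 ξ‖ₑ ^ 2) ?_ ?_ ?_ ?_
    · simpa using h
    · filter_upwards [Filter.eventually_gt_atTop 0] with N hN
      exact (((Lp.stronglyMeasurable u).measurable.norm.add (by fun_prop)).indicator
        (measurableSet_lt (by fun_prop) (by fun_prop))).enorm.pow_const 2
    · filter_upwards [Filter.eventually_ge_atTop 1] with N hN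
      refine .of_forall fun ξ => ?_
      have : ‖highFreq c R u N ξ‖ₑ ≤ ‖highFreq c R u 1 ξ‖ₑ :=
        enorm_indicator_le_of_subset (fun ξ (hξ : N < |ξ|) => hN.trans_lt hξ) _ _
      gcongr
    · rw [← eLpNorm_two_sq]
      exact ENNReal.pow_ne_top (memLp_highFreq hc u one_pos).eLpNorm_ne_top
    · refine .of_forall fun ξ => tendsto_const_nhds.congr' ?_
      filter_upwards [Filter.eventually_ge_atTop |ξ|] with N hN
      rw [highFreq, indicator_of_notMem (by simpa using hN)]
      simp
  have h := (ENNReal.continuous_rpow_const (y := 1 / 2)).tendsto 0 |>.comp hlim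
  simp only [one_div, ENNReal.zero_rpow_of_pos (by norm_num : (0 : ℝ) < 2⁻¹)] at h
  refine h.congr fun N => ?_
  simp only [Function.comp, ← eLpNorm_two_sq]
  rw [← ENNReal.rpow_natCast, ← ENNReal.rpow_mul]
  norm_num

/-- The constant depends only on c, R and T, not on the cutoffs nor on the datum. Thus N → ∞ gives
uniqueness for untruncated solutions, and a Cauchy estimate uniform in time for truncated ones. -/
theorem IsFourierMild.exists_norm_sub_le {c R T : ℝ} (hc : 0 < c) (hR : 0 ≤ R) (hT : 0 ≤ T) :
    ∃ K : ℝ, 0 < K ∧ ∀ (N : ℝ) (S₁ S₂ : Set ℝ) (u : L2C) (p q : ℝ → L2C), 0 < N →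
      Icc (-N) N ⊆ S₁ → Icc (-N) N ⊆ S₂ → IsFourierMild c S₁ T u p → IsFourierMild c S₂ T u q →
      (∀ s ∈ Icc 0 T, ‖p s‖ ≤ R) → (∀ s ∈ Icc 0 T, ‖q s‖ ≤ R) →
      ∀ t ∈ Icc 0 T, ‖p t - q t‖ ≤ K * (eLpNorm (highFreq c R u N) 2 volume).toReal := by
  -- The bound 1/(4π(R + 1)) turns the factor 2πR of the quadratic difference into at most 1/2.
  obtain ⟨l, hl, hlδ⟩ := exists_eLpNorm_abs_div_le hc
    (show (0 : ℝ) < 1 / (4 * Real.pi * (R + 1)) by positivity)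
  refine ⟨2 * Real.exp (l * T), by positivity, ?_⟩
  intro N S₁ S₂ u p q hN hS₁ hS₂ hp hq hpR hqR
  set δ := (eLpNorm (highFreq c R u N) 2 volume).toReal with hδ
  have hcont : ContinuousOn (fun s => Real.exp (-(l * s)) * ‖p s - q s‖) (Icc 0 T) :=
    (by fun_prop : Continuous fun s => Real.exp (-(l * s))).continuousOn.mul
      (hp.continuousOn.sub hq.continuousOn).norm
  -- M is the maximum of the difference in the norm weighted by e^{-ls}; it exists by continuity on
  -- a compact interval.
  obtain ⟨t₀, ht₀, hmax⟩ := isCompact_Icc.exists_isMaxOn ⟨0, left_mem_Icc.mpr hT⟩ hcont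
  set M := Real.exp (-(l * t₀)) * ‖p t₀ - q t₀‖ with hM
  have hM0 : 0 ≤ M := by positivity
  have hd : ∀ s ∈ Icc 0 T, ‖p s - q s‖ ≤ M * Real.exp (l * s) := by
    intro s hs
    have h : Real.exp (-(l * s)) * ‖p s - q s‖ ≤ M := hmax hs
    rw [Real.exp_neg, inv_mul_le_iff₀ (Real.exp_pos _)] at h
    linarith
  have hest : ∀ t ∈ Icc 0 T, ‖p t - q t‖ ≤ δ + M / 2 * Real.exp (l * t) := by
    intro t ht
    set B : ℝ := 2 * Real.pi * R * M * Real.exp (l * t) with hB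
    have hB0 : 0 ≤ B := by positivity
    have h₁ : eLpNorm (p t - q t : L2C) 2 volume ≤ eLpNorm (highFreq c R u N) 2 volume
        + ENNReal.ofReal B * ENNReal.ofReal (1 / (4 * Real.pi * (R + 1))) := by
      calc _ ≤ eLpNorm (highFreq c R u N + B • fun ξ : ℝ => |ξ| / (c * ξ ^ 2 + l)) 2 volume := by
            refine eLpNorm_mono_ae_real ?_
            filter_upwards [Lp.coeFn_sub (p t) (q t), hp.duhamel t ht, hq.duhamel t ht]
              with ξ h1 h2 h3
            rw [h1]
            exact IsFourierMild.norm_apply_sub_le hc hl hM0 hN hS₁ hS₂ hp hq hpR hqR hd ht h2 h3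
        _ ≤ _ := by
            refine (eLpNorm_add_le (memLp_highFreq hc u hN).aestronglyMeasurable
              (by fun_prop) (by norm_num)).trans ?_
            gcongr
            rw [eLpNorm_const_smul, Real.enorm_eq_ofReal hB0]
            gcongr
    rw [Lp.norm_def]
    refine (ENNReal.toReal_mono ?_ h₁).trans ?_
    · exact ENNReal.add_ne_top.mpr ⟨(memLp_highFreq hc u hN).eLpNorm_ne_top, by finiteness⟩
    · rw [ENNReal.toReal_add (memLp_highFreq hc u hN).eLpNorm_ne_top (by finiteness),
        ENNReal.toReal_mul, ENNReal.toReal_ofReal hB0, ENNReal.toReal_ofReal (by positivity)]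
      refine add_le_add le_rfl ?_
      rw [hB, mul_one_div, div_le_iff₀ (by positivity)]
      have : 0 ≤ Real.pi * M * Real.exp (l * t) := by positivity
      nlinarith
  -- At the maximizing time the estimate reads M ≤ δ + M/2.
  have hMδ : M ≤ 2 * δ := by
    have h := hest t₀ ht₀
    have h2 : M ≤ Real.exp (-(l * t₀)) * (δ + M / 2 * Real.exp (l * t₀)) := by rw [hM]; gcongr
    have h3 : Real.exp (-(l * t₀)) * Real.exp (l * t₀) = 1 := by rw [← Real.exp_add]; simp
    have h4 : Real.exp (-(l * t₀)) ≤ 1 := by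
      rw [Real.exp_le_one_iff]; nlinarith [ht₀.1]
    have h5 : Real.exp (-(l * t₀)) * δ ≤ δ := mul_le_of_le_one_left ENNReal.toReal_nonneg h4
    nlinarith
  intro t ht
  calc ‖p t - q t‖ ≤ M * Real.exp (l * t) := hd t ht
    _ ≤ 2 * δ * Real.exp (l * T) := by gcongr; exact ht.2
    _ = _ := by ring

/-! ### A dissipative quadratic differential equation in a Hilbert space -/

section AbstractODE

variable {E : Type*} [NormedAddCommGroup E] [InnerProductSpace ℝ E]

/-- The radial retraction of a normed space onto the ball of radius `R`. -/
def radialRetract (R : ℝ) (v : E) : E := (R / max R ‖v‖) • v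

theorem radialRetract_of_le {R : ℝ} (hR : 0 < R) {v : E} (hv : ‖v‖ ≤ R) :
    radialRetract R v = v := by
  rw [radialRetract, max_eq_left hv, div_self hR.ne', one_smul]

theorem norm_radialRetract_le {R : ℝ} (hR : 0 < R) (v : E) : ‖radialRetract R v‖ ≤ R := by
  have hm : 0 < max R ‖v‖ := lt_max_of_lt_left hR
  rw [radialRetract, norm_smul, Real.norm_of_nonneg (by positivity), div_mul_eq_mul_div,
    div_le_iff₀ hm]
  gcongr
  exact le_max_right _ _

/-- The scaling factor itself depends on the point, which accounts for the second ‖v - w‖; any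
Lipschitz constant is enough here. -/
theorem norm_radialRetract_sub_le {R : ℝ} (hR : 0 < R) (v w : E) :
    ‖radialRetract R v - radialRetract R w‖ ≤ 2 * ‖v - w‖ := by
  have hv : 0 < max R ‖v‖ := lt_max_of_lt_left hR
  have hw : 0 < max R ‖w‖ := lt_max_of_lt_left hR
  have h : radialRetract R v - radialRetract R w
      = (R / max R ‖v‖) • (v - w) + (R / max R ‖v‖ - R / max R ‖w‖) • w := by
    rw [radialRetract, radialRetract]; module
  rw [h, two_mul]
  refine (norm_add_le _ _).trans (add_le_add ?_ ?_)
  · rw [norm_smul, Real.norm_of_nonneg (by positivity)]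
    exact mul_le_of_le_one_left (norm_nonneg _) ((div_le_one hv).mpr (le_max_left _ _))
  · have h₁ : R / max R ‖v‖ - R / max R ‖w‖
        = (max R ‖w‖ - max R ‖v‖) * (R / (max R ‖v‖ * max R ‖w‖)) := by field_simp
    have h₂ : |max R ‖w‖ - max R ‖v‖| ≤ ‖v - w‖ := by
      refine (abs_max_sub_max_le_max _ _ _ _).trans ?_
      rw [sub_self, abs_zero, max_eq_right (abs_nonneg _), norm_sub_rev]
      exact abs_norm_sub_norm_le _ _
    rw [norm_smul, h₁, norm_mul, Real.norm_eq_abs, Real.norm_of_nonneg (by positivity), mul_assoc]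
    have h₃ : R / (max R ‖v‖ * max R ‖w‖) * ‖w‖ ≤ 1 := by
      rw [div_mul_eq_mul_div, div_le_one (by positivity)]
      exact mul_le_mul (le_max_left _ _) (le_max_right _ _) (norm_nonneg _) hv.le
    calc _ ≤ ‖v - w‖ * 1 := by gcongr
      _ = _ := mul_one _

/-- Global existence for a quadratic ordinary differential equation that leaves the range of the
projection `P` invariant and dissipates the norm on it. -/
theorem exists_solution_of_dissipative [CompleteSpace E] (A : E →L[ℝ] E) (B : E →L[ℝ] E →L[ℝ] E)
    (P : E →L[ℝ] E) (hPP : ∀ x, P (P x) = P x)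
    (hA : ∀ x, P x = x → P (A x) = A x) (hB : ∀ x, P x = x → P (B x x) = B x x)
    (hdiss : ∀ x, P x = x → inner ℝ x (A x + B x x) ≤ 0)
    {u : E} (hu : P u = u) {T : ℝ} (hT : 0 ≤ T) :
    ∃ y : ℝ → E, y 0 = u ∧ ∀ t ∈ Icc 0 T,
      HasDerivWithinAt y (A (y t) + B (y t) (y t)) (Icc 0 T) t ∧ P (y t) = y t ∧ ‖y t‖ ≤ ‖u‖ := by
  -- The retraction divides by its radius ‖u‖, so a zero datum is treated apart.
  rcases eq_or_ne u 0 with rfl | hu0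
  · refine ⟨fun _ => 0, rfl, fun t _ => ⟨?_, map_zero P, le_rfl⟩⟩
    simpa using hasDerivWithinAt_const t (Icc 0 T) (0 : E)
  have hR : 0 < ‖u‖ := norm_pos_iff.mpr hu0
  set R := ‖u‖ with hR_def
  -- Composing the vector field with the projection and the retraction makes it globally bounded and
  -- Lipschitz, so that Picard-Lindelöf applies on all of [0, T].
  set x : E → E := fun v => radialRetract R (P v) with hx
  have hPx : ∀ v, P (x v) = x v := fun v => by simp only [hx, radialRetract, map_smul, hPP]
  have hxR : ∀ v, ‖x v‖ ≤ R := fun v => norm_radialRetract_le hR _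
  set f : E → E := fun v => A (x v) + B (x v) (x v) with hf
  set L : ℝ := ‖A‖ * R + ‖B‖ * R * R with hL
  have hL0 : 0 ≤ L := by positivity
  have hfL : ∀ v, ‖f v‖ ≤ L := by
    intro v
    refine (norm_add_le _ _).trans (add_le_add ?_ ?_)
    · exact A.le_opNorm_of_le (hxR v)
    · refine (B.le_opNorm₂ _ _).trans ?_
      gcongr <;> exact hxR v
  set K : ℝ := (‖A‖ + 2 * ‖B‖ * R) * (2 * ‖P‖) with hK
  have hK0 : 0 ≤ K := by positivity
  have hfK : LipschitzWith K.toNNReal f := by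
    refine LipschitzWith.of_dist_le_mul fun v w => ?_
    rw [dist_eq_norm, dist_eq_norm, Real.coe_toNNReal _ hK0]
    have hxx : ‖x v - x w‖ ≤ 2 * ‖P‖ * ‖v - w‖ := by
      refine (norm_radialRetract_sub_le hR _ _).trans ?_
      rw [← map_sub, mul_assoc]
      gcongr
      exact P.le_opNorm _
    have hsplit : f v - f w = A (x v - x w) + (B (x v) (x v - x w) + B (x v - x w) (x w)) := by
      simp only [hf, map_sub, sub_apply]; abel
    rw [hsplit, hK, mul_assoc]
    calc _ ≤ ‖A‖ * ‖x v - x w‖ + (‖B‖ * R * ‖x v - x w‖ + ‖B‖ * ‖x v - x w‖ * R) := by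
          refine (norm_add_le _ _).trans (add_le_add (A.le_opNorm _) ((norm_add_le _ _).trans
            (add_le_add ((B.le_opNorm₂ _ _).trans ?_) ((B.le_opNorm₂ _ _).trans ?_))))
          · gcongr; exact hxR v
          · gcongr; exact hxR w
      _ = (‖A‖ + 2 * ‖B‖ * R) * ‖x v - x w‖ := by ring
      _ ≤ _ := by gcongr
  -- A solution of speed at most L stays within LT of its datum, so the ball of that radius costs no
  -- restriction on T.
  have hPL : IsPicardLindelof (fun _ : ℝ => f) (tmin := 0) (tmax := T)
      ⟨0, left_mem_Icc.mpr hT⟩ u (L.toNNReal * T.toNNReal) 0 L.toNNReal K.toNNReal := by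
    refine IsPicardLindelof.of_time_independent (fun v _ => ?_) hfK.lipschitzOnWith ?_
    · rw [Real.coe_toNNReal _ hL0]; exact hfL v
    · push_cast
      simp [hT]
  obtain ⟨α, hα0, hα⟩ := hPL.exists_eq_forall_mem_Icc_hasDerivWithinAt₀
  have hy : ∀ t ∈ Icc 0 T, HasDerivWithinAt (fun t => P (α t)) (f (α t)) (Icc 0 T) t := by
    intro t ht
    have h := P.hasFDerivAt.comp_hasDerivWithinAt t (hα t ht)
    have h2 : P (f (α t)) = f (α t) := by
      simp only [hf, map_add, hA _ (hPx _), hB _ (hPx _)]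
    rwa [h2] at h
  -- The retracted point is a positive multiple of P(α t), so dissipativity at the former gives the
  -- sign of the derivative at the latter. The norm then never exceeds R, the retraction is never
  -- active, and the original equation is solved.
  have hanti : AntitoneOn (fun t => ‖P (α t)‖ ^ 2) (Icc 0 T) := by
    refine antitoneOn_of_deriv_nonpos (convex_Icc 0 T)
      (fun t ht => (hy t ht).norm_sq.continuousWithinAt)
      (fun t ht => ((hy t (interior_subset ht)).norm_sq.mono interior_subset).differentiableWithinAt)
      fun t ht => ?_
    have ht' := interior_subset ht
    rw [((hy t ht').norm_sq.hasDerivAt (mem_interior_iff_mem_nhds.mp ht)).deriv]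
    have h := hdiss _ (hPx (α t))
    have hm : 0 < R / max R ‖P (α t)‖ := div_pos hR (lt_max_of_lt_left hR)
    have h2 : inner ℝ (x (α t)) (f (α t)) = R / max R ‖P (α t)‖ * inner ℝ (P (α t)) (f (α t)) := by
      simp only [hx, radialRetract, real_inner_smul_left]
    change inner ℝ (x (α t)) (f (α t)) ≤ 0 at h
    rw [h2] at h
    nlinarith [nonpos_of_mul_nonpos_right h hm]
  have hbound : ∀ t ∈ Icc 0 T, ‖P (α t)‖ ≤ R := by
    intro t ht
    have h := hanti (left_mem_Icc.mpr hT) ht ht.1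
    have hα0' : α 0 = u := hα0
    simp only [hα0', hu] at h
    exact (pow_le_pow_iff_left₀ (norm_nonneg _) hR.le two_ne_zero).mp h
  refine ⟨fun t => P (α t), ?_, fun t ht => ⟨?_, hPP _, hbound t ht⟩⟩
  · have hα0' : α 0 = u := hα0
    simp only [hα0', hu]
  · have h := hy t ht
    have hx' : x (α t) = P (α t) := radialRetract_of_le hR (hbound t ht)
    simpa only [hf, hx'] using h

end AbstractODE

/-! ### The frequency-truncated Burgers equation -/

/-- The frequency cutoff. -/
def cutoff (N : ℝ) : ℝ → ℝ := (Icc (-N) N).indicator 1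

theorem cutoff_neg (N ξ : ℝ) : cutoff N (-ξ) = cutoff N ξ := by
  have : (-ξ ∈ Icc (-N) N) ↔ ξ ∈ Icc (-N) N := by
    simp only [mem_Icc]; constructor <;> rintro ⟨h₁, h₂⟩ <;> constructor <;> linarith
  by_cases h : ξ ∈ Icc (-N) N <;> simp [cutoff, this, h]

theorem cutoff_mul_self (N ξ : ℝ) : cutoff N ξ * cutoff N ξ = cutoff N ξ := by
  by_cases h : ξ ∈ Icc (-N) N <;> simp [cutoff, h]

theorem cutoff_of_mem {N ξ : ℝ} (h : ξ ∈ Icc (-N) N) : cutoff N ξ = 1 := by simp [cutoff, h]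

theorem cutoff_of_notMem {N ξ : ℝ} (h : ξ ∉ Icc (-N) N) : cutoff N ξ = 0 := by simp [cutoff, h]

theorem cutoff_nonneg (N ξ : ℝ) : 0 ≤ cutoff N ξ := indicator_nonneg (fun _ _ => zero_le_one) ξ

theorem cutoff_le_one (N ξ : ℝ) : cutoff N ξ ≤ 1 := by
  by_cases h : ξ ∈ Icc (-N) N <;> simp [cutoff, h]

@[fun_prop]
theorem measurable_cutoff (N : ℝ) : Measurable (cutoff N) :=
  measurable_one.indicator measurableSet_Icc

theorem exists_norm_mul_cutoff_le {m : ℝ → ℂ} (hm : Continuous m) (N : ℝ) :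
    ∃ C, ∀ ξ, ‖m ξ * (cutoff N ξ : ℂ)‖ ≤ C := by
  obtain ⟨C, hC⟩ := isCompact_Icc (a := -N) (b := N) |>.exists_bound_of_continuousOn hm.continuousOn
  refine ⟨max C 0, fun ξ => ?_⟩
  by_cases h : ξ ∈ Icc (-N) N
  · rw [cutoff_of_mem h]; simpa using Or.inl (hC ξ h)
  · rw [cutoff_of_notMem h]; simp

theorem memLp_top_mul_cutoff {m : ℝ → ℂ} (hm : Continuous m) (N : ℝ) :
    MemLp (fun ξ => m ξ * (cutoff N ξ : ℂ)) ∞ := by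
  obtain ⟨C, hC⟩ := exists_norm_mul_cutoff_le hm N
  exact memLp_top_of_bound (by fun_prop) C (.of_forall hC)

theorem memLp_two_mul_cutoff {m : ℝ → ℂ} (hm : Continuous m) (N : ℝ) :
    MemLp (fun ξ => m ξ * (cutoff N ξ : ℂ)) 2 := by
  have h : MemLp (fun ξ => ((cutoff N ξ : ℝ) : ℂ)) 2 := by
    have : (fun ξ => ((cutoff N ξ : ℝ) : ℂ)) = (Icc (-N) N).indicator fun _ => (1 : ℂ) := by
      ext ξ; by_cases h : ξ ∈ Icc (-N) N <;> simp [cutoff, h]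
    rw [this]
    exact memLp_indicator_const 2 measurableSet_Icc 1 (Or.inr (by simp))
  obtain ⟨C, hC⟩ := exists_norm_mul_cutoff_le hm N
  refine h.of_le_mul (c := C) (by fun_prop) (.of_forall fun ξ => ?_)
  by_cases h : ξ ∈ Icc (-N) N
  · have := hC ξ
    rw [cutoff_of_mem h] at this ⊢
    simpa using this
  · rw [cutoff_of_notMem h]; simp

/-- Multiplication by the continuous function `m` on the frequencies in `[-N, N]`, and by zero
elsewhere. -/
def cutMul (m : ℝ → ℂ) (hm : Continuous m) (N : ℝ) : L2C →L[ℝ] L2C :=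
  (mulOp _ (memLp_top_mul_cutoff hm N)).restrictScalars ℝ

theorem coeFn_cutMul (m : ℝ → ℂ) (hm : Continuous m) (N : ℝ) (f : L2C) :
    cutMul m hm N f =ᵐ[volume] fun ξ => m ξ * (cutoff N ξ : ℂ) * f ξ :=
  coeFn_mulOp _ _ f

/-- The projection onto the Fourier transforms of the real-valued functions with frequencies in
`[-N, N]`. -/
def galerkinProj (N : ℝ) : L2C →L[ℝ] L2C :=
  cutMul (fun _ => 1) continuous_const N ∘L ((2⁻¹ : ℝ) • (ContinuousLinearMap.id ℝ L2C + hermReflect))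

theorem coeFn_galerkinProj (N : ℝ) (f : L2C) : galerkinProj N f =ᵐ[volume]
    fun ξ => (cutoff N ξ : ℂ) * (2⁻¹ * (f ξ + (starRingEnd ℂ) (f (-ξ)))) := by
  filter_upwards [coeFn_cutMul (fun _ => 1) continuous_const N
      (((2⁻¹ : ℝ) • (ContinuousLinearMap.id ℝ L2C + hermReflect)) f),
    Lp.coeFn_smul (2⁻¹ : ℝ) (f + hermReflect f), Lp.coeFn_add f (hermReflect f),
    coeFn_hermReflect f] with ξ h1 h2 h3 h4
  have h5 : galerkinProj N f ξ = 1 * (cutoff N ξ : ℂ) * ((2⁻¹ : ℝ) • (f + hermReflect f)) ξ := h1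
  rw [h5, h2, Pi.smul_apply, h3, Pi.add_apply, h4, Complex.real_smul]
  push_cast
  ring

theorem ae_neg {p : ℝ → Prop} (h : ∀ᵐ ξ : ℝ, p ξ) : ∀ᵐ ξ : ℝ, p (-ξ) :=
  (Measure.measurePreserving_neg volume).quasiMeasurePreserving.ae h

/-- Turns the operator identity into the pointwise symmetry used in all computations below. -/
theorem hermReflect_eq_self_iff (f : L2C) :
    hermReflect f = f ↔ ∀ᵐ ξ : ℝ, (starRingEnd ℂ) (f (-ξ)) = f ξ := by
  constructor
  · intro h
    have h2 := coeFn_hermReflect f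
    rw [h] at h2
    filter_upwards [h2] with ξ hξ using hξ.symm
  · intro h
    refine Lp.ext ?_
    filter_upwards [h, coeFn_hermReflect f] with ξ h1 h2
    rw [h2, h1]

theorem galerkinProj_eq_self_iff (N : ℝ) (f : L2C) : galerkinProj N f = f ↔
    (∀ᵐ ξ : ℝ, (starRingEnd ℂ) (f (-ξ)) = f ξ) ∧ ∀ᵐ ξ : ℝ, (cutoff N ξ : ℂ) * f ξ = f ξ := by
  constructor
  · intro h
    have h2 := coeFn_galerkinProj N f
    rw [h] at h2
    refine ⟨?_, ?_⟩
    · filter_upwards [h2, ae_neg h2] with ξ h3 h4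
      rw [h4, cutoff_neg, neg_neg]
      conv_rhs => rw [h3]
      simp only [map_mul, map_add, Complex.conj_conj, Complex.conj_ofReal, map_inv₀, map_ofNat]
      ring
    · filter_upwards [h2] with ξ h3
      rw [h3, ← mul_assoc, ← Complex.ofReal_mul, cutoff_mul_self]
  · rintro ⟨h₁, h₂⟩
    refine Lp.ext ?_
    filter_upwards [h₁, h₂, coeFn_galerkinProj N f] with ξ h3 h4 h5
    rw [h5, h3, ← two_mul, inv_mul_cancel_left₀ two_ne_zero, h4]

theorem galerkinProj_galerkinProj (N : ℝ) (f : L2C) :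
    galerkinProj N (galerkinProj N f) = galerkinProj N f := by
  have h := coeFn_galerkinProj N f
  rw [galerkinProj_eq_self_iff]
  refine ⟨?_, ?_⟩
  · filter_upwards [h, ae_neg h] with ξ h3 h4
    rw [h4, h3, cutoff_neg, neg_neg]
    simp only [map_mul, map_add, Complex.conj_conj, Complex.conj_ofReal, map_inv₀, map_ofNat]
    ring
  · filter_upwards [h] with ξ h3
    rw [h3, ← mul_assoc, ← Complex.ofReal_mul, cutoff_mul_self]

theorem coeFn_galerkinProj_of_herm (N : ℝ) {f : L2C} (hf : hermReflect f = f) :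
    galerkinProj N f =ᵐ[volume] fun ξ => (cutoff N ξ : ℂ) * f ξ := by
  rw [hermReflect_eq_self_iff] at hf
  filter_upwards [hf, coeFn_galerkinProj N f] with ξ h1 h2
  rw [h2, h1, ← two_mul, inv_mul_cancel_left₀ two_ne_zero]

theorem norm_galerkinProj_le_of_herm (N : ℝ) {f : L2C} (hf : hermReflect f = f) :
    ‖galerkinProj N f‖ ≤ ‖f‖ := by
  refine Lp.norm_le_norm_of_ae_le ?_
  filter_upwards [coeFn_galerkinProj_of_herm N hf] with ξ h
  rw [h, norm_mul, Complex.norm_real, Real.norm_of_nonneg (cutoff_nonneg _ _)]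
  exact mul_le_of_le_one_left (norm_nonneg _) (cutoff_le_one _ _)

/-- The linear part `-cξ²` of the cut-off Burgers equation. -/
def galerkinLin (c N : ℝ) : L2C →L[ℝ] L2C :=
  cutMul (fun ξ => ((-(c * ξ ^ 2) : ℝ) : ℂ)) (by fun_prop) N

/-- Since f ∗ g is only known to be bounded, the multiplier k has to supply the square
integrability; the truncated symbol -iπξ does. -/
theorem memLp_cconv_mul {k : ℝ → ℂ} (hk : MemLp k 2) (f g : L2C) :
    MemLp (fun ξ => k ξ * cconv f g ξ) 2 := by
  refine hk.of_le_mul (c := ‖f‖ * ‖g‖)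
    (hk.aestronglyMeasurable.mul (continuous_cconv f g).aestronglyMeasurable) (.of_forall fun ξ => ?_)
  rw [norm_mul, mul_comm]
  gcongr
  exact norm_cconv_le f g ξ

/-- The bilinear map `(f, g) ↦ k · (f ∗ g)` on `L²`, for `k ∈ L²`. -/
def mulCconv (k : ℝ → ℂ) (hk : MemLp k 2) : L2C →L[ℝ] L2C →L[ℝ] L2C :=
  LinearMap.mkContinuous₂ (LinearMap.mk₂ ℝ (fun f g => (memLp_cconv_mul hk f g).toLp _)
    (fun f₁ f₂ g => by
      rw [← MemLp.toLp_add]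
      exact MemLp.toLp_congr _ _ (.of_forall fun ξ => by
        simp only [cconv_add_left, Pi.add_apply]; ring))
    (fun a f g => by
      rw [← MemLp.toLp_const_smul]
      refine MemLp.toLp_congr _ _ (.of_forall fun ξ => ?_)
      have : a • f = (a : ℂ) • f := (Complex.coe_smul a f).symm
      simp only [this, cconv_smul_left, Pi.smul_apply, Complex.real_smul]; ring)
    (fun f g₁ g₂ => by
      rw [← MemLp.toLp_add]
      exact MemLp.toLp_congr _ _ (.of_forall fun ξ => by
        simp only [cconv_add_right, Pi.add_apply]; ring))
    (fun a f g => by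
      rw [← MemLp.toLp_const_smul]
      refine MemLp.toLp_congr _ _ (.of_forall fun ξ => ?_)
      have : a • g = (a : ℂ) • g := (Complex.coe_smul a g).symm
      simp only [this, cconv_smul_right, Pi.smul_apply, Complex.real_smul]; ring))
    ‖hk.toLp k‖ fun f g => by
      have : ‖(memLp_cconv_mul hk f g).toLp _‖ ≤ (‖f‖ * ‖g‖) * ‖hk.toLp k‖ := by
        refine Lp.norm_le_mul_norm_of_ae_le_mul ?_
        filter_upwards [(memLp_cconv_mul hk f g).coeFn_toLp, hk.coeFn_toLp] with ξ h1 h2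
        rw [h1, h2, norm_mul, mul_comm]
        gcongr
        exact norm_cconv_le f g ξ
      refine this.trans (le_of_eq (by ring))

theorem coeFn_mulCconv (k : ℝ → ℂ) (hk : MemLp k 2) (f g : L2C) :
    mulCconv k hk f g =ᵐ[volume] fun ξ => k ξ * cconv f g ξ :=
  (memLp_cconv_mul hk f g).coeFn_toLp

/-- The nonlinear part `-iπξ (f ∗ g)` of the cut-off Burgers equation. -/
def galerkinNonlin (N : ℝ) : L2C →L[ℝ] L2C →L[ℝ] L2C :=
  mulCconv _ (memLp_two_mul_cutoff
    (by fun_prop : Continuous fun ξ : ℝ => -(Real.pi * ξ * Complex.I : ℂ)) N)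

theorem cconv_neg_of_herm {f : L2C} (hf : ∀ᵐ ξ : ℝ, (starRingEnd ℂ) (f (-ξ)) = f ξ) (ξ : ℝ) :
    cconv f f (-ξ) = (starRingEnd ℂ) (cconv f f ξ) := by
  rw [cconv, cconv, ← integral_neg_eq_self, ← integral_conj]
  refine integral_congr_ae ?_
  filter_upwards [ae_neg hf, ((Measure.measurePreserving_sub_left volume ξ).quasiMeasurePreserving.ae
    (ae_neg hf))] with η h1 h2
  rw [neg_neg] at h1 h2
  rw [map_mul, h1, h2, show -ξ - -η = -(ξ - η) by ring]

theorem lintegral_enorm_mul_comp_le (h g : L2C) {e : ℝ → ℝ} (he : MeasurePreserving e) :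
    ∫⁻ x, ‖h x‖ₑ * ‖g (e x)‖ₑ ≤ ‖h‖ₑ * ‖g‖ₑ := by
  have h₁ := lintegral_enorm_mul_le h (Lp.compMeasurePreservingₗᵢ ℂ e he g)
  rw [LinearIsometry.enorm_map] at h₁
  refine le_trans (le_of_eq (lintegral_congr_ae ?_)) h₁
  have h₂ : Lp.compMeasurePreservingₗᵢ ℂ e he g =ᵐ[volume] g ∘ e :=
    Lp.coeFn_compMeasurePreserving g he
  filter_upwards [h₂] with x hx
  rw [hx, Function.comp_apply]

/-- Tonelli followed by Cauchy-Schwarz in ξ for each fixed η: f is measured in L¹, h and g in L².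
The change of variables e is left free because it occurs both as -ξ - η and as ξ - η. -/
theorem lintegral_trilinear_le (h g : L2C) {f : ℝ → ℂ} (hf : Measurable f) {e : ℝ → ℝ → ℝ}
    (he : Measurable (Function.uncurry e)) (hmp : ∀ η, MeasurePreserving fun ξ => e ξ η) :
    ∫⁻ ξ, ∫⁻ η, ‖h ξ‖ₑ * (‖f η‖ₑ * ‖g (e ξ η)‖ₑ) ≤ (∫⁻ η, ‖f η‖ₑ) * (‖h‖ₑ * ‖g‖ₑ) := by
  have hh := (Lp.stronglyMeasurable h).measurable
  have hg := (Lp.stronglyMeasurable g).measurable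
  have hge : Measurable fun p : ℝ × ℝ => g (e p.1 p.2) := hg.comp he
  rw [lintegral_lintegral_swap (by fun_prop), ← lintegral_mul_const _ hf.enorm]
  refine lintegral_mono fun η => ?_
  have hge' : Measurable fun ξ => g (e ξ η) := hg.comp (hmp η).measurable
  calc _ = ∫⁻ ξ, ‖f η‖ₑ * (‖h ξ‖ₑ * ‖g (e ξ η)‖ₑ) := lintegral_congr fun ξ => by ring
    _ = ‖f η‖ₑ * ∫⁻ ξ, (‖h ξ‖ₑ * ‖g (e ξ η)‖ₑ) := lintegral_const_mul _ (by fun_prop)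
    _ ≤ _ := by gcongr; exact lintegral_enorm_mul_comp_le h g (hmp η)

/-- The cancellation `∫ v² ∂ₓv = 0` on the Fourier side. -/
theorem integral_mul_cconv_neg_eq_zero {v w : L2C} (hv : Integrable v)
    (hw : ∀ᵐ ζ : ℝ, w ζ = ζ * v ζ) : ∫ ζ, w ζ * cconv v v (-ζ) = 0 := by
  have hvm := (Lp.stronglyMeasurable v).measurable
  -- On the plane ζ₁ + ζ₂ + ζ₃ = 0 the integrand is ζ₁ v(ζ₁) v(ζ₂) v(ζ₃).
  set F : ℝ × ℝ → ℂ := fun p => (p.1 * v p.1) * (v p.2 * v (-p.1 - p.2)) with hF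
  have hFm : Measurable F := by
    have h₁ : Measurable fun p : ℝ × ℝ => v p.1 := hvm.comp measurable_fst
    have h₂ : Measurable fun p : ℝ × ℝ => v p.2 := hvm.comp measurable_snd
    have h₃ : Measurable fun p : ℝ × ℝ => v (-p.1 - p.2) := hvm.comp (by fun_prop)
    fun_prop
  have hmp : ∀ η : ℝ, MeasurePreserving fun ξ : ℝ => -ξ - η := fun η => by
    have h := Measure.measurePreserving_sub_left volume (-η)
    refine (show (fun ξ : ℝ => -ξ - η) = fun ξ => -η - ξ from ?_) ▸ h
    ext ξ; ring
  have hFi : Integrable F (volume.prod volume) := by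
    refine ⟨hFm.aestronglyMeasurable, ?_⟩
    rw [HasFiniteIntegral, lintegral_prod _ hFm.enorm.aemeasurable]
    refine lt_of_eq_of_lt (b := ∫⁻ ξ, ∫⁻ η, ‖w ξ‖ₑ * (‖v η‖ₑ * ‖v (-ξ - η)‖ₑ)) ?_ ?_
    · refine lintegral_congr_ae ?_
      filter_upwards [hw] with ξ hξ
      simp only [hF, enorm_mul, hξ]
    · refine (lintegral_trilinear_le w v hvm (by fun_prop) hmp).trans_lt ?_
      have := hv.2
      rw [HasFiniteIntegral] at this
      finiteness
  have hJ : ∫ ζ, w ζ * cconv v v (-ζ) = ∫ p, F p ∂(volume.prod volume) := by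
    rw [integral_prod _ hFi]
    refine integral_congr_ae ?_
    filter_upwards [hw] with ζ hζ
    simp only [hF]
    rw [integral_const_mul, hζ, cconv]
  -- Exchanging ζ₁ and ζ₂ and adding produces ζ₁ + ζ₂ = -ζ₃ in front; renaming ζ₃ as the first
  -- variable gives J + J = -J.
  have hsum : (∫ p, F p ∂(volume.prod volume)) + ∫ p, F p ∂(volume.prod volume)
      = -∫ p, F p ∂(volume.prod volume) := by
    have hi : Integrable (fun z : ℝ × ℝ => F z.swap) (volume.prod volume) := hFi.swap
    conv_lhs => enter [1]; rw [← integral_prod_swap (f := F)]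
    rw [← integral_add hi hFi, integral_prod_symm (fun a : ℝ × ℝ => F a.swap + F a) (hi.add hFi),
      integral_prod_symm _ hFi, ← integral_neg]
    congr 1
    ext η
    rw [← integral_neg]
    conv_lhs => rw [← integral_sub_left_eq_self _ _ (-η)]
    congr 1
    ext ζ
    simp only [hF, Prod.swap]
    rw [show -η - (-η - ζ) = ζ by ring, show -(-η - ζ) - η = ζ by ring,
      show -η - ζ = -ζ - η by ring]
    push_cast
    ring
  rw [hJ]
  have h3 : (3 : ℂ) * ∫ p, F p ∂(volume.prod volume) = 0 := by linear_combination hsum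
  simpa using h3

theorem inner_eq_re_integral (f g : L2C) :
    inner ℝ f g = (∫ ξ, (starRingEnd ℂ) (f ξ) * g ξ).re := by
  have hint : Integrable fun ξ => (starRingEnd ℂ) (f ξ) * g ξ :=
    (Lp.memLp f).star.integrable_mul (Lp.memLp g)
  rw [L2.inner_def]
  refine Eq.trans ?_ (Complex.reCLM.integral_comp_comm hint)
  refine integral_congr_ae (.of_forall fun ξ => ?_)
  simp only [Complex.inner, Complex.reCLM_apply, mul_comm]

theorem memLp_one_of_cutoff {N : ℝ} {f : L2C} (hf : ∀ᵐ ξ : ℝ, (cutoff N ξ : ℂ) * f ξ = f ξ) :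
    Integrable f := by
  have h := (memLp_two_mul_cutoff (continuous_const (y := (1 : ℂ))) N).integrable_mul (Lp.memLp f)
  refine h.congr ?_
  filter_upwards [hf] with ξ hξ
  simp only [Pi.mul_apply, one_mul, hξ]

/-- Hermitian symmetry replaces conj f(ξ) by f(-ξ), which turns the inner product into the
cancelling trilinear integral. The band limitation makes f integrable and ξf square integrable, as
that cancellation requires. -/
theorem inner_galerkinNonlin_self {N : ℝ} {f : L2C} (hf : galerkinProj N f = f) :
    inner ℝ f (galerkinNonlin N f f) = 0 := by
  obtain ⟨hherm, hcut⟩ := (galerkinProj_eq_self_iff N f).mp hf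
  set w := cutMul (fun ξ => (ξ : ℂ)) (by fun_prop) N f with hw_def
  have hw : ∀ᵐ ζ : ℝ, w ζ = ζ * f ζ := by
    filter_upwards [coeFn_cutMul (fun ξ => (ξ : ℂ)) (by fun_prop) N f, hcut] with ξ h1 h2
    rw [hw_def, h1, mul_assoc, h2]
  have hzero := integral_mul_cconv_neg_eq_zero (memLp_one_of_cutoff hcut) hw
  rw [inner_eq_re_integral]
  have h : ∫ ξ, (starRingEnd ℂ) (f ξ) * galerkinNonlin N f f ξ
      = (Real.pi * Complex.I) * ∫ ζ, w ζ * cconv f f (-ζ) := by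
    rw [← integral_const_mul, ← integral_neg_eq_self]
    refine integral_congr_ae ?_
    filter_upwards [hherm, hcut, hw, ae_neg (coeFn_mulCconv _ (memLp_two_mul_cutoff
      (by fun_prop : Continuous fun ξ : ℝ => -(Real.pi * ξ * Complex.I : ℂ)) N) f f)]
      with ξ h1 h2 h3 h4
    rw [galerkinNonlin, h4, h1, h3, cutoff_neg, ← h2]
    push_cast
    have : (cutoff N ξ : ℂ) * (cutoff N ξ : ℂ) = cutoff N ξ := by
      rw [← Complex.ofReal_mul, cutoff_mul_self]
    linear_combination (Real.pi * ξ * Complex.I * f ξ * cconv f f (-ξ)) * this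
  rw [h, hzero]
  simp

theorem inner_cutMul_neg_nonpos (m : ℝ → ℝ) (hm : Continuous fun ξ => ((m ξ : ℝ) : ℂ))
    (hm0 : ∀ ξ, m ξ ≤ 0) (N : ℝ) (f : L2C) : inner ℝ f (cutMul _ hm N f) ≤ 0 := by
  rw [L2.inner_def]
  refine integral_nonpos_of_ae ?_
  filter_upwards [coeFn_cutMul _ hm N f] with ξ h
  rw [h, ← Complex.ofReal_mul, ← Complex.real_smul, real_inner_smul_right]
  exact mul_nonpos_of_nonpos_of_nonneg
    (mul_nonpos_of_nonpos_of_nonneg (hm0 ξ) (cutoff_nonneg N ξ)) real_inner_self_nonneg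

theorem galerkinLin_mem {c N : ℝ} {f : L2C} (hf : galerkinProj N f = f) :
    galerkinProj N (galerkinLin c N f) = galerkinLin c N f := by
  obtain ⟨hherm, hcut⟩ := (galerkinProj_eq_self_iff N f).mp hf
  have h := coeFn_cutMul (fun ξ => ((-(c * ξ ^ 2) : ℝ) : ℂ)) (by fun_prop) N f
  rw [galerkinProj_eq_self_iff]
  refine ⟨?_, ?_⟩
  · filter_upwards [h, ae_neg h, hherm] with ξ h1 h2 h3
    rw [galerkinLin, h1, h2, cutoff_neg, map_mul, map_mul, h3, Complex.conj_ofReal,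
      Complex.conj_ofReal, neg_sq]
  · filter_upwards [h, hcut] with ξ h1 h2
    rw [galerkinLin, h1]
    linear_combination ((-(c * ξ ^ 2) : ℝ) : ℂ) * (cutoff N ξ : ℂ) * h2

theorem galerkinNonlin_mem {N : ℝ} {f : L2C} (hf : galerkinProj N f = f) :
    galerkinProj N (galerkinNonlin N f f) = galerkinNonlin N f f := by
  obtain ⟨hherm, -⟩ := (galerkinProj_eq_self_iff N f).mp hf
  have h := coeFn_mulCconv _ (memLp_two_mul_cutoff
      (by fun_prop : Continuous fun ξ : ℝ => -(Real.pi * ξ * Complex.I : ℂ)) N) f f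
  rw [galerkinProj_eq_self_iff]
  refine ⟨?_, ?_⟩
  · filter_upwards [h, ae_neg h] with ξ h1 h2
    rw [galerkinNonlin, h1, h2, cutoff_neg, cconv_neg_of_herm hherm]
    simp only [map_mul, map_neg, Complex.conj_ofReal, Complex.conj_I, Complex.conj_conj]
    push_cast
    ring
  · filter_upwards [h] with ξ h1
    have : (cutoff N ξ : ℂ) * (cutoff N ξ : ℂ) = cutoff N ξ := by
      rw [← Complex.ofReal_mul, cutoff_mul_self]
    rw [galerkinNonlin, h1]
    linear_combination (-(Real.pi * ξ * Complex.I : ℂ)) * cconv f f ξ * this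

/-- The solutions of the cut-off Burgers equation on the Fourier side. -/
theorem exists_galerkin_solution {c : ℝ} (hc : 0 ≤ c) (N : ℝ) {u : L2C} (hu : galerkinProj N u = u)
    {T : ℝ} (hT : 0 ≤ T) : ∃ y : ℝ → L2C, y 0 = u ∧ ∀ t ∈ Icc 0 T,
      HasDerivWithinAt y (galerkinLin c N (y t) + galerkinNonlin N (y t) (y t)) (Icc 0 T) t ∧
      galerkinProj N (y t) = y t ∧ ‖y t‖ ≤ ‖u‖ := by
  refine exists_solution_of_dissipative _ _ (galerkinProj N) (galerkinProj_galerkinProj N)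
    (fun x hx => galerkinLin_mem hx) (fun x hx => galerkinNonlin_mem hx) (fun x hx => ?_) hu hT
  rw [inner_add_right, inner_galerkinNonlin_self hx, add_zero]
  exact inner_cutMul_neg_nonpos _ _ (fun ξ => by nlinarith [mul_nonneg hc (sq_nonneg ξ)]) N x

/-! ### The Sobolev energy estimate -/

/-- The Sobolev weight `(1 + ξ²)^{n/2}`. -/
def sobWeight (n : ℕ) (ξ : ℝ) : ℝ := √((1 + ξ ^ 2) ^ n)

@[fun_prop]
theorem continuous_sobWeight (n : ℕ) : Continuous (sobWeight n) := by
  unfold sobWeight; fun_prop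

theorem sobWeight_nonneg (n : ℕ) (ξ : ℝ) : 0 ≤ sobWeight n ξ := Real.sqrt_nonneg _

theorem sobWeight_sq (n : ℕ) (ξ : ℝ) : sobWeight n ξ ^ 2 = (1 + ξ ^ 2) ^ n :=
  Real.sq_sqrt (by positivity)

/-- One of η and ξ - η has size at least |ξ|/2. This lets the weight of a convolution fall on a
single factor. -/
theorem sobWeight_le (n : ℕ) (ξ η : ℝ) :
    sobWeight n ξ ≤ 2 ^ n * (sobWeight n η + sobWeight n (ξ - η)) := by
  have h₁ : ∀ a : ℝ, 0 < 1 + a ^ 2 := fun a => by positivity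
  have h₂ : 1 + ξ ^ 2 ≤ 4 * max (1 + η ^ 2) (1 + (ξ - η) ^ 2) := by
    nlinarith [le_max_left (1 + η ^ 2) (1 + (ξ - η) ^ 2), le_max_right (1 + η ^ 2) (1 + (ξ - η) ^ 2),
      sq_nonneg (ξ - 2 * η)]
  have h₃ : sobWeight n ξ ≤ 2 ^ n * max (sobWeight n η) (sobWeight n (ξ - η)) := by
    refine Real.sqrt_le_iff.mpr ⟨by have := sobWeight_nonneg n η; positivity, ?_⟩
    calc (1 + ξ ^ 2) ^ n ≤ (4 * max (1 + η ^ 2) (1 + (ξ - η) ^ 2)) ^ n :=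
          pow_le_pow_left₀ (h₁ _).le h₂ n
      _ = (2 ^ n) ^ 2 * max (1 + η ^ 2) (1 + (ξ - η) ^ 2) ^ n := by
          rw [mul_pow, ← pow_mul, mul_comm n 2, pow_mul]; norm_num
      _ ≤ _ := by
          rw [mul_pow]
          gcongr
          rcases max_choice (1 + η ^ 2) (1 + (ξ - η) ^ 2) with h | h
          · rw [h, ← sobWeight_sq]
            exact pow_le_pow_left₀ (sobWeight_nonneg _ _) (le_max_left _ _) 2
          · rw [h, ← sobWeight_sq]
            exact pow_le_pow_left₀ (sobWeight_nonneg _ _) (le_max_right _ _) 2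
  refine h₃.trans ?_
  gcongr
  exact max_le_add_of_nonneg (sobWeight_nonneg _ _) (sobWeight_nonneg _ _)

/-- Cauchy-Schwarz against (k² + ξ²)^{-1/2}, whose squared L² norm is π/k. A large k makes the
coefficient √(π/k) of ‖ξf‖ small, at the price of a large coefficient in front of ‖f‖. -/
theorem lintegral_enorm_le {f g : L2C} (hg : ∀ᵐ ξ : ℝ, g ξ = ξ * f ξ) {k : ℝ} (hk : 0 < k) :
    ∫⁻ ξ, ‖f ξ‖ₑ ≤ ENNReal.ofReal (√(Real.pi / k) * (k * ‖f‖ + ‖g‖)) := by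
  have hmem : MemLp (fun ξ : ℝ => ((√((k ^ 2 + ξ ^ 2)⁻¹) : ℝ) : ℂ)) 2 := by
    refine MemLp.ofReal ?_
    rw [memLp_two_iff_integrable_sq (by fun_prop)]
    refine (integrable_inv_add_sq hk).congr (.of_forall fun ξ => ?_)
    simp only
    rw [Real.sq_sqrt (by positivity)]
  set S : L2C := hmem.toLp _ with hS
  have hSn : ‖S‖ₑ = ENNReal.ofReal √(Real.pi / k) := by
    have h : ‖S‖ₑ ^ 2 = ENNReal.ofReal √(Real.pi / k) ^ 2 := by
      rw [← lintegral_enorm_sq_eq, ← ENNReal.ofReal_pow (by positivity),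
        Real.sq_sqrt (by positivity), ← lintegral_inv_add_sq hk]
      refine lintegral_congr_ae ?_
      filter_upwards [hmem.coeFn_toLp] with ξ hξ
      rw [hξ, ← ofReal_norm, Complex.norm_real, Real.norm_of_nonneg (by positivity),
        ← ENNReal.ofReal_pow (by positivity), Real.sq_sqrt (by positivity)]
    exact le_antisymm ((ENNReal.pow_le_pow_left_iff two_ne_zero).mp h.le)
      ((ENNReal.pow_le_pow_left_iff two_ne_zero).mp h.ge)
  have hfm := (Lp.stronglyMeasurable f).measurable
  have hgm := (Lp.stronglyMeasurable g).measurable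
  have hSm := (Lp.stronglyMeasurable S).measurable
  calc ∫⁻ ξ, ‖f ξ‖ₑ
      ≤ ∫⁻ ξ, (ENNReal.ofReal k * (‖S ξ‖ₑ * ‖f ξ‖ₑ) + ‖S ξ‖ₑ * ‖g ξ‖ₑ) := by
        refine lintegral_mono_ae ?_
        filter_upwards [hg, hmem.coeFn_toLp] with ξ h1 h2
        rw [h1, hS, h2, ← ofReal_norm, ← ofReal_norm, ← ofReal_norm, norm_mul, Complex.norm_real,
          Complex.norm_real, Real.norm_of_nonneg (by positivity), ← ENNReal.ofReal_mul (by positivity),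
          ← ENNReal.ofReal_mul (by positivity), ← ENNReal.ofReal_mul (by positivity),
          ← ENNReal.ofReal_add (by positivity) (by positivity), Real.norm_eq_abs]
        refine ENNReal.ofReal_le_ofReal ?_
        have h : 1 ≤ √((k ^ 2 + ξ ^ 2)⁻¹) * (k + |ξ|) := by
          rw [Real.sqrt_inv, inv_mul_eq_div, one_le_div (by positivity)]
          refine Real.sqrt_le_iff.mpr ⟨by positivity, ?_⟩
          nlinarith [sq_abs ξ, mul_nonneg hk.le (abs_nonneg ξ)]
        nlinarith [norm_nonneg (f ξ)]
    _ = ENNReal.ofReal k * (∫⁻ ξ, ‖S ξ‖ₑ * ‖f ξ‖ₑ) + ∫⁻ ξ, ‖S ξ‖ₑ * ‖g ξ‖ₑ := by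
        rw [lintegral_add_right _ (by fun_prop), lintegral_const_mul _ (by fun_prop)]
    _ ≤ ENNReal.ofReal k * (‖S‖ₑ * ‖f‖ₑ) + ‖S‖ₑ * ‖g‖ₑ := by
        gcongr <;> exact lintegral_enorm_mul_le _ _
    _ = _ := by
        rw [hSn, ← ofReal_norm f, ← ofReal_norm g, ← ENNReal.ofReal_mul (by positivity),
          ← ENNReal.ofReal_mul (by positivity), ← ENNReal.ofReal_mul (by positivity),
          ← ENNReal.ofReal_add (by positivity) (by positivity)]
        congr 1; ring

/-- The two placements of the weight given by `sobWeight_le` contribute equally by the symmetry of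
the convolution; this is the second factor 2 in 2^{n+1}. -/
theorem sobWeight_mul_enorm_cconv_le (n : ℕ) {f d : L2C}
    (hd : ∀ᵐ ξ : ℝ, d ξ = sobWeight n ξ * f ξ) (ξ : ℝ) :
    ENNReal.ofReal (sobWeight n ξ) * ‖cconv f f ξ‖ₑ
      ≤ ENNReal.ofReal (2 ^ (n + 1)) * ∫⁻ η, ‖d η‖ₑ * ‖f (ξ - η)‖ₑ := by
  have hfm := (Lp.stronglyMeasurable f).measurable
  have hdm := (Lp.stronglyMeasurable d).measurable
  have hsub : Measurable fun η : ℝ => ξ - η := by fun_prop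
  have hfs : Measurable fun η : ℝ => f (ξ - η) := hfm.comp hsub
  have hds : Measurable fun η : ℝ => d (ξ - η) := hdm.comp hsub
  have hflip : ∫⁻ η, ‖f η‖ₑ * ‖d (ξ - η)‖ₑ = ∫⁻ η, ‖d η‖ₑ * ‖f (ξ - η)‖ₑ := by
    rw [← lintegral_sub_left_eq_self _ ξ]
    refine lintegral_congr fun η => ?_
    rw [sub_sub_cancel, mul_comm]
  calc _ ≤ ENNReal.ofReal (sobWeight n ξ) * ∫⁻ η, ‖f η‖ₑ * ‖f (ξ - η)‖ₑ := by
        gcongr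
        refine (enorm_integral_le_lintegral_enorm _).trans ?_
        simp only [enorm_mul, le_refl]
    _ = ∫⁻ η, ENNReal.ofReal (sobWeight n ξ) * (‖f η‖ₑ * ‖f (ξ - η)‖ₑ) :=
        (lintegral_const_mul _ (by fun_prop)).symm
    _ ≤ ∫⁻ η, ENNReal.ofReal (2 ^ n) * (‖d η‖ₑ * ‖f (ξ - η)‖ₑ + ‖f η‖ₑ * ‖d (ξ - η)‖ₑ) := by
        refine lintegral_mono_ae ?_
        filter_upwards [hd, (Measure.measurePreserving_sub_left volume ξ).quasiMeasurePreserving.ae hd]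
          with η h1 h2
        have hw : ∀ x, ‖((sobWeight n x : ℝ) : ℂ)‖ₑ = ENNReal.ofReal (sobWeight n x) := fun x => by
          rw [← ofReal_norm, Complex.norm_real, Real.norm_of_nonneg (sobWeight_nonneg _ _)]
        rw [h1, h2, enorm_mul, enorm_mul, hw, hw]
        calc _ ≤ ENNReal.ofReal (2 ^ n * (sobWeight n η + sobWeight n (ξ - η)))
                * (‖f η‖ₑ * ‖f (ξ - η)‖ₑ) := by
              gcongr; exact sobWeight_le n ξ η
          _ = _ := by
              rw [ENNReal.ofReal_mul (by positivity),
                ENNReal.ofReal_add (sobWeight_nonneg _ _) (sobWeight_nonneg _ _)]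
              ring
    _ = _ := by
        rw [lintegral_const_mul _ (by fun_prop), lintegral_add_left (by fun_prop), hflip, ← two_mul,
          ← mul_assoc]
        congr 1
        rw [pow_succ, ENNReal.ofReal_mul (by positivity)]
        norm_num

/-- The trilinear estimate behind the Sobolev bounds. -/
theorem abs_inner_sobWeight_nonlin_le (n : ℕ) {N k : ℝ} (hk : 0 < k) {f d x b : L2C}
    (hd : ∀ᵐ ξ : ℝ, d ξ = sobWeight n ξ * f ξ) (hx : ∀ᵐ ξ : ℝ, x ξ = ξ * d ξ)
    (hb : ∀ᵐ ξ : ℝ, b ξ = sobWeight n ξ *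
      (-(Real.pi * ξ * Complex.I : ℂ) * (cutoff N ξ : ℂ) * cconv f f ξ)) :
    |inner ℝ d b| ≤ Real.pi * 2 ^ (n + 1) * √(Real.pi / k) * ‖f‖ * ‖x‖ * (k * ‖d‖ + ‖x‖) := by
  have hdm := (Lp.stronglyMeasurable d).measurable
  have hxm := (Lp.stronglyMeasurable x).measurable
  have hfm := (Lp.stronglyMeasurable f).measurable
  have hw : ∀ x, ‖((sobWeight n x : ℝ) : ℂ)‖ₑ = ENNReal.ofReal (sobWeight n x) := fun x => by
    rw [← ofReal_norm, Complex.norm_real, Real.norm_of_nonneg (sobWeight_nonneg _ _)]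
  have hcutle : ∀ ξ, ‖((cutoff N ξ : ℝ) : ℂ)‖ₑ ≤ 1 := fun ξ => by
    rw [← ofReal_norm, Complex.norm_real, Real.norm_of_nonneg (cutoff_nonneg _ _)]
    simpa using cutoff_le_one N ξ
  have hmain : ‖∫ ξ, (starRingEnd ℂ) (d ξ) * b ξ‖ₑ ≤ ENNReal.ofReal
      (Real.pi * 2 ^ (n + 1) * √(Real.pi / k) * ‖f‖ * ‖x‖ * (k * ‖d‖ + ‖x‖)) := by
    calc _ ≤ ∫⁻ ξ, ‖d ξ‖ₑ * ‖b ξ‖ₑ := by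
          refine (enorm_integral_le_lintegral_enorm _).trans (le_of_eq ?_)
          refine lintegral_congr fun ξ => ?_
          rw [enorm_mul, ← ofReal_norm, ← ofReal_norm (d ξ), RCLike.norm_conj]
      -- The factor ξ of the nonlinearity goes to the outer d, making it x; the inner d is the one
      -- measured in L¹.
      _ ≤ ∫⁻ ξ, ENNReal.ofReal (Real.pi * 2 ^ (n + 1)) *
            ∫⁻ η, ‖x ξ‖ₑ * (‖d η‖ₑ * ‖f (ξ - η)‖ₑ) := by
          refine lintegral_mono_ae ?_
          filter_upwards [hx, hb] with ξ h1 h2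
          have hfs : Measurable fun η : ℝ => f (ξ - η) := hfm.comp (by fun_prop)
          rw [lintegral_const_mul _ (by fun_prop)]
          calc ‖d ξ‖ₑ * ‖b ξ‖ₑ = ENNReal.ofReal Real.pi * ‖x ξ‖ₑ * ‖((cutoff N ξ : ℝ) : ℂ)‖ₑ *
                (ENNReal.ofReal (sobWeight n ξ) * ‖cconv f f ξ‖ₑ) := by
                have hI : ‖Complex.I‖ₑ = 1 := by rw [← ofReal_norm]; simp
                have hpi : ‖((Real.pi : ℝ) : ℂ)‖ₑ = ENNReal.ofReal Real.pi := by
                  rw [← ofReal_norm, Complex.norm_real, Real.norm_of_nonneg Real.pi_pos.le]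
                rw [h1, h2]
                simp only [enorm_mul, enorm_neg, hw, hI, hpi]
                ring
            _ ≤ ENNReal.ofReal Real.pi * ‖x ξ‖ₑ * 1 *
                (ENNReal.ofReal (2 ^ (n + 1)) * ∫⁻ η, ‖d η‖ₑ * ‖f (ξ - η)‖ₑ) := by
                exact mul_le_mul' (mul_le_mul' le_rfl (hcutle ξ))
                  (sobWeight_mul_enorm_cconv_le n hd ξ)
            _ = _ := by
                rw [ENNReal.ofReal_mul Real.pi_pos.le]; ring
      _ ≤ ENNReal.ofReal (Real.pi * 2 ^ (n + 1)) * ((∫⁻ η, ‖d η‖ₑ) * (‖x‖ₑ * ‖f‖ₑ)) := by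
          rw [lintegral_const_mul' _ _ (by finiteness)]
          gcongr
          exact lintegral_trilinear_le x f hdm (by fun_prop)
            fun η => measurePreserving_sub_right volume η
      _ ≤ ENNReal.ofReal (Real.pi * 2 ^ (n + 1)) *
            (ENNReal.ofReal (√(Real.pi / k) * (k * ‖d‖ + ‖x‖)) * (‖x‖ₑ * ‖f‖ₑ)) := by
          gcongr
          exact lintegral_enorm_le hx hk
      _ = _ := by
          rw [← ofReal_norm x, ← ofReal_norm f, ← ENNReal.ofReal_mul (by positivity),
            ← ENNReal.ofReal_mul (by positivity), ← ENNReal.ofReal_mul (by positivity)]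
          congr 1; ring
  rw [inner_eq_re_integral]
  refine (Complex.abs_re_le_norm _).trans ?_
  rw [← ofReal_norm] at hmain
  exact (ENNReal.ofReal_le_ofReal_iff (by positivity)).mp hmain

/-- The exponential growth rate of the `Hⁿ` norm along the viscous Burgers flow, for data of `L²`
norm at most `R`. -/
def sobRate (c : ℝ) (n : ℕ) (R : ℝ) : ℝ :=
  (Real.pi * 2 ^ (n + 1) * √Real.pi * R) ^ 2
    * (2 * (Real.pi * 2 ^ (n + 1) * √Real.pi * R) / c + 1) ^ 2 / (2 * c)

theorem sobRate_nonneg {c : ℝ} (hc : 0 < c) (n : ℕ) (R : ℝ) : 0 ≤ sobRate c n R := by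
  unfold sobRate; positivity

theorem sobRate_mono {c : ℝ} (hc : 0 < c) (n : ℕ) {R₁ R₂ : ℝ} (h₀ : 0 ≤ R₁) (h : R₁ ≤ R₂) :
    sobRate c n R₁ ≤ sobRate c n R₂ := by
  unfold sobRate; gcongr

/-- With κ = π 2^{n+1} √π R and q = 2κ/c + 1, the choice k = q² gives √(π/k) = √π/q and κ/q ≤ c/2.
Half of the dissipation absorbs the X² term; the other half absorbs κqXF by Young's inequality,
which leaves κ²q²/(2c) F². -/
theorem sobRate_absorb {c : ℝ} (hc : 0 < c) (n : ℕ) {R : ℝ} (hR : 0 ≤ R) :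
    ∃ k : ℝ, 0 < k ∧ ∀ X F r : ℝ, 0 ≤ X → 0 ≤ F → 0 ≤ r → r ≤ R →
      Real.pi * 2 ^ (n + 1) * √(Real.pi / k) * r * X * (k * F + X)
        ≤ c * X ^ 2 + sobRate c n R * F ^ 2 := by
  set κ : ℝ := Real.pi * 2 ^ (n + 1) * √Real.pi * R with hκ
  have hκ0 : 0 ≤ κ := by positivity
  set q : ℝ := 2 * κ / c + 1 with hq
  have hq0 : 0 < q := by positivity
  refine ⟨q ^ 2, by positivity, fun X F r hX hF hr hrR => ?_⟩
  have h₁ : √(Real.pi / q ^ 2) = √Real.pi / q := by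
    rw [Real.sqrt_div Real.pi_pos.le, Real.sqrt_sq hq0.le]
  have h₂ : κ / q ≤ c / 2 := by
    rw [div_le_div_iff₀ hq0 two_pos, hq, mul_add, mul_div_cancel₀ _ hc.ne']
    linarith
  have h₃ : sobRate c n R = κ ^ 2 * q ^ 2 / (2 * c) := rfl
  rw [h₁, h₃]
  calc _ ≤ Real.pi * 2 ^ (n + 1) * (√Real.pi / q) * R * X * (q ^ 2 * F + X) := by gcongr
    _ = κ * q * X * F + κ / q * X ^ 2 := by rw [hκ]; field_simp
    _ ≤ κ * q * X * F + c / 2 * X ^ 2 := by gcongr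
    _ ≤ _ := by
        have h₄ : κ ^ 2 * q ^ 2 / (2 * c) * F ^ 2 + c / 2 * X ^ 2 - κ * q * X * F
            = (c * X - κ * q * F) ^ 2 / (2 * c) := by field_simp; ring
        have h₅ : 0 ≤ (c * X - κ * q * F) ^ 2 / (2 * c) := by positivity
        linarith

/-- Multiplication by the Sobolev weight on the frequencies in `[-N, N]`. -/
def cutSob (n : ℕ) (N : ℝ) : L2C →L[ℝ] L2C :=
  cutMul (fun ξ => ((sobWeight n ξ : ℝ) : ℂ)) (by fun_prop) N

theorem coeFn_cutSob (n : ℕ) (N : ℝ) (f : L2C) :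
    cutSob n N f =ᵐ[volume] fun ξ => (sobWeight n ξ : ℂ) * (cutoff N ξ : ℂ) * f ξ :=
  coeFn_cutMul _ _ N f

/-- The linear part contributes exactly -c‖ξd‖², which cancels the ‖ξd‖² term of the trilinear
bound. The remaining constant does not involve the cutoff N. -/
theorem inner_cutSob_galerkin_le {c N : ℝ} (hc : 0 < c) (n : ℕ) {f : L2C} {R : ℝ} (hfR : ‖f‖ ≤ R)
    (hf : galerkinProj N f = f) :
    inner ℝ (cutSob n N f) (cutSob n N (galerkinLin c N f + galerkinNonlin N f f))
      ≤ sobRate c n R * ‖cutSob n N f‖ ^ 2 := by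
  obtain ⟨-, hcut⟩ := (galerkinProj_eq_self_iff N f).mp hf
  set d := cutSob n N f with hd_def
  have hd : ∀ᵐ ξ : ℝ, d ξ = sobWeight n ξ * f ξ := by
    filter_upwards [coeFn_cutSob n N f, hcut] with ξ h1 h2
    rw [hd_def, h1, mul_assoc, h2]
  have hdcut : ∀ᵐ ξ : ℝ, (cutoff N ξ : ℂ) * d ξ = d ξ := by
    filter_upwards [hd, hcut] with ξ h1 h2
    rw [h1]; linear_combination (sobWeight n ξ : ℂ) * h2
  set x := cutMul (fun ξ => (ξ : ℂ)) (by fun_prop) N d with hx_def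
  have hx : ∀ᵐ ξ : ℝ, x ξ = ξ * d ξ := by
    filter_upwards [coeFn_cutMul (fun ξ => (ξ : ℂ)) (by fun_prop) N d, hdcut] with ξ h1 h2
    rw [hx_def, h1, mul_assoc, h2]
  have hlin : inner ℝ d (cutSob n N (galerkinLin c N f)) = -(c * ‖x‖ ^ 2) := by
    rw [← real_inner_self_eq_norm_sq, L2.inner_def, L2.inner_def, ← integral_const_mul,
      ← integral_neg]
    refine integral_congr_ae ?_
    filter_upwards [hx, hd, hdcut, coeFn_cutSob n N (galerkinLin c N f),
      coeFn_cutMul (fun ξ => ((-(c * ξ ^ 2) : ℝ) : ℂ)) (by fun_prop) N f] with ξ h1 h2 h3 h4 h5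
    have h6 : cutSob n N (galerkinLin c N f) ξ = (-(c * ξ ^ 2)) • d ξ := by
      rw [h4, galerkinLin, h5, Complex.real_smul]
      rw [h2] at h3 ⊢
      push_cast
      linear_combination (-(c * ξ ^ 2) : ℂ) * ((cutoff N ξ : ℂ) + 1) * h3
    rw [h6, h1, ← Complex.real_smul, real_inner_smul_right, real_inner_smul_left,
      real_inner_smul_right]
    ring
  have hb : ∀ᵐ ξ : ℝ, cutSob n N (galerkinNonlin N f f) ξ = sobWeight n ξ *
      (-(Real.pi * ξ * Complex.I : ℂ) * (cutoff N ξ : ℂ) * cconv f f ξ) := by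
    filter_upwards [coeFn_cutSob n N (galerkinNonlin N f f), coeFn_mulCconv _ (memLp_two_mul_cutoff
      (by fun_prop : Continuous fun ξ : ℝ => -(Real.pi * ξ * Complex.I : ℂ)) N) f f] with ξ h1 h2
    have : (cutoff N ξ : ℂ) * (cutoff N ξ : ℂ) = cutoff N ξ := by
      rw [← Complex.ofReal_mul, cutoff_mul_self]
    rw [h1, galerkinNonlin, h2]
    linear_combination (sobWeight n ξ : ℂ) * (-(Real.pi * ξ * Complex.I : ℂ)) * cconv f f ξ * this
  obtain ⟨k, hk, habs⟩ := sobRate_absorb hc n ((norm_nonneg f).trans hfR)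
  have h := (le_abs_self _).trans (abs_inner_sobWeight_nonlin_le n hk hd hx hb)
  rw [map_add, inner_add_right, hlin]
  linarith [habs ‖x‖ ‖d‖ ‖f‖ (norm_nonneg _) (norm_nonneg _) (norm_nonneg _) hfR]

/-- Gronwall's inequality: the differential inequality makes e^{-2Ct}‖Dy‖² nonincreasing, where C is
the rate and D the truncated weight. -/
theorem norm_cutSob_galerkin_le {c N T : ℝ} (hc : 0 < c) (n : ℕ) {y : ℝ → L2C} {R : ℝ}
    (hy : ∀ t ∈ Icc 0 T,
      HasDerivWithinAt y (galerkinLin c N (y t) + galerkinNonlin N (y t) (y t)) (Icc 0 T) t ∧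
      galerkinProj N (y t) = y t ∧ ‖y t‖ ≤ R) {t : ℝ} (ht : t ∈ Icc 0 T) :
    ‖cutSob n N (y t)‖ ≤ Real.exp (sobRate c n R * t) * ‖cutSob n N (y 0)‖ := by
  set C := sobRate c n R with hC
  set D := cutSob n N
  have h0 : (0 : ℝ) ∈ Icc 0 T := left_mem_Icc.mpr (ht.1.trans ht.2)
  have hD : ∀ t ∈ Icc 0 T, HasDerivWithinAt (fun t => Real.exp (-(2 * C) * t) * ‖D (y t)‖ ^ 2)
      (Real.exp (-(2 * C) * t) * (-(2 * C)) * ‖D (y t)‖ ^ 2 + Real.exp (-(2 * C) * t) *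
        (2 * inner ℝ (D (y t)) (D (galerkinLin c N (y t) + galerkinNonlin N (y t) (y t)))))
      (Icc 0 T) t := by
    intro t ht
    have h₁ : HasDerivAt (fun t => Real.exp (-(2 * C) * t)) (Real.exp (-(2 * C) * t) * (-(2 * C))) t := by
      simpa using ((hasDerivAt_id t).const_mul (-(2 * C))).exp
    exact h₁.hasDerivWithinAt.mul (D.hasFDerivAt.comp_hasDerivWithinAt t (hy t ht).1).norm_sq
  have hanti : AntitoneOn (fun t => Real.exp (-(2 * C) * t) * ‖D (y t)‖ ^ 2) (Icc 0 T) := by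
    refine antitoneOn_of_deriv_nonpos (convex_Icc 0 T) (fun t ht => (hD t ht).continuousWithinAt)
      (fun t ht => ((hD t (interior_subset ht)).mono interior_subset).differentiableWithinAt)
      fun t ht => ?_
    have ht' := interior_subset ht
    rw [((hD t ht').hasDerivAt (mem_interior_iff_mem_nhds.mp ht)).deriv]
    have h := inner_cutSob_galerkin_le hc n (hy t ht').2.2 (hy t ht').2.1
    have hexp := Real.exp_pos (-(2 * C) * t)
    nlinarith
  have h := hanti h0 ht ht.1
  simp only [mul_zero, Real.exp_zero, one_mul] at h
  rw [neg_mul, Real.exp_neg, inv_mul_le_iff₀ (Real.exp_pos _)] at h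
  refine (pow_le_pow_iff_left₀ (norm_nonneg _) (by positivity) two_ne_zero).mp (h.trans_eq ?_)
  rw [mul_pow, ← Real.exp_nat_mul]
  push_cast
  ring_nf

/-! ### Duhamel's formula for the cut-off equation -/

theorem norm_mulOp_le {m : ℝ → ℂ} (hm : MemLp m ∞) {C : ℝ} (hC : 0 ≤ C) (hmC : ∀ ξ, ‖m ξ‖ ≤ C) :
    ‖mulOp m hm‖ ≤ C := by
  refine ContinuousLinearMap.opNorm_le_bound _ hC fun f => ?_
  refine Lp.norm_le_mul_norm_of_ae_le_mul ?_
  filter_upwards [coeFn_mulOp m hm f] with ξ h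
  rw [h, norm_mul]
  gcongr
  exact hmC ξ

theorem memLp_top_exp {a : ℝ → ℝ} (ha : Measurable a) {L : ℝ} (haL : ∀ ξ, |a ξ| ≤ L) (s : ℝ) :
    MemLp (fun ξ => ((Real.exp (s * a ξ) : ℝ) : ℂ)) ∞ := by
  refine memLp_top_of_bound (by fun_prop) (Real.exp (|s| * L)) (.of_forall fun ξ => ?_)
  rw [Complex.norm_real, Real.norm_of_nonneg (Real.exp_pos _).le, Real.exp_le_exp]
  calc s * a ξ ≤ |s * a ξ| := le_abs_self _
    _ ≤ _ := by rw [abs_mul]; gcongr; exact haL ξ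

/-- The semigroup of multiplications by `exp (s a)`, for a bounded function `a`. -/
def expOp {a : ℝ → ℝ} (ha : Measurable a) {L : ℝ} (haL : ∀ ξ, |a ξ| ≤ L) (s : ℝ) : L2C →L[ℝ] L2C :=
  (mulOp _ (memLp_top_exp ha haL s)).restrictScalars ℝ

theorem coeFn_expOp {a : ℝ → ℝ} (ha : Measurable a) {L : ℝ} (haL : ∀ ξ, |a ξ| ≤ L) (s : ℝ)
    (f : L2C) : expOp ha haL s f =ᵐ[volume] fun ξ => ((Real.exp (s * a ξ) : ℝ) : ℂ) * f ξ :=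
  coeFn_mulOp _ _ f

theorem memLp_top_ofReal {a : ℝ → ℝ} (ha : Measurable a) {L : ℝ} (haL : ∀ ξ, |a ξ| ≤ L) :
    MemLp (fun ξ => ((a ξ : ℝ) : ℂ)) ∞ :=
  memLp_top_of_bound (by fun_prop) L (.of_forall fun ξ => by simpa using haL ξ)

/-- Differentiability holds in operator norm because the exponent is bounded: the Taylor remainder
of exp is then O(h²) uniformly in ξ. -/
theorem hasDerivAt_expOp {a : ℝ → ℝ} (ha : Measurable a) {L : ℝ} (haL : ∀ ξ, |a ξ| ≤ L) (s : ℝ) :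
    HasDerivAt (expOp ha haL) (expOp ha haL s ∘L
      (mulOp _ (memLp_top_ofReal ha haL)).restrictScalars ℝ) s := by
  have hL0 : 0 ≤ L := (abs_nonneg _).trans (haL 0)
  rw [hasDerivAt_iff_isLittleO_nhds_zero]
  have hO : (fun h : ℝ => expOp ha haL (s + h) - expOp ha haL s - h • (expOp ha haL s ∘L
      (mulOp _ (memLp_top_ofReal ha haL)).restrictScalars ℝ)) =O[nhds 0] fun h : ℝ => h ^ 2 := by
    refine Asymptotics.IsBigO.of_bound (Real.exp (|s| * L) * L ^ 2) ?_
    filter_upwards [Metric.ball_mem_nhds (0 : ℝ) (show 0 < 1 / (L + 1) by positivity)] with h hh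
    rw [mem_ball_zero_iff, Real.norm_eq_abs, lt_div_iff₀ (by positivity)] at hh
    refine ContinuousLinearMap.opNorm_le_bound _ (by positivity) fun f => ?_
    refine Lp.norm_le_mul_norm_of_ae_le_mul ?_
    set M : L2C →L[ℝ] L2C := (mulOp _ (memLp_top_ofReal ha haL)).restrictScalars ℝ with hM
    have hMf : M f =ᵐ[volume] fun ξ => ((a ξ : ℝ) : ℂ) * f ξ := coeFn_mulOp _ _ f
    filter_upwards [Lp.coeFn_sub (expOp ha haL (s + h) f - expOp ha haL s f)
        (h • expOp ha haL s (M f)), Lp.coeFn_sub (expOp ha haL (s + h) f) (expOp ha haL s f),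
      Lp.coeFn_smul h (expOp ha haL s (M f)), coeFn_expOp ha haL (s + h) f, coeFn_expOp ha haL s f,
      coeFn_expOp ha haL s (M f), hMf] with ξ h1 h2 h3 h4 h5 h6 h7
    have h8 : (expOp ha haL (s + h) - expOp ha haL s - h • (expOp ha haL s ∘L M)) f ξ
        = ((Real.exp (s * a ξ) * (Real.exp (h * a ξ) - 1 - h * a ξ) : ℝ) : ℂ) * f ξ := by
      change (expOp ha haL (s + h) f - expOp ha haL s f - h • expOp ha haL s (M f)) ξ = _
      rw [h1, Pi.sub_apply, h2, Pi.sub_apply, h3, Pi.smul_apply, h4, h5, h6, h7, add_mul,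
        Real.exp_add, Complex.real_smul]
      push_cast
      ring
    rw [h8, norm_mul, Complex.norm_real, norm_mul, norm_pow]
    refine mul_le_mul_of_nonneg_right ?_ (norm_nonneg _)
    have hha : |h * a ξ| ≤ |h| * L := by rw [abs_mul]; gcongr; exact haL ξ
    have hha1 : ‖h * a ξ‖ ≤ 1 := by
      rw [Real.norm_eq_abs]; nlinarith [abs_nonneg h]
    have h9 := Real.norm_exp_sub_one_sub_id_le hha1
    have h10 : ‖Real.exp (s * a ξ)‖ ≤ Real.exp (|s| * L) := by
      rw [Real.norm_of_nonneg (Real.exp_pos _).le, Real.exp_le_exp]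
      calc s * a ξ ≤ |s * a ξ| := le_abs_self _
        _ ≤ _ := by rw [abs_mul]; gcongr; exact haL ξ
    calc _ ≤ Real.exp (|s| * L) * (|h| * L) ^ 2 := by
          gcongr
          refine h9.trans ?_
          rw [Real.norm_eq_abs]
          gcongr
      _ = _ := by rw [Real.norm_eq_abs]; ring
  refine hO.trans_isLittleO ?_
  simpa using Asymptotics.isLittleO_pow_id (𝕜 := ℝ) (n := 2) (by norm_num)

/-- The quadratic bound controls a change of f uniformly in ξ, so continuity in ξ is needed only at
one fixed f. -/
theorem continuous_cconv_self : Continuous fun p : L2C × ℝ => cconv p.1 p.1 p.2 := by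
  rw [continuous_iff_continuousAt]
  rintro ⟨f₀, ξ₀⟩
  rw [ContinuousAt, tendsto_iff_norm_sub_tendsto_zero]
  have h₁ : Continuous fun p : L2C × ℝ => (‖p.1‖ + ‖f₀‖) * ‖p.1 - f₀‖
      + ‖cconv f₀ f₀ p.2 - cconv f₀ f₀ ξ₀‖ := by
    have := continuous_cconv f₀ f₀
    fun_prop
  have h₂ := h₁.tendsto (f₀, ξ₀)
  simp only [sub_self, norm_zero, mul_zero, add_zero] at h₂
  refine squeeze_zero (fun _ => norm_nonneg _) (fun p => ?_) h₂
  calc ‖cconv p.1 p.1 p.2 - cconv f₀ f₀ ξ₀‖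
      = ‖(cconv p.1 p.1 p.2 - cconv f₀ f₀ p.2) + (cconv f₀ f₀ p.2 - cconv f₀ f₀ ξ₀)‖ := by
        rw [sub_add_sub_cancel]
    _ ≤ _ := (norm_add_le _ _).trans (by gcongr; exact norm_cconv_self_sub_le _ _ _)

/-- The value of an `L²`-valued integral is the integral of the values. -/
theorem coeFn_intervalIntegral {F : ℝ → L2C} {f : ℝ → ℝ → ℂ} {t : ℝ} (ht : 0 ≤ t)
    (hF : ContinuousOn F (Icc 0 t))
    (hf : AEStronglyMeasurable (Function.uncurry f) ((volume.restrict (Ioc 0 t)).prod volume))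
    (h : ∀ s ∈ Ioc 0 t, F s =ᵐ[volume] f s) :
    (∫ s in (0 : ℝ)..t, F s : L2C) =ᵐ[volume] fun ξ => ∫ s in (0 : ℝ)..t, f s ξ := by
  obtain ⟨M, hM⟩ := isCompact_Icc.exists_bound_of_continuousOn hF
  have hFi : IntervalIntegrable F volume 0 t :=
    ContinuousOn.intervalIntegrable (by rwa [uIcc_of_le ht])
  -- On a set of finite measure the L² norm controls the L¹ norm, uniformly in s; this is the
  -- absolute integrability behind Fubini.
  have hint : ∀ S : Set ℝ, MeasurableSet S → volume S < ∞ →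
      Integrable (Function.uncurry f) ((volume.restrict (Ioc 0 t)).prod (volume.restrict S)) := by
    intro S hS hSfin
    have : IsFiniteMeasure (volume.restrict S) := ⟨by simpa using hSfin⟩
    have hmeas : AEStronglyMeasurable (Function.uncurry f)
        ((volume.restrict (Ioc 0 t)).prod (volume.restrict S)) :=
      hf.mono_ac (Measure.AbsolutelyContinuous.rfl.prod
        Measure.restrict_le_self.absolutelyContinuous)
    have hfs : ∀ s ∈ Ioc 0 t, MemLp (f s) 2 (volume.restrict S) := fun s hs =>
      ((memLp_congr_ae (h s hs)).mp (Lp.memLp (F s))).restrict S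
    rw [integrable_prod_iff hmeas]
    refine ⟨?_, ?_⟩
    · filter_upwards [ae_restrict_mem measurableSet_Ioc] with s hs
      exact (hfs s hs).integrable (by norm_num)
    · set χ : L2C := indicatorConstLp 2 hS hSfin.ne (1 : ℂ) with hχ
      refine Integrable.of_bound hmeas.norm.integral_prod_right' (‖χ‖ * M) ?_
      filter_upwards [ae_restrict_mem measurableSet_Ioc] with s hs
      rw [Real.norm_of_nonneg (integral_nonneg fun _ => norm_nonneg _)]
      simp only [Function.uncurry_apply_pair]
      rw [integral_norm_eq_lintegral_enorm ((hfs s hs).aestronglyMeasurable)]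
      have h₁ : ∫⁻ ξ in S, ‖f s ξ‖ₑ ≤ ‖χ‖ₑ * ‖F s‖ₑ := by
        refine le_trans (le_of_eq ?_) (lintegral_enorm_mul_le χ (F s))
        rw [← lintegral_indicator hS]
        refine lintegral_congr_ae ?_
        filter_upwards [indicatorConstLp_coeFn (p := 2) (hs := hS) (hμs := hSfin.ne) (c := (1 : ℂ)),
          h s hs] with ξ h2 h3
        rw [hχ, h2, h3]
        by_cases hξ : ξ ∈ S <;> simp [hξ]
      refine (ENNReal.toReal_mono (by finiteness) h₁).trans ?_
      rw [ENNReal.toReal_mul, toReal_enorm, toReal_enorm]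
      gcongr
      exact hM s ⟨hs.1.le, hs.2⟩
  -- Integration over S is a continuous functional on L², so it commutes with the vector-valued
  -- integral, while Fubini moves it through the pointwise one.
  have hset : ∀ S : Set ℝ, MeasurableSet S → volume S < ∞ →
      IntegrableOn (fun ξ => ∫ s in (0 : ℝ)..t, f s ξ) S ∧
      ∫ ξ in S, (∫ s in (0 : ℝ)..t, F s : L2C) ξ = ∫ ξ in S, ∫ s in (0 : ℝ)..t, f s ξ := by
    intro S hS hSfin
    have hi := hint S hS hSfin
    simp only [intervalIntegral.integral_of_le ht]
    refine ⟨hi.integral_prod_right, ?_⟩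
    set χ : L2C := indicatorConstLp 2 hS hSfin.ne (1 : ℂ) with hχ
    have hpair : ∀ g : L2C, ∫ ξ in S, g ξ = l2Pairing χ g := by
      intro g
      rw [l2Pairing_apply, ← integral_indicator hS]
      refine integral_congr_ae ?_
      filter_upwards [indicatorConstLp_coeFn (p := 2) (hs := hS) (hμs := hSfin.ne) (c := (1 : ℂ))]
        with ξ h2
      rw [hχ, h2]
      by_cases hξ : ξ ∈ S <;> simp [hξ]
    rw [hpair, ← ContinuousLinearMap.integral_comp_comm _
      ((intervalIntegrable_iff_integrableOn_Ioc_of_le ht).mp hFi),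
      integral_integral_swap (f := fun ξ s => f s ξ) hi.swap]
    refine setIntegral_congr_fun measurableSet_Ioc fun s hs => ?_
    rw [← hpair]
    exact integral_congr_ae (ae_restrict_of_ae (h s hs))
  refine ae_eq_of_forall_setIntegral_eq_of_sigmaFinite (fun S hS hSfin => ?_)
    (fun S hS hSfin => (hset S hS hSfin).1) fun S hS hSfin => (hset S hS hSfin).2
  have : IsFiniteMeasure (volume.restrict S) := ⟨by simpa using hSfin⟩
  exact ((Lp.memLp _).restrict S).integrable (by norm_num)

theorem abs_mul_cutoff_le (c N ξ : ℝ) : |-(c * ξ ^ 2) * cutoff N ξ| ≤ |c| * N ^ 2 := by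
  by_cases h : ξ ∈ Icc (-N) N
  · rw [cutoff_of_mem h, mul_one, abs_neg, abs_mul, abs_of_nonneg (sq_nonneg ξ)]
    exact mul_le_mul le_rfl (sq_le_sq' h.1 h.2) (sq_nonneg _) (abs_nonneg _)
  · rw [cutoff_of_notMem h, mul_zero, abs_zero]
    positivity

theorem measurable_mul_cutoff (c N : ℝ) : Measurable fun ξ => -(c * ξ ^ 2) * cutoff N ξ := by
  fun_prop

theorem mulOp_eq_galerkinLin (c N : ℝ) :
    (mulOp _ (memLp_top_ofReal (measurable_mul_cutoff c N) (abs_mul_cutoff_le c N))).restrictScalars ℝ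
      = galerkinLin c N := by
  ext1 f
  refine Lp.ext ?_
  filter_upwards [coeFn_mulOp _ (memLp_top_ofReal (measurable_mul_cutoff c N)
      (abs_mul_cutoff_le c N)) f,
    coeFn_cutMul (fun ξ => ((-(c * ξ ^ 2) : ℝ) : ℂ)) (by fun_prop) N f] with ξ h1 h2
  rw [ContinuousLinearMap.coe_restrictScalars', h1, galerkinLin, h2]
  push_cast
  ring

/-- The heat semigroup, cut off at frequencies in `[-N, N]`. -/
def cutHeat (c N : ℝ) : ℝ → L2C →L[ℝ] L2C :=
  expOp (measurable_mul_cutoff c N) (abs_mul_cutoff_le c N)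

theorem hasDerivAt_cutHeat (c N s : ℝ) :
    HasDerivAt (cutHeat c N) (cutHeat c N s ∘L galerkinLin c N) s := by
  rw [← mulOp_eq_galerkinLin]
  exact hasDerivAt_expOp _ _ s

theorem continuous_cutHeat (c N : ℝ) : Continuous (cutHeat c N) :=
  continuous_iff_continuousAt.mpr fun s => (hasDerivAt_cutHeat c N s).continuousAt

theorem continuousOn_cutHeat_nonlin {c N t : ℝ} {y : ℝ → L2C} (hy : ContinuousOn y (Icc 0 t)) :
    ContinuousOn (fun s => cutHeat c N (t - s) (galerkinNonlin N (y s) (y s))) (Icc 0 t) := by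
  have h₁ : ContinuousOn (fun s => galerkinNonlin N (y s) (y s)) (Icc 0 t) :=
    ((galerkinNonlin N).continuous.comp_continuousOn hy).clm_apply hy
  have h₂ : Continuous fun s => cutHeat c N (t - s) := (continuous_cutHeat c N).comp (by fun_prop)
  exact h₂.continuousOn.clm_apply h₁

/-- In the derivative of s ↦ e^{(t-s)A} y(s) the linear terms cancel, leaving the nonlinear term
under the semigroup. -/
theorem galerkin_variation_of_constants {c N t : ℝ} (ht : 0 ≤ t) {y : ℝ → L2C}
    (hy : ∀ s ∈ Icc 0 t,
      HasDerivWithinAt y (galerkinLin c N (y s) + galerkinNonlin N (y s) (y s)) (Icc 0 t) s) :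
    ∫ s in (0 : ℝ)..t, cutHeat c N (t - s) (galerkinNonlin N (y s) (y s))
      = cutHeat c N (t - t) (y t) - cutHeat c N (t - 0) (y 0) := by
  have hcont : ContinuousOn y (Icc 0 t) := fun s hs => (hy s hs).continuousWithinAt
  have hderiv : ∀ s ∈ Icc 0 t, HasDerivWithinAt (fun s => cutHeat c N (t - s) (y s))
      (cutHeat c N (t - s) (galerkinNonlin N (y s) (y s))) (Icc 0 t) s := by
    intro s hs
    have h₁ : HasDerivAt (fun s => cutHeat c N (t - s))
        (-(cutHeat c N (t - s) ∘L galerkinLin c N)) s := by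
      have h := (hasDerivAt_cutHeat c N (t - s)).scomp s ((hasDerivAt_id s).const_sub t)
      rw [neg_one_smul] at h
      exact h
    have h₂ := h₁.hasDerivWithinAt.clm_apply (hy s hs)
    refine h₂.congr_deriv ?_
    rw [map_add, neg_apply, ContinuousLinearMap.comp_apply]
    abel
  exact intervalIntegral.integral_eq_sub_of_hasDerivAt_of_le ht
      (fun s hs => (hderiv s hs).continuousWithinAt)
      (fun s hs => (hderiv s (Ioo_subset_Icc_self hs)).hasDerivAt (Icc_mem_nhds hs.1 hs.2))
      (ContinuousOn.intervalIntegrable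
        (by rw [uIcc_of_le ht]; exact continuousOn_cutHeat_nonlin hcont))

theorem aestronglyMeasurable_cconv_self {t : ℝ} {y : ℝ → L2C} (hy : ContinuousOn y (Icc 0 t)) :
    AEStronglyMeasurable (fun p : ℝ × ℝ => cconv (y p.1) (y p.1) p.2)
      ((volume.restrict (Ioc 0 t)).prod volume) := by
  have h₁ : ContinuousOn (fun p : ℝ × ℝ => cconv (y p.1) (y p.1) p.2) (Ioc 0 t ×ˢ univ) :=
    continuous_cconv_self.comp_continuousOn (ContinuousOn.prodMk
      (hy.comp continuousOn_fst fun p hp => ⟨hp.1.1.le, hp.1.2⟩) continuousOn_snd)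
  rw [← Measure.restrict_univ (μ := (volume : Measure ℝ)), Measure.prod_restrict]
  simp only [Measure.restrict_univ]
  exact h₁.aestronglyMeasurable (measurableSet_Ioc.prod .univ)

/-- Variation of constants read frequency by frequency. The formula may carry the full datum u,
since the indicator discards the frequencies beyond N. -/
theorem isFourierMild_of_galerkin {c N T : ℝ} {u : L2C} {y : ℝ → L2C}
    (hy0 : ∀ᵐ ξ : ℝ, y 0 ξ = (cutoff N ξ : ℂ) * u ξ)
    (hy : ∀ t ∈ Icc 0 T,
      HasDerivWithinAt y (galerkinLin c N (y t) + galerkinNonlin N (y t) (y t)) (Icc 0 T) t ∧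
      galerkinProj N (y t) = y t) :
    IsFourierMild c (Icc (-N) N) T u y := by
  have hcont : ContinuousOn y (Icc 0 T) := fun t ht => (hy t ht).1.continuousWithinAt
  refine ⟨hcont, fun t ht => ?_⟩
  have htT : Icc 0 t ⊆ Icc 0 T := Icc_subset_Icc le_rfl ht.2
  set g : ℝ → ℝ → ℂ := fun s ξ => ((Real.exp ((t - s) * (-(c * ξ ^ 2) * cutoff N ξ)) : ℝ) : ℂ) *
    (-(Real.pi * ξ * Complex.I : ℂ) * (cutoff N ξ : ℂ) * cconv (y s) (y s) ξ) with hg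
  have hgm : AEStronglyMeasurable (Function.uncurry g)
      ((volume.restrict (Ioc 0 t)).prod volume) := by
    have h₃ : Measurable fun p : ℝ × ℝ => cutoff N p.2 := (measurable_cutoff N).comp measurable_snd
    exact AEStronglyMeasurable.mul (Measurable.aestronglyMeasurable (by fun_prop))
      (AEStronglyMeasurable.mul (Measurable.aestronglyMeasurable (by fun_prop))
        (aestronglyMeasurable_cconv_self (hcont.mono htT)))
  have hgF : ∀ s ∈ Ioc 0 t, cutHeat c N (t - s) (galerkinNonlin N (y s) (y s)) =ᵐ[volume] g s := by
    intro s hs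
    filter_upwards [coeFn_expOp (measurable_mul_cutoff c N) (abs_mul_cutoff_le c N) (t - s)
      (galerkinNonlin N (y s) (y s)), coeFn_mulCconv _ (memLp_two_mul_cutoff
        (by fun_prop : Continuous fun ξ : ℝ => -(Real.pi * ξ * Complex.I : ℂ)) N) (y s) (y s)]
      with ξ h1 h2
    rw [cutHeat, h1, galerkinNonlin, h2]
  have hcut := ((galerkinProj_eq_self_iff N (y t)).mp (hy t ht).2).2
  have hvar := galerkin_variation_of_constants ht.1 fun s hs => (hy s (htT hs)).1.mono htT
  filter_upwards [coeFn_intervalIntegral ht.1 (continuousOn_cutHeat_nonlin (hcont.mono htT)) hgm hgF,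
    Lp.coeFn_sub (cutHeat c N (t - t) (y t)) (cutHeat c N (t - 0) (y 0)),
    coeFn_expOp (measurable_mul_cutoff c N) (abs_mul_cutoff_le c N) (t - t) (y t),
    coeFn_expOp (measurable_mul_cutoff c N) (abs_mul_cutoff_le c N) (t - 0) (y 0), hy0, hcut]
    with ξ h1 h2 h3 h4 h5 h6
  rw [hvar, h2, Pi.sub_apply, cutHeat, h3, h4, h5, sub_self, zero_mul, Real.exp_zero, sub_zero,
    Complex.ofReal_one, one_mul] at h1
  by_cases hξ : ξ ∈ Icc (-N) N
  · rw [indicator_of_mem hξ, ← intervalIntegral.integral_const_mul]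
    simp only [hg, cutoff_of_mem hξ, Complex.ofReal_one, mul_one, one_mul] at h1
    rw [sub_eq_iff_eq_add] at h1
    rw [h1, add_comm, sub_eq_add_neg, ← intervalIntegral.integral_neg, Complex.real_smul,
      mul_comm t]
    congr 1
    refine intervalIntegral.integral_congr fun s _ => ?_
    simp only [Complex.real_smul]
    rw [mul_comm (t - s)]
    ring
  · rw [indicator_of_notMem hξ, ← h6, cutoff_of_notMem hξ, Complex.ofReal_zero, zero_mul]

/-! ### Removing the cutoff: global solutions on the Fourier side -/

/-- The square of the `Hⁿ` norm of the inverse Fourier transform. -/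
def sobEnergy (n : ℕ) (f : L2C) : ℝ≥0∞ :=
  ∫⁻ ξ : ℝ, ENNReal.ofReal ((1 + ξ ^ 2) ^ n) * ‖f ξ‖ₑ ^ 2

theorem enorm_cutSob_sq (n : ℕ) (N : ℝ) (f : L2C) : ‖cutSob n N f‖ₑ ^ 2
    = ∫⁻ ξ : ℝ, ENNReal.ofReal ((1 + ξ ^ 2) ^ n) * ‖(cutoff N ξ : ℂ) * f ξ‖ₑ ^ 2 := by
  rw [← lintegral_enorm_sq_eq]
  refine lintegral_congr_ae ?_
  filter_upwards [coeFn_cutSob n N f] with ξ h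
  rw [h, mul_assoc, enorm_mul, mul_pow, ← sobWeight_sq, ENNReal.ofReal_pow (sobWeight_nonneg _ _),
    ← ofReal_norm (sobWeight n ξ : ℂ), Complex.norm_real, Real.norm_of_nonneg (sobWeight_nonneg _ _)]

/-- For the band-limited f the truncated weight already sees the whole energy; for the datum,
truncation only lowers it. -/
theorem sobEnergy_le_of_cutSob {n : ℕ} {N C : ℝ} {f g u : L2C} (hC : 0 ≤ C)
    (hf : ∀ᵐ ξ : ℝ, (cutoff N ξ : ℂ) * f ξ = f ξ) (hg : ∀ᵐ ξ : ℝ, g ξ = (cutoff N ξ : ℂ) * u ξ)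
    (h : ‖cutSob n N f‖ ≤ C * ‖cutSob n N g‖) :
    sobEnergy n f ≤ ENNReal.ofReal C ^ 2 * sobEnergy n u := by
  have h₁ : sobEnergy n f = ‖cutSob n N f‖ₑ ^ 2 := by
    rw [enorm_cutSob_sq, sobEnergy]
    refine lintegral_congr_ae ?_
    filter_upwards [hf] with ξ hξ
    rw [hξ]
  have h₂ : ‖cutSob n N g‖ₑ ^ 2 ≤ sobEnergy n u := by
    rw [enorm_cutSob_sq, sobEnergy]
    refine lintegral_mono_ae ?_
    filter_upwards [hg] with ξ hξ
    rw [hξ, ← mul_assoc, ← Complex.ofReal_mul, cutoff_mul_self]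
    gcongr
    rw [enorm_mul]
    refine mul_le_of_le_one_left' ?_
    rw [← ofReal_norm, Complex.norm_real, Real.norm_of_nonneg (cutoff_nonneg _ _)]
    simpa using cutoff_le_one N ξ
  have h₃ : ‖cutSob n N f‖ₑ ≤ ENNReal.ofReal C * ‖cutSob n N g‖ₑ := by
    rw [← ofReal_norm, ← ofReal_norm, ← ENNReal.ofReal_mul hC]
    exact ENNReal.ofReal_le_ofReal h
  calc sobEnergy n f ≤ (ENNReal.ofReal C * ‖cutSob n N g‖ₑ) ^ 2 := by rw [h₁]; gcongr
    _ ≤ _ := by rw [mul_pow]; gcongr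

theorem IsFourierMild.apply_zero {c T : ℝ} (hT : 0 ≤ T) {u : L2C} {p : ℝ → L2C}
    (hp : IsFourierMild c univ T u p) : p 0 = u := by
  refine Lp.ext ?_
  filter_upwards [hp.duhamel 0 (left_mem_Icc.mpr hT)] with ξ h
  rw [h, indicator_univ]
  simp

theorem exists_ae_tendsto_subseq {y : ℕ → L2C} {p : L2C} (h : Tendsto y atTop (nhds p)) :
    ∃ φ : ℕ → ℕ, StrictMono φ ∧ ∀ᵐ ξ : ℝ, Tendsto (fun k => y (φ k) ξ) atTop (nhds (p ξ)) :=
  (tendstoInMeasure_of_tendsto_Lp h).exists_seq_tendsto_ae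

/-- Lower semicontinuity: Fatou's lemma along an almost everywhere convergent subsequence. -/
theorem sobEnergy_le_of_tendsto {n : ℕ} {y : ℕ → L2C} {p : L2C} (h : Tendsto y atTop (nhds p))
    {B : ℝ≥0∞} (hB : ∀ k, sobEnergy n (y k) ≤ B) : sobEnergy n p ≤ B := by
  obtain ⟨φ, -, hφ⟩ := exists_ae_tendsto_subseq h
  have hm : ∀ f : L2C, Measurable fun ξ : ℝ => ENNReal.ofReal ((1 + ξ ^ 2) ^ n) * ‖f ξ‖ₑ ^ 2 :=
    fun f => by
      have := (Lp.stronglyMeasurable f).measurable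
      fun_prop
  calc sobEnergy n p
      = ∫⁻ ξ : ℝ, liminf (fun k => ENNReal.ofReal ((1 + ξ ^ 2) ^ n) * ‖y (φ k) ξ‖ₑ ^ 2) atTop := by
        refine lintegral_congr_ae ?_
        filter_upwards [hφ] with ξ hξ
        refine (Tendsto.liminf_eq ?_).symm
        exact ENNReal.Tendsto.const_mul (((ENNReal.continuous_pow 2).tendsto _).comp hξ.enorm)
          (Or.inr ENNReal.ofReal_ne_top)
    _ ≤ liminf (fun k => sobEnergy n (y (φ k))) atTop := lintegral_liminf_le fun k => hm _
    _ ≤ B := liminf_le_of_le (by isBoundedDefault) fun b hb => by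
        obtain ⟨k, hk⟩ := hb.exists
        exact hk.trans (hB _)

/-- Uniform limits of solutions with frequencies in growing intervals are mild solutions. -/
theorem IsFourierMild.of_tendstoUniformlyOn {c T R : ℝ} {u : L2C} {y : ℕ → ℝ → L2C} {p : ℝ → L2C}
    (hy : ∀ k : ℕ, IsFourierMild c (Icc (-(k + 1 : ℝ)) (k + 1)) T u (y k))
    (hR : ∀ k, ∀ t ∈ Icc 0 T, ‖y k t‖ ≤ R) (hyp : TendstoUniformlyOn y p atTop (Icc 0 T)) :
    IsFourierMild c univ T u p := by
  refine ⟨hyp.continuousOn (.of_forall fun k => (hy k).continuousOn), fun t ht => ?_⟩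
  have htT : Ioc 0 t ⊆ Icc 0 T := fun s hs => ⟨hs.1.le, hs.2.trans ht.2⟩
  have hlim : ∀ s ∈ Icc 0 T, Tendsto (fun k => y k s) atTop (nhds (p s)) := fun s hs =>
    hyp.tendsto_at hs
  -- Only the left-hand side needs a subsequence: the convolutions on the right converge at every ξ,
  -- with the uniform bound R² for dominated convergence.
  obtain ⟨φ, hφ, hφlim⟩ := exists_ae_tendsto_subseq (hlim t ht)
  filter_upwards [hφlim, ae_all_iff.mpr fun k => (hy k).duhamel t ht] with ξ h₁ h₂
  refine tendsto_nhds_unique h₁ ?_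
  rw [indicator_univ]
  have h₃ : Tendsto (fun k => Real.exp (-(c * ξ ^ 2) * t) • u ξ - (Real.pi * ξ * Complex.I) *
      ∫ s in (0 : ℝ)..t, Real.exp (-(c * ξ ^ 2) * (t - s)) • cconv (y k s) (y k s) ξ) atTop
      (nhds (Real.exp (-(c * ξ ^ 2) * t) • u ξ - (Real.pi * ξ * Complex.I) *
      ∫ s in (0 : ℝ)..t, Real.exp (-(c * ξ ^ 2) * (t - s)) • cconv (p s) (p s) ξ)) := by
    refine tendsto_const_nhds.sub (Tendsto.const_mul _ ?_)
    refine intervalIntegral.tendsto_integral_filter_of_dominated_convergence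
      (fun s => Real.exp (-(c * ξ ^ 2) * (t - s)) * (R * R)) ?_ ?_ ?_ ?_
    · refine .of_forall fun k => ?_
      rw [uIoc_of_le ht.1]
      refine ContinuousOn.aestronglyMeasurable ?_ measurableSet_Ioc
      exact (by fun_prop : Continuous fun s => Real.exp (-(c * ξ ^ 2) * (t - s))).continuousOn.smul
        (((hy k).continuousOn_cconv ξ).mono htT)
    · refine .of_forall fun k => .of_forall fun s hs => ?_
      rw [uIoc_of_le ht.1] at hs
      rw [norm_smul, Real.norm_of_nonneg (Real.exp_pos _).le]
      have h₄ := hR k s (htT hs)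
      refine mul_le_mul_of_nonneg_left ((norm_cconv_le _ _ _).trans ?_) (Real.exp_pos _).le
      exact mul_le_mul h₄ h₄ (norm_nonneg _) ((norm_nonneg _).trans h₄)
    · exact Continuous.intervalIntegrable (by fun_prop) _ _
    · refine .of_forall fun s hs => ?_
      rw [uIoc_of_le ht.1] at hs
      refine Tendsto.const_smul ?_ _
      have h₅ := hlim s (htT hs)
      exact ((continuous_cconv_apply ξ).tendsto (p s, p s)).comp (h₅.prodMk_nhds h₅)
  refine (h₃.comp hφ.tendsto_atTop).congr' ?_
  -- A given frequency lies inside the cutoff from some index on, where the indicator becomes 1.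
  obtain ⟨K, hK⟩ := exists_nat_ge |ξ|
  filter_upwards [eventually_ge_atTop K] with k hk
  have h₆ : ξ ∈ Icc (-((φ k : ℕ) + 1 : ℝ)) ((φ k : ℕ) + 1) := by
    refine abs_le.mp ?_
    have h₇ : (K : ℝ) ≤ φ k := by exact_mod_cast hk.trans (hφ.id_le k)
    linarith
  simp only [Function.comp]
  rw [h₂ (φ k), indicator_of_mem h₆]

/-- Global solvability of the viscous Burgers equation on the Fourier side, with the bounds on the
`L²` and Sobolev norms. -/
theorem exists_isFourierMild {c : ℝ} (hc : 0 < c) {u : L2C} (hu : hermReflect u = u) {T : ℝ}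
    (hT : 0 ≤ T) : ∃ p : ℝ → L2C, IsFourierMild c univ T u p ∧ ∀ t ∈ Icc 0 T,
      hermReflect (p t) = p t ∧ ‖p t‖ ≤ ‖u‖ ∧
      ∀ n, sobEnergy n (p t) ≤ ENNReal.ofReal (Real.exp (sobRate c n ‖u‖ * t)) ^ 2 * sobEnergy n u := by
  have hex : ∀ k : ℕ, ∃ y : ℝ → L2C, y 0 = galerkinProj (k + 1) u ∧ ∀ t ∈ Icc 0 T,
      HasDerivWithinAt y (galerkinLin c (k + 1) (y t) + galerkinNonlin (k + 1) (y t) (y t))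
        (Icc 0 T) t ∧ galerkinProj (k + 1) (y t) = y t ∧ ‖y t‖ ≤ ‖galerkinProj (k + 1) u‖ := fun k =>
    exists_galerkin_solution hc.le _ (galerkinProj_galerkinProj _ u) hT
  choose y hy0 hy using hex
  have hyR : ∀ k, ∀ t ∈ Icc 0 T, ‖y k t‖ ≤ ‖u‖ := fun k t ht =>
    (hy k t ht).2.2.trans (norm_galerkinProj_le_of_herm _ hu)
  have hy0' : ∀ k : ℕ, ∀ᵐ ξ : ℝ, y k 0 ξ = (cutoff (k + 1) ξ : ℂ) * u ξ := fun k => by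
    rw [hy0]; exact coeFn_galerkinProj_of_herm _ hu
  have hmild : ∀ k : ℕ, IsFourierMild c (Icc (-(k + 1 : ℝ)) (k + 1)) T u (y k) := fun k =>
    isFourierMild_of_galerkin (hy0' k) fun t ht => ⟨(hy k t ht).1, (hy k t ht).2.1⟩
  obtain ⟨K, hK, hdiff⟩ := IsFourierMild.exists_norm_sub_le hc (norm_nonneg u) hT
  set δ : ℕ → ℝ := fun k => K * (eLpNorm (highFreq c ‖u‖ u (k + 1)) 2 volume).toReal with hδ
  have hδ0 : Tendsto δ atTop (nhds 0) := by
    have h₁ : Tendsto (fun k : ℕ => (k + 1 : ℝ)) atTop atTop :=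
      tendsto_natCast_atTop_atTop.atTop_add tendsto_const_nhds
    have h₂ := ((ENNReal.tendsto_toReal ENNReal.zero_ne_top).comp
      ((tendsto_eLpNorm_highFreq (R := ‖u‖) hc u).comp h₁)).const_mul K
    simpa using h₂
  -- The smaller of the two cutoffs, k + 1, is the common level in the stability estimate, so the
  -- bound is independent of j and t.
  have hcauchy : ∀ t ∈ Icc 0 T, ∀ k j : ℕ, k ≤ j → dist (y k t) (y j t) ≤ δ k := by
    intro t ht k j hkj
    have hkj' : (k : ℝ) ≤ j := by exact_mod_cast hkj
    rw [dist_eq_norm]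
    exact hdiff (k + 1) _ _ u (y k) (y j) (by positivity) Subset.rfl
      (Icc_subset_Icc (by linarith) (by linarith)) (hmild k) (hmild j) (hyR k) (hyR j) t ht
  have hlimex : ∀ t, ∃ q : L2C, t ∈ Icc 0 T → Tendsto (fun k => y k t) atTop (nhds q) := by
    intro t
    by_cases ht : t ∈ Icc 0 T
    · obtain ⟨q, hq⟩ := cauchySeq_tendsto_of_complete
        (cauchySeq_of_le_tendsto_0' δ (hcauchy t ht) hδ0)
      exact ⟨q, fun _ => hq⟩
    · exact ⟨0, fun h => absurd h ht⟩
  choose p hp using hlimex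
  have hunif : TendstoUniformlyOn y p atTop (Icc 0 T) := by
    rw [Metric.tendstoUniformlyOn_iff]
    intro e he
    filter_upwards [hδ0.eventually_lt_const he] with k hk t ht
    refine lt_of_le_of_lt ?_ hk
    rw [dist_comm]
    refine le_of_tendsto (tendsto_const_nhds.dist (hp t ht)) ?_
    filter_upwards [eventually_ge_atTop k] with j hj using hcauchy t ht k j hj
  refine ⟨p, IsFourierMild.of_tendstoUniformlyOn hmild hyR hunif, fun t ht => ⟨?_, ?_, fun n => ?_⟩⟩
  · refine tendsto_nhds_unique ((hermReflect.continuous.tendsto _).comp (hp t ht)) ?_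
    refine (hp t ht).congr fun k => ?_
    exact ((hermReflect_eq_self_iff _).mpr
      ((galerkinProj_eq_self_iff _ _).mp (hy k t ht).2.1).1).symm
  · exact le_of_tendsto (hp t ht).norm (.of_forall fun k => hyR k t ht)
  · refine sobEnergy_le_of_tendsto (hp t ht) fun k => ?_
    exact sobEnergy_le_of_cutSob (Real.exp_pos _).le
      ((galerkinProj_eq_self_iff _ _).mp (hy k t ht).2.1).2 (hy0' k)
      (norm_cutSob_galerkin_le hc n
        (fun s hs => ⟨(hy k s hs).1, (hy k s hs).2.1, hyR k s hs⟩) ht)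

/-- Both solutions are bounded on the compact interval, and the stability estimate holds for every
N; its right-hand side vanishes as N → ∞. -/
theorem IsFourierMild.eqOn {c : ℝ} (hc : 0 < c) {T : ℝ} (hT : 0 ≤ T) {u : L2C} {p q : ℝ → L2C}
    (hp : IsFourierMild c univ T u p) (hq : IsFourierMild c univ T u q) : EqOn p q (Icc 0 T) := by
  obtain ⟨R₁, hR₁⟩ := isCompact_Icc.exists_bound_of_continuousOn hp.continuousOn
  obtain ⟨R₂, hR₂⟩ := isCompact_Icc.exists_bound_of_continuousOn hq.continuousOn
  have hR : 0 ≤ max R₁ R₂ := le_max_of_le_left ((norm_nonneg _).trans (hR₁ 0 (left_mem_Icc.mpr hT)))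
  obtain ⟨K, hK, hdiff⟩ := IsFourierMild.exists_norm_sub_le hc hR hT
  intro t ht
  have h₁ : ∀ᶠ N : ℝ in atTop,
      ‖p t - q t‖ ≤ K * (eLpNorm (highFreq c (max R₁ R₂) u N) 2 volume).toReal := by
    filter_upwards [eventually_gt_atTop 0] with N hN
    exact hdiff N univ univ u p q hN (subset_univ _) (subset_univ _) hp hq
      (fun s hs => (hR₁ s hs).trans (le_max_left _ _))
      (fun s hs => (hR₂ s hs).trans (le_max_right _ _)) t ht
  have h₂ := ((ENNReal.tendsto_toReal ENNReal.zero_ne_top).comp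
    (tendsto_eLpNorm_highFreq (R := max R₁ R₂) hc u)).const_mul K
  rw [ENNReal.toReal_zero, mul_zero] at h₂
  have h₃ : ‖p t - q t‖ ≤ 0 := ge_of_tendsto h₂ h₁
  exact sub_eq_zero.mp (norm_le_zero_iff.mp h₃)

theorem IsFourierMild.mono {c : ℝ} {S : Set ℝ} {T T' : ℝ} (hT : T' ≤ T) {u : L2C} {p : ℝ → L2C}
    (hp : IsFourierMild c S T u p) : IsFourierMild c S T' u p :=
  ⟨hp.continuousOn.mono (Icc_subset_Icc le_rfl hT), fun t ht =>
    hp.duhamel t (Icc_subset_Icc le_rfl hT ht)⟩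

/-- The global solution of the viscous Burgers equation on the Fourier side. -/
theorem exists_global_isFourierMild {c : ℝ} (hc : 0 < c) {u : L2C} (hu : hermReflect u = u) :
    ∃ p : ℝ → L2C, (∀ T, 0 ≤ T → IsFourierMild c univ T u p) ∧ ∀ t, 0 ≤ t →
      hermReflect (p t) = p t ∧ ‖p t‖ ≤ ‖u‖ ∧
      ∀ n, sobEnergy n (p t) ≤ ENNReal.ofReal (Real.exp (sobRate c n ‖u‖ * t)) ^ 2 * sobEnergy n u := by
  -- Solutions on all intervals agree by uniqueness, so the diagonal t ↦ q t t is the global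
  -- solution; the maximum with 0 makes the family total in T.
  have hex := fun T : ℝ => exists_isFourierMild hc hu (le_max_right T 0)
  choose q hq hq' using hex
  have hagree : ∀ s t, 0 ≤ s → s ≤ t → q s s = q t s := by
    intro s t hs hst
    have h₁ : max s 0 ≤ max t 0 := max_le_max_right _ hst
    exact ((hq s).eqOn hc (le_max_right _ _) ((hq t).mono h₁)) ⟨hs, le_max_left _ _⟩
  refine ⟨fun t => q t t, fun T hT => ?_, fun t ht => hq' t t ⟨ht, le_max_left _ _⟩⟩
  have h₂ : EqOn (fun t => q t t) (q T) (Icc 0 T) := fun s hs => hagree s T hs.1 hs.2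
  have h₃ := (hq T).mono (le_max_left T 0)
  refine ⟨h₃.continuousOn.congr h₂, fun t ht => ?_⟩
  filter_upwards [h₃.duhamel t ht] with ξ hξ
  have h₄ : q t t = q T t := h₂ ht
  rw [h₄, hξ, indicator_univ, indicator_univ]
  congr 2
  refine intervalIntegral.integral_congr fun s hs => ?_
  rw [uIcc_of_le ht.1] at hs
  have h₅ : q s s = q T s := h₂ ⟨hs.1, hs.2.trans ht.2⟩
  simp only [h₅]

/-! ### Convolution kernels as Fourier multipliers -/

theorem integral_schwartz_mul_fourierInv_of_integrable (φ : 𝓢(ℝ, ℂ)) {f : ℝ → ℂ}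
    (hf : Integrable f) : ∫ x, φ x * 𝓕⁻ f x = ∫ x, (𝓕⁻ φ) x * f x := by
  have h := VectorFourier.integral_fourierIntegral_smul_eq_flip (μ := volume) (ν := volume)
    (L := -innerₗ ℝ) Real.continuous_fourierChar (by
      exact continuous_inner.neg) φ.integrable hf
  have h' : (-innerₗ ℝ : ℝ →ₗ[ℝ] ℝ →ₗ[ℝ] ℝ).flip = -innerₗ ℝ := by
    ext
    simp
  rw [h'] at h
  rw [SchwartzMap.fourierInv_coe]
  exact h.symm

theorem fourierInv_ae_eq_fourierInv {f : ℝ → ℂ} (hf : Integrable f) {h : L2C}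
    (hfh : f =ᵐ[volume] h) : 𝓕⁻ f =ᵐ[volume] (𝓕⁻ h : L2C) := by
  have hc : Continuous (𝓕⁻ f) := by
    have h₁ : 𝓕⁻ f = fun x => 𝓕 f (-x) := funext fun x => Real.fourierInv_eq_fourier_neg f x
    rw [h₁]
    exact (continuous_fourier_of_integrable hf).comp continuous_neg
  refine ae_eq_of_integral_schwartz_mul_eq hc.locallyIntegrable (L2C.locallyIntegrable _)
    fun φ => ?_
  have h₁ := integral_schwartz_mul_fourier (𝓕⁻ φ) (𝓕⁻ h)
  rw [fourier_fourierInv_eq, fourier_fourierInv_eq] at h₁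
  rw [integral_schwartz_mul_fourierInv_of_integrable φ hf, ← h₁]
  refine integral_congr_ae ?_
  filter_upwards [hfh] with x hx
  rw [hx]

/-- The kernel is the inverse transform of an L² symbol, so the convolution theorem for L² factors
applies at every point x. -/
theorem conv_eq_fourierInv {k : ℝ → ℝ} {m : ℝ → ℂ} (hm₁ : Integrable m) (hm₂ : MemLp m 2)
    (hk : ∀ x, (k x : ℂ) = 𝓕⁻ m x) (v : L2R) (x : ℝ) :
    ((conv k v x : ℝ) : ℂ) = 𝓕⁻ (fun ξ => m ξ * realFourier v ξ) x := by
  have h₁ : 𝓕⁻ (fun ξ => m ξ * realFourier v ξ) x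
      = 𝓕⁻ (fun ξ => (hm₂.toLp m : L2C) ξ * realFourier v ξ) x := by
    refine Real.fourierInv_congr_ae ?_ x
    filter_upwards [hm₂.coeFn_toLp] with ξ hξ
    rw [hξ]
  have h₂ : (𝓕⁻ (realFourier v) : L2C) = toComplexL2 v := by
    rw [realFourier_apply, fourierInv_fourier_eq (E := L2C) (F := L2C)]
  rw [h₁, fourierInv_mul_eq_cconv, h₂, conv, convolution, ← integral_complex_ofReal, cconv]
  refine integral_congr_ae ?_
  filter_upwards [fourierInv_ae_eq_fourierInv hm₁ hm₂.coeFn_toLp.symm,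
    (Measure.measurePreserving_sub_left volume x).quasiMeasurePreserving.ae
      (toComplexL2_ae v)] with y h₃ h₄
  rw [← h₃, h₄, ← hk]
  simp

/-- Convolution with the inverse Fourier transform of `m` is the Fourier multiplier with
symbol `m`. -/
theorem exists_memLp_conv {k : ℝ → ℝ} {m : ℝ → ℂ} (hm₁ : Integrable m) (hm₂ : MemLp m 2)
    (hm : MemLp m ∞) (hk : ∀ x, (k x : ℂ) = 𝓕⁻ m x) (v : L2R) :
    ∃ h : MemLp (conv k v) 2, realFourier h.toLp = mulOp m hm (realFourier v) := by
  set q : L2C := mulOp m hm (realFourier v)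
  have h₁ : (fun x => ((conv k v x : ℝ) : ℂ)) =ᵐ[volume] (𝓕⁻ q : L2C) := by
    have h₂ : (fun ξ => m ξ * realFourier v ξ) =ᵐ[volume] q := (coeFn_mulOp m hm _).symm
    have h₃ : Integrable (fun ξ => m ξ * realFourier v ξ) :=
      hm₂.integrable_mul (Lp.memLp (realFourier v))
    simp only [conv_eq_fourierInv hm₁ hm₂ hk]
    exact fourierInv_ae_eq_fourierInv h₃ h₂
  have h : MemLp (conv k v) 2 := by
    have h₄ : MemLp (fun x => ((conv k v x : ℝ) : ℂ)) 2 :=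
      (memLp_congr_ae h₁).mpr (Lp.memLp _)
    exact h₄.re
  refine ⟨h, ?_⟩
  have h₅ : toComplexL2 h.toLp = (𝓕⁻ q : L2C) := by
    refine Lp.ext ?_
    filter_upwards [h₁, toComplexL2_ae h.toLp, h.coeFn_toLp] with x h₆ h₇ h₈
    rw [h₇, h₈, h₆]
  rw [realFourier_apply, h₅, fourier_fourierInv_eq (E := L2C) (F := L2C)]

theorem memLp_two_of_bound {m : ℝ → ℂ} (hm : Integrable m) {C : ℝ} (hC : ∀ ξ, ‖m ξ‖ ≤ C) :
    MemLp m 2 := by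
  rw [memLp_two_iff_integrable_sq_norm hm.aestronglyMeasurable]
  simp only [sq]
  exact hm.norm.bdd_mul hm.aestronglyMeasurable.norm (.of_forall fun ξ => by
    simpa using hC ξ)

theorem integrable_ofReal_exp_neg_mul_sq {c t : ℝ} (hc : 0 < c) (ht : 0 < t) :
    Integrable fun ξ : ℝ => ((Real.exp (-(c * ξ ^ 2) * t) : ℝ) : ℂ) := by
  have h := (integrable_exp_neg_mul_sq (mul_pos hc ht)).ofReal (𝕜 := ℂ)
  refine h.congr (.of_forall fun ξ => ?_)
  simp only
  congr 2
  ring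

/-- The transform of the Gaussian e^{-πbξ²} with b = 4πεt. -/
theorem heatKernel_eq_fourierInv {ε t : ℝ} (hε : 0 < ε) (ht : 0 < t) (x : ℝ) :
    ((heatKernel ε t x : ℝ) : ℂ)
      = 𝓕⁻ (fun ξ : ℝ => ((Real.exp (-(4 * Real.pi ^ 2 * ε * ξ ^ 2) * t) : ℝ) : ℂ)) x := by
  have hb : 0 < 4 * Real.pi * ε * t := by positivity
  have h := congrFun (fourier_gaussian_pi (b := ((4 * Real.pi * ε * t : ℝ) : ℂ))
    (by rwa [Complex.ofReal_re])) (-x)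
  have h₁ : (fun ξ : ℝ => ((Real.exp (-(4 * Real.pi ^ 2 * ε * ξ ^ 2) * t) : ℝ) : ℂ))
      = fun ξ : ℝ => Complex.exp (-Real.pi * ((4 * Real.pi * ε * t : ℝ) : ℂ) * ξ ^ 2) := by
    ext ξ
    push_cast
    congr 1
    ring
  rw [Real.fourierInv_eq_fourier_neg, h₁, h, heatKernel, Real.sqrt_eq_rpow]
  push_cast [Complex.ofReal_cpow hb.le]
  congr 2
  have hpi : (Real.pi : ℂ) ≠ 0 := by exact_mod_cast Real.pi_ne_zero
  have hε' : (ε : ℂ) ≠ 0 := by exact_mod_cast hε.ne'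
  have ht' : (t : ℂ) ≠ 0 := by exact_mod_cast ht.ne'
  field_simp

/-! ### The symbol φ and the linear flow -/

theorem re_linSymbol (η a b ξ : ℝ) :
    (linSymbol η a b ξ).re = 4 * Real.pi ^ 2 * η * ξ ^ 2 - a * |ξ| ^ (4 / 3 : ℝ) := by
  rw [linSymbol, Complex.add_re, Complex.ofReal_re, Complex.I_mul_re, Complex.ofReal_im]
  ring

theorem continuous_linSymbol (η a b : ℝ) : Continuous (linSymbol η a b) := by
  unfold linSymbol
  have h₁ : Continuous fun ξ : ℝ => |ξ| ^ (4 / 3 : ℝ) :=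
    continuous_abs.rpow_const fun _ => .inr (by norm_num)
  have h₂ : Continuous fun ξ : ℝ => |ξ| ^ (1 / 3 : ℝ) :=
    continuous_abs.rpow_const fun _ => .inr (by norm_num)
  fun_prop

/-- Half of the quadratic term dominates the power 4/3 up to a constant. This coercivity yields both
the existence of the minimum and the integrability of e^{-tφ}. -/
theorem exists_le_re_linSymbol {η a : ℝ} (hη : 0 < η) (ha : 0 < a) (b : ℝ) :
    ∃ K, ∀ ξ, 2 * Real.pi ^ 2 * η * ξ ^ 2 - K ≤ (linSymbol η a b ξ).re := by
  set p := 2 * Real.pi ^ 2 * η with hp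
  have hp₀ : 0 < p := by positivity
  refine ⟨a * (a / p) ^ 2, fun ξ => ?_⟩
  -- In this variable the two powers are y³ and y². Below y = a/p the constant dominates ay², above
  -- it py³ does.
  set y := |ξ| ^ (2 / 3 : ℝ) with hy
  have hy₀ : 0 ≤ y := by positivity
  have h₂ : |ξ| ^ (4 / 3 : ℝ) = y ^ 2 := by
    rw [hy, ← Real.rpow_natCast, ← Real.rpow_mul (abs_nonneg _)]
    norm_num
  have h₃ : ξ ^ 2 = y ^ 3 := by
    rw [hy, ← Real.rpow_natCast (|ξ| ^ (2 / 3 : ℝ)) 3, ← Real.rpow_mul (abs_nonneg _), ← sq_abs]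
    norm_num
  have h₄ : a * y ^ 2 ≤ p * y ^ 3 + a * (a / p) ^ 2 := by
    rcases le_total y (a / p) with h | h
    · have := mul_le_mul_of_nonneg_left (pow_le_pow_left₀ hy₀ h 2) ha.le
      have h₅ : 0 ≤ p * y ^ 3 := by positivity
      linarith
    · have h₅ : a ≤ p * y := by rwa [div_le_iff₀' hp₀] at h
      have := mul_le_mul_of_nonneg_right h₅ (sq_nonneg y)
      have h₆ : 0 ≤ a * (a / p) ^ 2 := by positivity
      nlinarith
  rw [re_linSymbol, h₂, h₃]
  have h₅ : 4 * Real.pi ^ 2 * η = 2 * p := by rw [hp]; ring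
  rw [h₅]
  linarith

theorem isLeast_range_re_linSymbol {η a : ℝ} (hη : 0 < η) (ha : 0 < a) (b : ℝ) :
    IsLeast (range fun ξ : ℝ => (linSymbol η a b ξ).re) (-growthRate η a b) := by
  obtain ⟨K, hK⟩ := exists_le_re_linSymbol hη ha b
  have h₁ : Tendsto (fun ξ : ℝ => (linSymbol η a b ξ).re) (cocompact ℝ) atTop := by
    refine tendsto_atTop_mono hK (tendsto_atTop_add_const_right _ _ ?_)
    refine Tendsto.const_mul_atTop (by positivity) ?_
    have h₂ := (tendsto_pow_atTop two_ne_zero).comp (tendsto_norm_cocompact_atTop (E := ℝ))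
    simpa [Function.comp_def] using h₂
  obtain ⟨ξ₀, h₀⟩ := (Complex.continuous_re.comp (continuous_linSymbol η a b)).exists_forall_le h₁
  have h₂ : IsLeast (range fun ξ : ℝ => (linSymbol η a b ξ).re) (linSymbol η a b ξ₀).re :=
    ⟨⟨ξ₀, rfl⟩, by rintro _ ⟨ξ, rfl⟩; exact h₀ ξ⟩
  rw [growthRate, neg_neg, h₂.csInf_eq]
  exact h₂

theorem neg_growthRate_le {η a : ℝ} (hη : 0 < η) (ha : 0 < a) (b ξ : ℝ) :
    -growthRate η a b ≤ (linSymbol η a b ξ).re :=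
  (isLeast_range_re_linSymbol hη ha b).2 ⟨ξ, rfl⟩

/-- At small frequencies the power 4/3 beats the square. The test point has |ξ|^{2/3} = y with 4π²ηy
= a/2, where Re φ = -ay²/2. -/
theorem growthRate_pos {η a : ℝ} (hη : 0 < η) (ha : 0 < a) (b : ℝ) : 0 < growthRate η a b := by
  set y := a / (8 * Real.pi ^ 2 * η) with hy
  have hy₀ : 0 < y := by positivity
  have h := neg_growthRate_le hη ha b (y ^ (3 / 2 : ℝ))
  have h₂ : |y ^ (3 / 2 : ℝ)| ^ (4 / 3 : ℝ) = y ^ 2 := by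
    rw [abs_of_nonneg (by positivity), ← Real.rpow_mul hy₀.le, ← Real.rpow_natCast]
    norm_num
  have h₃ : (y ^ (3 / 2 : ℝ)) ^ 2 = y ^ 3 := by
    rw [← Real.rpow_natCast, ← Real.rpow_mul hy₀.le, ← Real.rpow_natCast]
    norm_num
  have h₄ : 4 * Real.pi ^ 2 * η * y = a / 2 := by
    rw [hy]
    field_simp
    norm_num
  rw [re_linSymbol, h₂, h₃] at h
  have h₅ : 0 < a * y ^ 2 := by positivity
  nlinarith

theorem norm_exp_linSymbol (η a b t ξ : ℝ) :
    ‖Complex.exp (-(t : ℂ) * linSymbol η a b ξ)‖ = Real.exp (-t * (linSymbol η a b ξ).re) := by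
  rw [Complex.norm_exp, ← Complex.ofReal_neg, Complex.re_ofReal_mul]

theorem norm_exp_linSymbol_le {η a : ℝ} (hη : 0 < η) (ha : 0 < a) (b : ℝ) {t : ℝ} (ht : 0 ≤ t)
    (ξ : ℝ) :
    ‖Complex.exp (-(t : ℂ) * linSymbol η a b ξ)‖ ≤ Real.exp (growthRate η a b * t) := by
  rw [norm_exp_linSymbol, Real.exp_le_exp]
  have := mul_le_mul_of_nonneg_left (neg_growthRate_le hη ha b ξ) ht
  linarith

theorem continuous_exp_linSymbol (η a b t : ℝ) :
    Continuous fun ξ => Complex.exp (-(t : ℂ) * linSymbol η a b ξ) :=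
  Complex.continuous_exp.comp (continuous_const.mul (continuous_linSymbol η a b))

theorem integrable_exp_linSymbol {η a : ℝ} (hη : 0 < η) (ha : 0 < a) (b : ℝ) {t : ℝ} (ht : 0 < t) :
    Integrable fun ξ => Complex.exp (-(t : ℂ) * linSymbol η a b ξ) := by
  obtain ⟨K, hK⟩ := exists_le_re_linSymbol hη ha b
  have h₁ : 0 < 2 * Real.pi ^ 2 * η * t := by positivity
  refine ((integrable_exp_neg_mul_sq h₁).const_mul (Real.exp (t * K))).mono'
    (continuous_exp_linSymbol η a b t).aestronglyMeasurable (.of_forall fun ξ => ?_)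
  rw [norm_exp_linSymbol, ← Real.exp_add, Real.exp_le_exp]
  have := mul_le_mul_of_nonneg_left (hK ξ) ht.le
  linarith

theorem memLp_top_exp_linSymbol {η a : ℝ} (hη : 0 < η) (ha : 0 < a) (b : ℝ) {t : ℝ} (ht : 0 ≤ t) :
    MemLp (fun ξ => Complex.exp (-(t : ℂ) * linSymbol η a b ξ)) ∞ :=
  memLp_top_of_bound (continuous_exp_linSymbol η a b t).aestronglyMeasurable _
    (.of_forall (norm_exp_linSymbol_le hη ha b ht))

/-- On the Fourier side `X^t` is the multiplication by `e^{-tφ}`. -/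
theorem exists_memLp_linFlow {η a : ℝ} (hη : 0 < η) (ha : 0 < a) (b : ℝ) {t : ℝ} (ht : 0 ≤ t)
    (v : L2R) : ∃ h : MemLp (linFlow η a b t v) 2,
      realFourier h.toLp = mulOp _ (memLp_top_exp_linSymbol hη ha b ht) (realFourier v) := by
  rcases ht.eq_or_lt with rfl | ht₀
  · have h₁ : linFlow η a b 0 v = v := if_pos rfl
    rw [h₁]
    refine ⟨Lp.memLp v, ?_⟩
    rw [Lp.toLp_coeFn]
    refine Lp.ext ?_
    filter_upwards [coeFn_mulOp _ (memLp_top_exp_linSymbol hη ha b ht) (realFourier v)] with ξ hξ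
    rw [hξ]
    simp
  · have h₁ : linFlow η a b t v = conv (linKernel η a b t) v := if_neg ht₀.ne'
    rw [h₁]
    have h₂ := integrable_exp_linSymbol hη ha b ht₀
    exact exists_memLp_conv h₂ (memLp_two_of_bound h₂ (norm_exp_linSymbol_le hη ha b ht))
      (memLp_top_exp_linSymbol hη ha b ht) (linKernel_eq η a b t) v

/-! ### The Duhamel term in physical space -/

theorem hasDerivAt_heatKernel {ε t : ℝ} (hε : 0 < ε) (ht : 0 < t) (x : ℝ) :
    HasDerivAt (heatKernel ε t) (-(x / (2 * ε * t)) * heatKernel ε t x) x := by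
  have h₁ : HasDerivAt (fun x : ℝ => -x ^ 2 / (4 * ε * t)) (-(2 * x) / (4 * ε * t)) x := by
    simpa using ((hasDerivAt_pow 2 x).neg.div_const (4 * ε * t))
  have h₂ : HasDerivAt (heatKernel ε t) _ x :=
    h₁.exp.const_mul (1 / Real.sqrt (4 * Real.pi * ε * t))
  refine h₂.congr_deriv ?_
  rw [heatKernel]
  field_simp
  ring

theorem integrable_heatKernel {ε t : ℝ} (hε : 0 < ε) (ht : 0 < t) :
    Integrable (heatKernel ε t) := by
  have hb : 0 < 1 / (4 * ε * t) := by positivity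
  refine ((integrable_exp_neg_mul_sq hb).const_mul (1 / Real.sqrt (4 * Real.pi * ε * t))).congr
    (.of_forall fun x => ?_)
  simp only [heatKernel]
  congr 2
  ring

theorem deriv_heatKernel {ε t : ℝ} (hε : 0 < ε) (ht : 0 < t) :
    deriv (heatKernel ε t) = fun x => -(x / (2 * ε * t)) * heatKernel ε t x :=
  funext fun x => (hasDerivAt_heatKernel hε ht x).deriv

theorem continuous_deriv_heatKernel {ε t : ℝ} (hε : 0 < ε) (ht : 0 < t) :
    Continuous (deriv (heatKernel ε t)) := by
  rw [deriv_heatKernel hε ht]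
  unfold heatKernel
  fun_prop

/-- With z = |x|/√(4εt) the derivative has the profile z e^{-z²}, and z ≤ e^{z²/2} trades the linear
factor for half of the Gaussian decay. -/
theorem abs_deriv_heatKernel_le {ε t : ℝ} (hε : 0 < ε) (ht : 0 < t) (x : ℝ) :
    |deriv (heatKernel ε t) x| ≤ 1 / Real.sqrt (4 * Real.pi * ε * t) * (2 / Real.sqrt (4 * ε * t))
      * Real.exp (-(1 / (8 * ε * t)) * x ^ 2) := by
  set r := Real.sqrt (4 * ε * t) with hr
  have hr₀ : 0 < r := Real.sqrt_pos.mpr (by positivity)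
  have hr₂ : 4 * ε * t = r ^ 2 := (Real.sq_sqrt (by positivity)).symm
  have h₁ : |x| / r ≤ Real.exp ((|x| / r) ^ 2 / 2) := by
    have := Real.add_one_le_exp ((|x| / r) ^ 2 / 2)
    nlinarith [sq_nonneg (|x| / r - 1)]
  have h₂ : |deriv (heatKernel ε t) x| = 1 / Real.sqrt (4 * Real.pi * ε * t) * (2 / r)
      * (|x| / r * Real.exp (-(|x| / r) ^ 2)) := by
    rw [congrFun (deriv_heatKernel hε ht) x]
    simp only [heatKernel]
    rw [abs_mul, abs_neg, abs_div, abs_of_pos (by positivity : 0 < 2 * ε * t),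
      abs_of_nonneg (by positivity : 0 ≤ 1 / _ * Real.exp _), hr₂, div_pow, sq_abs,
      show 2 * ε * t = r ^ 2 / 2 by linarith, neg_div]
    field_simp
  rw [h₂]
  refine mul_le_mul_of_nonneg_left ?_ (by positivity)
  calc _ ≤ Real.exp ((|x| / r) ^ 2 / 2) * Real.exp (-(|x| / r) ^ 2) := by gcongr
    _ = _ := by
      rw [← Real.exp_add, div_pow, sq_abs, show 8 * ε * t = 2 * r ^ 2 by linarith]
      congr 1
      field_simp
      ring

theorem integrable_deriv_heatKernel {ε t : ℝ} (hε : 0 < ε) (ht : 0 < t) :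
    Integrable (deriv (heatKernel ε t)) :=
  ((integrable_exp_neg_mul_sq (by positivity : 0 < 1 / (8 * ε * t))).const_mul _).mono'
    (continuous_deriv_heatKernel hε ht).aestronglyMeasurable
    (.of_forall (abs_deriv_heatKernel_le hε ht))

/-- The singularity t^{-1/2} is integrable at 0, which makes the Duhamel integral converge
absolutely in L¹ although w² is only in L¹. -/
theorem integral_abs_deriv_heatKernel_le {ε t : ℝ} (hε : 0 < ε) (ht : 0 < t) :
    ∫ x, |deriv (heatKernel ε t) x| ≤ 2 * Real.sqrt 2 / Real.sqrt (4 * ε) * t ^ (-(1 / 2) : ℝ) := by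
  have hb : 0 < 1 / (8 * ε * t) := by positivity
  calc _ ≤ ∫ x, 1 / Real.sqrt (4 * Real.pi * ε * t) * (2 / Real.sqrt (4 * ε * t))
      * Real.exp (-(1 / (8 * ε * t)) * x ^ 2) :=
        integral_mono (integrable_deriv_heatKernel hε ht).abs
          ((integrable_exp_neg_mul_sq hb).const_mul _) (abs_deriv_heatKernel_le hε ht)
    _ = _ := by
      rw [integral_const_mul, integral_gaussian, Real.rpow_neg ht.le, ← Real.sqrt_eq_rpow,
        show Real.pi / (1 / (8 * ε * t)) = 2 * (4 * Real.pi * ε * t) by field_simp; ring,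
        Real.sqrt_mul zero_le_two, Real.sqrt_mul (x := 4 * ε) (by positivity) t]
      have h₁ : 0 < Real.sqrt (4 * Real.pi * ε * t) := Real.sqrt_pos.mpr (by positivity)
      have h₂ : 0 < Real.sqrt (4 * ε) := Real.sqrt_pos.mpr (by positivity)
      have h₃ : 0 < Real.sqrt t := Real.sqrt_pos.mpr ht
      field_simp

theorem fourier_heatKernel {ε t : ℝ} (hε : 0 < ε) (ht : 0 < t) :
    𝓕 (fun x => ((heatKernel ε t x : ℝ) : ℂ))
      = fun ξ => ((Real.exp (-(4 * Real.pi ^ 2 * ε * ξ ^ 2) * t) : ℝ) : ℂ) := by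
  simp only [heatKernel_eq_fourierInv hε ht]
  refine Continuous.fourier_fourierInv_eq (by fun_prop)
    (integrable_ofReal_exp_neg_mul_sq (by positivity) ht) ?_
  have h := ((integrable_heatKernel hε ht).ofReal (𝕜 := ℂ)).comp_neg
  refine h.congr (.of_forall fun x => ?_)
  simp only [Complex.coe_algebraMap, heatKernel_eq_fourierInv hε ht]
  rw [Real.fourierInv_eq_fourier_neg, neg_neg]

theorem fourier_deriv_heatKernel {ε t : ℝ} (hε : 0 < ε) (ht : 0 < t) (ξ : ℝ) :
    𝓕 (fun x => ((deriv (heatKernel ε t) x : ℝ) : ℂ)) ξ = 2 * Real.pi * Complex.I * ξ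
      * ((Real.exp (-(4 * Real.pi ^ 2 * ε * ξ ^ 2) * t) : ℝ) : ℂ) := by
  have h₁ : ∀ x, HasDerivAt (fun x => ((heatKernel ε t x : ℝ) : ℂ))
      ((deriv (heatKernel ε t) x : ℝ) : ℂ) x := fun x =>
    (hasDerivAt_heatKernel hε ht x).differentiableAt.hasDerivAt.ofReal_comp
  have h₂ : deriv (fun x => ((heatKernel ε t x : ℝ) : ℂ))
      = fun x => ((deriv (heatKernel ε t) x : ℝ) : ℂ) := funext fun x => (h₁ x).deriv
  have h₃ := Real.fourier_deriv (integrable_heatKernel hε ht).ofReal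
    (fun x => (h₁ x).differentiableAt) (by
      rw [h₂]
      exact (integrable_deriv_heatKernel hε ht).ofReal)
  rw [← h₂, congrFun h₃ ξ, congrFun (fourier_heatKernel hε ht) ξ, smul_eq_mul]

theorem integrable_sq_coeFn (w : L2R) : Integrable fun y => (w y) ^ 2 :=
  (Lp.memLp w).integrable_sq

theorem integral_sq_coeFn (w : L2R) : ∫ y, (w y) ^ 2 = ‖w‖ ^ 2 := by
  rw [← real_inner_self_eq_norm_sq, L2.inner_def]
  refine integral_congr_ae (.of_forall fun y => ?_)
  simp [sq]

theorem fourier_sq_coeFn (w : L2R) (ξ : ℝ) :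
    𝓕 (fun y => (((w y) ^ 2 : ℝ) : ℂ)) ξ = cconv (realFourier w) (realFourier w) ξ := by
  rw [realFourier_apply, ← fourier_mul_eq_cconv]
  refine Real.fourier_congr_ae ?_ ξ
  filter_upwards [toComplexL2_ae w] with y hy
  rw [hy]
  push_cast
  ring

theorem ofReal_conv (f g : ℝ → ℝ) : (fun x => ((conv f g x : ℝ) : ℂ))
    = convolution (fun x => (f x : ℂ)) (fun x => (g x : ℂ)) (ContinuousLinearMap.mul ℂ ℂ) volume := by
  ext x
  rw [conv, convolution, convolution, ← integral_complex_ofReal]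
  simp

theorem integral_abs_conv_le {f g : ℝ → ℝ} (hf : Integrable f) (hg : Integrable g) :
    ∫ x, |conv f g x| ≤ (∫ x, |f x|) * ∫ x, |g x| := by
  have h₁ := integral_convolution (ContinuousLinearMap.mul ℝ ℝ) hf.abs hg.abs
  rw [ContinuousLinearMap.mul_apply'] at h₁
  rw [← h₁]
  refine integral_mono (hf.integrable_convolution _ hg).abs
    (hf.abs.integrable_convolution _ hg.abs) fun x => ?_
  refine (abs_integral_le_integral_abs).trans_eq ?_
  refine integral_congr_ae (.of_forall fun y => ?_)
  simp [abs_mul]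

/-- The integrand `∂ₓG(t) ∗ w²` of Duhamel's formula is integrable. -/
theorem integrable_conv_deriv_heatKernel {ε t : ℝ} (hε : 0 < ε) (ht : 0 < t) (w : L2R) :
    Integrable (conv (deriv (heatKernel ε t)) fun y => (w y) ^ 2) :=
  (integrable_deriv_heatKernel hε ht).integrable_convolution _ (integrable_sq_coeFn w)

theorem integral_abs_conv_deriv_heatKernel_le {ε t : ℝ} (hε : 0 < ε) (ht : 0 < t) (w : L2R) :
    ∫ x, |conv (deriv (heatKernel ε t)) (fun y => (w y) ^ 2) x|
      ≤ 2 * Real.sqrt 2 / Real.sqrt (4 * ε) * t ^ (-(1 / 2) : ℝ) * ‖w‖ ^ 2 := by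
  refine (integral_abs_conv_le (integrable_deriv_heatKernel hε ht) (integrable_sq_coeFn w)).trans ?_
  simp only [abs_sq, integral_sq_coeFn]
  gcongr
  exact integral_abs_deriv_heatKernel_le hε ht

theorem fourier_conv_deriv_heatKernel {ε t : ℝ} (hε : 0 < ε) (ht : 0 < t) (w : L2R) (ξ : ℝ) :
    𝓕 (fun x => ((conv (deriv (heatKernel ε t)) (fun y => (w y) ^ 2) x : ℝ) : ℂ)) ξ
      = 2 * Real.pi * Complex.I * ξ * ((Real.exp (-(4 * Real.pi ^ 2 * ε * ξ ^ 2) * t) : ℝ) : ℂ)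
        * cconv (realFourier w) (realFourier w) ξ := by
  rw [ofReal_conv]
  refine (Real.fourier_mul_convolution_eq (R := ℂ) (integrable_deriv_heatKernel hε ht).ofReal
    (integrable_sq_coeFn w).ofReal ξ).trans ?_
  exact congrArg₂ _ (fourier_deriv_heatKernel hε ht ξ) (fourier_sq_coeFn w ξ)

/-- Inversion holds at every x: the convolution is continuous and integrable, and its transform is
integrable because ξe^{-cξ²t} is and the factor ŵ ∗ ŵ is bounded. -/
theorem conv_deriv_heatKernel_eq_fourierInv {ε t : ℝ} (hε : 0 < ε) (ht : 0 < t) (w : L2R) (x : ℝ) :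
    ((conv (deriv (heatKernel ε t)) (fun y => (w y) ^ 2) x : ℝ) : ℂ)
      = 𝓕⁻ (fun ξ : ℝ => 2 * Real.pi * Complex.I * ξ
        * ((Real.exp (-(4 * Real.pi ^ 2 * ε * ξ ^ 2) * t) : ℝ) : ℂ)
        * cconv (realFourier w) (realFourier w) ξ) x := by
  have h₁ : Continuous (conv (deriv (heatKernel ε t)) fun y => (w y) ^ 2) := by
    refine BddAbove.continuous_convolution_left_of_integrable _ ?_
      (continuous_deriv_heatKernel hε ht) (integrable_sq_coeFn w)
    refine ⟨1 / Real.sqrt (4 * Real.pi * ε * t) * (2 / Real.sqrt (4 * ε * t)), ?_⟩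
    rintro _ ⟨x, rfl⟩
    refine (abs_deriv_heatKernel_le hε ht x).trans (mul_le_of_le_one_right (by positivity) ?_)
    rw [Real.exp_le_one_iff, neg_mul]
    exact neg_nonpos.mpr (by positivity)
  have h₂ := funext (fourier_conv_deriv_heatKernel hε ht w)
  rw [← h₂]
  refine (congrFun (Continuous.fourierInv_fourier_eq (Complex.continuous_ofReal.comp h₁)
    (integrable_conv_deriv_heatKernel hε ht w).ofReal ?_) x).symm
  refine Integrable.congr ?_ (.of_forall fun ξ => (congrFun h₂ ξ).symm)
  have h₃ : Integrable fun ξ : ℝ => 2 * Real.pi * Complex.I * ξ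
      * ((Real.exp (-(4 * Real.pi ^ 2 * ε * ξ ^ 2) * t) : ℝ) : ℂ) := by
    have h₄ := ((integrable_mul_exp_neg_mul_sq
      (by positivity : 0 < 4 * Real.pi ^ 2 * ε * t)).ofReal (𝕜 := ℂ)).const_mul
        (2 * Real.pi * Complex.I)
    refine h₄.congr (.of_forall fun ξ => ?_)
    simp only [RCLike.ofReal_eq_complex_ofReal, Complex.ofReal_mul, ← mul_assoc]
    congr 3
    ring
  refine (h₃.bdd_mul (continuous_cconv _ _).aestronglyMeasurable (.of_forall fun ξ =>
    norm_cconv_le (realFourier w) (realFourier w) ξ)).congr (.of_forall fun ξ => ?_)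
  simp only
  ring

/-- The integrand of Duhamel's formula for the viscous Burgers equation. -/
def duhamelIntegrand (ε t : ℝ) (w : ℝ → L2R) (s x : ℝ) : ℝ :=
  conv (deriv (heatKernel ε (t - s))) (fun y => (w s y) ^ 2) x

/-- Each w(s) is only a class of functions, so joint measurability of w(s)(y)² is not available. The
inverse Fourier integral expresses the integrand through data continuous in (s, x, ξ). -/
theorem aestronglyMeasurable_duhamelIntegrand {ε t : ℝ} (hε : 0 < ε) {w : ℝ → L2R}
    (hw : ContinuousOn w (Ici 0)) :
    AEStronglyMeasurable (fun z : ℝ × ℝ => ((duhamelIntegrand ε t w z.1 z.2 : ℝ) : ℂ))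
      ((volume.restrict (Ioo 0 t)).prod volume) := by
  -- Freezing w at negative times gives a globally continuous curve and changes nothing on (0, t).
  set v : ℝ → L2C := fun s => realFourier (w (max s 0)) with hv
  have hv₁ : Continuous v := realFourier.continuous.comp
    (hw.comp_continuous (continuous_id.max continuous_const) fun s => le_max_right s 0)
  have h₁ : Continuous fun q : (ℝ × ℝ) × ℝ => cconv (v q.1.1) (v q.1.1) q.2 :=
    continuous_cconv_self.comp (f := fun q : (ℝ × ℝ) × ℝ => (v q.1.1, q.2)) (by fun_prop)
  have h₂ : Continuous fun q : (ℝ × ℝ) × ℝ => Complex.exp (2 * Real.pi * q.2 * q.1.2 * Complex.I)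
      * (2 * Real.pi * Complex.I * q.2
        * ((Real.exp (-(4 * Real.pi ^ 2 * ε * q.2 ^ 2) * (t - q.1.1)) : ℝ) : ℂ)
        * cconv (v q.1.1) (v q.1.1) q.2) := by fun_prop
  have h₃ := (h₂.stronglyMeasurable.integral_prod_right' (ν := volume)).aestronglyMeasurable
    (μ := (volume.restrict (Ioo 0 t)).prod (volume : Measure ℝ))
  refine h₃.congr ?_
  have h₄ : ∀ᵐ z : ℝ × ℝ ∂(volume.restrict (Ioo 0 t)).prod (volume : Measure ℝ), z.1 ∈ Ioo 0 t :=
    Measure.quasiMeasurePreserving_fst.ae (ae_restrict_mem measurableSet_Ioo)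
  filter_upwards [h₄] with z hz
  rw [duhamelIntegrand, conv_deriv_heatKernel_eq_fourierInv hε (sub_pos.mpr hz.2),
    Real.fourierInv_eq']
  refine integral_congr_ae (.of_forall fun ξ => ?_)
  simp only [hv, max_eq_left hz.1.le, smul_eq_mul]
  congr 2
  simp
  ring

theorem integrable_duhamelIntegrand {ε t : ℝ} (hε : 0 < ε) {w : ℝ → L2R}
    (hw : ContinuousOn w (Ici 0)) :
    Integrable (fun z : ℝ × ℝ => ((duhamelIntegrand ε t w z.1 z.2 : ℝ) : ℂ))
      ((volume.restrict (Ioo 0 t)).prod volume) := by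
  have hm := aestronglyMeasurable_duhamelIntegrand (t := t) hε hw
  rw [integrable_prod_iff hm]
  refine ⟨?_, ?_⟩
  · filter_upwards [ae_restrict_mem measurableSet_Ioo] with s hs
    exact (integrable_conv_deriv_heatKernel hε (sub_pos.mpr hs.2) (w s)).ofReal
  · obtain ⟨R, hR⟩ := (isCompact_Icc (a := (0 : ℝ)) (b := t)).exists_bound_of_continuousOn
      (hw.mono fun s hs => hs.1)
    have h₁ : IntegrableOn (fun s => 2 * Real.sqrt 2 / Real.sqrt (4 * ε) * (t - s) ^ (-(1 / 2) : ℝ)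
        * R ^ 2) (Ioo 0 t) := by
      have h₂ : IntervalIntegrable (fun s : ℝ => s ^ (-(1 / 2) : ℝ)) volume (t - 0) (t - t) :=
        intervalIntegral.intervalIntegrable_rpow' (by norm_num)
      have h₃ := (h₂.comp_sub_left t).1
      simp only [sub_sub_cancel] at h₃
      exact ((h₃.mono_set Ioo_subset_Ioc_self).const_mul _).mul_const _
    refine h₁.mono' hm.norm.integral_prod_right' ?_
    filter_upwards [ae_restrict_mem measurableSet_Ioo] with s hs
    have h₄ := hR s (Ioo_subset_Icc_self hs)
    have hts := sub_pos.mpr hs.2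
    rw [Real.norm_of_nonneg (integral_nonneg fun _ => norm_nonneg _)]
    simp only [Complex.norm_real, Real.norm_eq_abs]
    refine (integral_abs_conv_deriv_heatKernel_le hε hts (w s)).trans ?_
    gcongr

theorem integrable_integral_duhamelIntegrand {ε t : ℝ} (hε : 0 < ε) (ht : 0 < t) {w : ℝ → L2R}
    (hw : ContinuousOn w (Ici 0)) :
    Integrable fun x => ((∫ s in (0 : ℝ)..t, duhamelIntegrand ε t w s x : ℝ) : ℂ) := by
  have h := (integrable_duhamelIntegrand (t := t) hε hw).integral_prod_right
  refine h.congr (.of_forall fun x => ?_)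
  simp only
  rw [intervalIntegral.integral_of_le ht.le, integral_Ioc_eq_integral_Ioo, integral_complex_ofReal]

/-- Fubini, justified by the joint integrability of the Duhamel integrand. The factor 2 cancels the
1/2 of the equation. -/
theorem fourier_integral_duhamelIntegrand {ε t : ℝ} (hε : 0 < ε) (ht : 0 < t) {w : ℝ → L2R}
    (hw : ContinuousOn w (Ici 0)) (ξ : ℝ) :
    𝓕 (fun x => ((∫ s in (0 : ℝ)..t, duhamelIntegrand ε t w s x : ℝ) : ℂ)) ξ
      = 2 * (Real.pi * ξ * Complex.I) * ∫ s in (0 : ℝ)..t,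
        Real.exp (-(4 * Real.pi ^ 2 * ε * ξ ^ 2) * (t - s))
          • cconv (realFourier (w s)) (realFourier (w s)) ξ := by
  have h := integrable_duhamelIntegrand (t := t) hε hw
  have h₁ : Integrable (Function.uncurry fun s x : ℝ =>
      Complex.exp (((-2 * Real.pi * x * ξ : ℝ) : ℂ) * Complex.I)
        • ((duhamelIntegrand ε t w s x : ℝ) : ℂ)) ((volume.restrict (Ioo 0 t)).prod volume) := by
    refine h.bdd_mul (c := 1) ?_ (.of_forall fun z => ?_)
    · exact Continuous.aestronglyMeasurable (by fun_prop)
    · rw [Complex.norm_exp_ofReal_mul_I]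
  rw [Real.fourier_real_eq_integral_exp_smul]
  simp only [intervalIntegral.integral_of_le ht.le, integral_Ioc_eq_integral_Ioo,
    ← integral_complex_ofReal, ← integral_smul]
  rw [← integral_integral_swap h₁, ← integral_const_mul]
  refine setIntegral_congr_fun measurableSet_Ioo fun s hs => ?_
  have h₂ := fourier_conv_deriv_heatKernel hε (sub_pos.mpr hs.2) (w s) ξ
  rw [Real.fourier_real_eq_integral_exp_smul] at h₂
  refine h₂.trans ?_
  rw [Complex.real_smul]
  ring

/-! ### Back to the viscous Burgers flow -/

/-- The Duhamel integral is a priori in L¹ and the solution in L²; the agreement of the two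
transforms allows them to be compared on the Fourier side. -/
theorem ae_eq_toComplexL2_iff {f : ℝ → ℝ} (hf : Integrable fun x => ((f x : ℝ) : ℂ)) (g : L2R) :
    f =ᵐ[volume] g ↔ 𝓕 (fun x => ((f x : ℝ) : ℂ)) =ᵐ[volume] realFourier g := by
  have h : f =ᵐ[volume] g ↔ (fun x => ((f x : ℝ) : ℂ)) =ᵐ[volume] toComplexL2 g := by
    refine eventually_congr ?_
    filter_upwards [toComplexL2_ae g] with x hx
    rw [hx, Complex.ofReal_inj]
  rw [h, realFourier_apply]
  exact ⟨fourier_ae_eq_fourier hf, ae_eq_of_fourier_ae_eq hf⟩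

/-- Duhamel's formula at time `t` on the physical and on the Fourier side. -/
theorem duhamel_iff {ε t : ℝ} (hε : 0 < ε) (ht : 0 < t) (u : L2R) {w : ℝ → L2R}
    (hw : ContinuousOn w (Ici 0)) :
    (∀ᵐ x : ℝ, w t x = conv (heatKernel ε t) u x
      - 1 / 2 * ∫ s in (0 : ℝ)..t, duhamelIntegrand ε t w s x) ↔
    ∀ᵐ ξ : ℝ, realFourier (w t) ξ
      = Real.exp (-(4 * Real.pi ^ 2 * ε * ξ ^ 2) * t) • realFourier u ξ
        - (Real.pi * ξ * Complex.I) * ∫ s in (0 : ℝ)..t,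
          Real.exp (-(4 * Real.pi ^ 2 * ε * ξ ^ 2) * (t - s))
            • cconv (realFourier (w s)) (realFourier (w s)) ξ := by
  have hg₁ := integrable_ofReal_exp_neg_mul_sq (by positivity : 0 < 4 * Real.pi ^ 2 * ε) ht
  have hb : ∀ ξ : ℝ, ‖((Real.exp (-(4 * Real.pi ^ 2 * ε * ξ ^ 2) * t) : ℝ) : ℂ)‖ ≤ 1 := by
    intro ξ
    rw [Complex.norm_real, Real.norm_of_nonneg (Real.exp_pos _).le, Real.exp_le_one_iff]
    have : 0 ≤ 4 * Real.pi ^ 2 * ε * ξ ^ 2 * t := by positivity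
    linarith
  have hgT : MemLp (fun ξ : ℝ => ((Real.exp (-(4 * Real.pi ^ 2 * ε * ξ ^ 2) * t) : ℝ) : ℂ)) ∞ :=
    memLp_top_of_bound hg₁.aestronglyMeasurable 1 (.of_forall hb)
  obtain ⟨hA, hA'⟩ := exists_memLp_conv hg₁ (memLp_two_of_bound hg₁ hb) hgT
    (heatKernel_eq_fourierInv hε ht) u
  set A : L2R := hA.toLp
  -- Solving the formula for the integral gives 2(G ∗ u - w(t)), which is in L², so the identity
  -- becomes one between an L¹ and an L² function.
  have h₁ := ae_eq_toComplexL2_iff (integrable_integral_duhamelIntegrand hε ht hw)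
    ((2 : ℝ) • (A - w t))
  have h₂ : (∀ᵐ x : ℝ, w t x = conv (heatKernel ε t) u x
      - 1 / 2 * ∫ s in (0 : ℝ)..t, duhamelIntegrand ε t w s x) ↔
      (fun x => ∫ s in (0 : ℝ)..t, duhamelIntegrand ε t w s x)
        =ᵐ[volume] ((2 : ℝ) • (A - w t) : L2R) := by
    refine eventually_congr ?_
    filter_upwards [Lp.coeFn_smul (2 : ℝ) (A - w t), Lp.coeFn_sub A (w t), hA.coeFn_toLp]
      with x h₃ h₄ h₅
    rw [h₃, Pi.smul_apply, h₄, Pi.sub_apply, h₅, smul_eq_mul]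
    constructor <;> intro h <;> linarith
  rw [h₂, h₁, map_smul, map_sub, hA']
  refine eventually_congr ?_
  filter_upwards [Lp.coeFn_smul (2 : ℝ) (mulOp _ hgT (realFourier u) - realFourier (w t)),
    Lp.coeFn_sub (mulOp _ hgT (realFourier u)) (realFourier (w t)),
    coeFn_mulOp _ hgT (realFourier u)] with ξ h₃ h₄ h₅
  rw [h₃, Pi.smul_apply, h₄, Pi.sub_apply, h₅, fourier_integral_duhamelIntegrand hε ht hw,
    Complex.real_smul, Complex.real_smul]
  push_cast
  constructor <;> intro h
  · linear_combination (1 / 2) * h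
  · linear_combination 2 * h

/-- Mild solutions of the viscous Burgers equation correspond to solutions on the Fourier side. -/
theorem isBurgersMildSolution_iff {ε : ℝ} (hε : 0 < ε) (u : L2R) (w : ℝ → L2R) :
    IsBurgersMildSolution ε u w ↔ ∀ T, 0 ≤ T →
      IsFourierMild (4 * Real.pi ^ 2 * ε) univ T (realFourier u) fun t => realFourier (w t) := by
  constructor
  · intro h T hT
    refine ⟨realFourier.continuous.comp_continuousOn (h.continuousOn.mono fun s hs => hs.1),
      fun t ht => ?_⟩
    simp only [indicator_univ]
    rcases ht.1.eq_or_lt with rfl | ht₀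
    · rw [h.initial]
      simp
    · exact (duhamel_iff hε ht₀ u h.continuousOn).mp (h.duhamel t ht₀)
  · intro h
    have hiso : ∀ s t, dist (w s) (w t) = dist (realFourier (w s)) (realFourier (w t)) := by
      intro s t
      rw [dist_eq_norm, dist_eq_norm, ← map_sub, norm_realFourier]
    have hc : ContinuousOn w (Ici 0) := by
      intro t ht
      rw [mem_Ici] at ht
      have h₁ := (h (t + 1) (by linarith)).continuousOn t ⟨ht, by linarith⟩
      have h₂ : ContinuousWithinAt w (Icc 0 (t + 1)) t := by
        rw [ContinuousWithinAt, tendsto_iff_dist_tendsto_zero] at h₁ ⊢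
        simpa only [hiso] using h₁
      refine h₂.mono_of_mem_nhdsWithin ?_
      rw [← Ici_inter_Iic]
      exact inter_mem_nhdsWithin _ (Iic_mem_nhds (by linarith))
    refine ⟨hc, ?_, fun t ht => ?_⟩
    · exact realFourier_injective ((h 0 le_rfl).apply_zero le_rfl)
    · refine (duhamel_iff hε ht u hc).mpr ?_
      simpa only [indicator_univ] using (h t ht.le).duhamel t ⟨ht.le, le_rfl⟩

theorem exists_isBurgersMildSolution {ε : ℝ} (hε : 0 < ε) (u : L2R) :
    ∃ w : ℝ → L2R, IsBurgersMildSolution ε u w ∧ ∀ t, 0 ≤ t → ‖w t‖ ≤ ‖u‖ ∧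
      ∀ n, sobEnergy n (realFourier (w t))
        ≤ ENNReal.ofReal (Real.exp (sobRate (4 * Real.pi ^ 2 * ε) n ‖u‖ * t)) ^ 2
          * sobEnergy n (realFourier u) := by
  obtain ⟨p, hp, hp'⟩ := exists_global_isFourierMild (by positivity : 0 < 4 * Real.pi ^ 2 * ε)
    (hermReflect_realFourier u)
  have hw : ∀ t, ∃ f : L2R, 0 ≤ t → realFourier f = p t := by
    intro t
    by_cases ht : 0 ≤ t
    · obtain ⟨f, hf⟩ := exists_realFourier_eq (hp' t ht).1
      exact ⟨f, fun _ => hf⟩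
    · exact ⟨0, fun h => absurd h ht⟩
  choose w hw using hw
  refine ⟨w, (isBurgersMildSolution_iff hε u w).mpr fun T hT => ?_, fun t ht => ?_⟩
  · have h := hp T hT
    refine ⟨h.continuousOn.congr fun t ht => hw t ht.1, fun t ht => ?_⟩
    filter_upwards [h.duhamel t ht] with ξ hξ
    rw [hw t ht.1, hξ, indicator_univ, indicator_univ]
    congr 2
    refine intervalIntegral.integral_congr fun s hs => ?_
    rw [uIcc_of_le ht.1] at hs
    simp only [hw s hs.1]
  · have h := (hp' t ht).2
    rw [← hw t ht, norm_realFourier, norm_realFourier] at h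
    exact h

theorem IsBurgersMildSolution.eqOn {ε : ℝ} (hε : 0 < ε) {u : L2R} {w₁ w₂ : ℝ → L2R}
    (h₁ : IsBurgersMildSolution ε u w₁) (h₂ : IsBurgersMildSolution ε u w₂) :
    EqOn w₁ w₂ (Ici 0) := by
  intro t ht
  rw [mem_Ici] at ht
  have h₃ := (isBurgersMildSolution_iff hε u w₁).mp h₁ t ht
  have h₄ := (isBurgersMildSolution_iff hε u w₂).mp h₂ t ht
  exact realFourier_injective (h₃.eqOn (by positivity) ht h₄ ⟨ht, le_rfl⟩)

/-- The chosen solution does not depend on t, so the flow at all times comes from a single mild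
solution. -/
theorem isBurgersMildSolution_burgersFlow {ε : ℝ} (hε : 0 < ε) (u : L2R) :
    IsBurgersMildSolution ε u fun t => burgersFlow ε t u := by
  have h : ∃ w : ℝ → L2R, IsBurgersMildSolution ε u w :=
    (exists_isBurgersMildSolution hε u).imp fun _ => And.left
  have h₁ : (fun t => burgersFlow ε t u) = h.choose := by
    ext1 t
    rw [burgersFlow, dif_pos h]
  rw [h₁]
  exact h.choose_spec

theorem burgersFlow_bounds {ε : ℝ} (hε : 0 < ε) (u : L2R) {t : ℝ} (ht : 0 ≤ t) :
    ‖burgersFlow ε t u‖ ≤ ‖u‖ ∧ ∀ n, sobEnergy n (realFourier (burgersFlow ε t u))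
        ≤ ENNReal.ofReal (Real.exp (sobRate (4 * Real.pi ^ 2 * ε) n ‖u‖ * t)) ^ 2
          * sobEnergy n (realFourier u) := by
  obtain ⟨w, hw, hw'⟩ := exists_isBurgersMildSolution hε u
  have h : w t = burgersFlow ε t u := hw.eqOn hε (isBurgersMildSolution_burgersFlow hε u) ht
  rw [← h]
  exact hw' t ht

/-! ### Bounds for the Lie splitting operator -/

theorem sobEnergy_mulOp_le {m : ℝ → ℂ} (hm : MemLp m ∞) {C : ℝ} (hC : ∀ ξ, ‖m ξ‖ ≤ C) (n : ℕ)
    (v : L2C) : sobEnergy n (mulOp m hm v) ≤ ENNReal.ofReal C ^ 2 * sobEnergy n v := by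
  rw [sobEnergy, sobEnergy, ← lintegral_const_mul' _ _ (by finiteness)]
  refine lintegral_mono_ae ?_
  filter_upwards [coeFn_mulOp m hm v] with ξ hξ
  rw [hξ, enorm_mul, mul_pow, mul_left_comm]
  gcongr
  rw [← ofReal_norm]
  exact ENNReal.ofReal_le_ofReal (hC ξ)

/-- The Lie splitting operator preserves `L²`, with bounds on the `L²` and Sobolev norms. -/
theorem exists_memLp_lieSplitting {ε η a : ℝ} (hε : 0 < ε) (hη : 0 < η) (ha : 0 < a) (b : ℝ)
    (u : L2R) {t : ℝ} (ht : 0 ≤ t) : ∃ h : MemLp (lieSplitting ε η a b t u) 2,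
      ‖h.toLp‖ ≤ Real.exp (growthRate η a b * t) * ‖u‖ ∧
      ∀ n, sobEnergy n (realFourier h.toLp) ≤ ENNReal.ofReal (Real.exp
        ((growthRate η a b + sobRate (4 * Real.pi ^ 2 * ε) n ‖u‖) * t)) ^ 2
          * sobEnergy n (realFourier u) := by
  obtain ⟨h, h'⟩ := exists_memLp_linFlow hη ha b ht (burgersFlow ε t u)
  obtain ⟨h₁, h₂⟩ := burgersFlow_bounds hε u ht
  have hC := norm_exp_linSymbol_le hη ha b ht
  refine ⟨h, ?_, fun n => ?_⟩
  · have h₃ := (mulOp _ (memLp_top_exp_linSymbol hη ha b ht)).le_of_opNorm_le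
      (norm_mulOp_le (memLp_top_exp_linSymbol hη ha b ht) (Real.exp_pos _).le hC)
      (realFourier (burgersFlow ε t u))
    rw [← h', norm_realFourier, norm_realFourier] at h₃
    exact h₃.trans (by gcongr)
  · have h₃ := sobEnergy_mulOp_le (memLp_top_exp_linSymbol hη ha b ht) hC n
      (realFourier (burgersFlow ε t u))
    rw [← h'] at h₃
    refine h₃.trans ((mul_le_mul_right (h₂ n) _).trans_eq ?_)
    rw [← mul_assoc, ← mul_pow, ← ENNReal.ofReal_mul (Real.exp_pos _).le, ← Real.exp_add, add_mul]

theorem sobEnergy_eq_lintegral (n : ℕ) (v : L2C) :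
    sobEnergy n v = ∫⁻ ξ, ‖(sobWeight n ξ : ℂ) * v ξ‖ₑ ^ 2 := by
  refine lintegral_congr fun ξ => ?_
  rw [enorm_mul, mul_pow, ← ofReal_norm (sobWeight n ξ : ℂ), Complex.norm_real,
    Real.norm_of_nonneg (sobWeight_nonneg n ξ), ← ENNReal.ofReal_pow (sobWeight_nonneg n ξ),
    sobWeight_sq]

theorem aestronglyMeasurable_sobWeight_mul (n : ℕ) (v : L2C) :
    AEStronglyMeasurable (fun ξ => (sobWeight n ξ : ℂ) * v ξ) :=
  (Complex.continuous_ofReal.comp (continuous_sobWeight n)).aestronglyMeasurable.mul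
    (Lp.aestronglyMeasurable v)

theorem memLp_sobWeight_mul_iff (n : ℕ) (v : L2C) :
    MemLp (fun ξ => (sobWeight n ξ : ℂ) * v ξ) 2 ↔ sobEnergy n v < ∞ := by
  rw [sobEnergy_eq_lintegral, MemLp, and_iff_right (aestronglyMeasurable_sobWeight_mul n v),
    eLpNorm_lt_top_iff_lintegral_rpow_enorm_lt_top two_ne_zero ENNReal.ofNat_ne_top]
  simp

theorem locallyIntegrable_sobWeight_mul (n : ℕ) (v : L2C) :
    LocallyIntegrable fun ξ => (sobWeight n ξ : ℂ) * v ξ := by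
  rw [locallyIntegrable_iff]
  intro k hk
  exact ((L2C.locallyIntegrable v).integrableOn_isCompact hk).continuousOn_mul
    (Complex.continuous_ofReal.comp (continuous_sobWeight n)).continuousOn hk

/-- Sobolev membership asks that the weighted transform, as a tempered distribution, be given by an
L² function. Testing against Schwartz functions identifies that function with the pointwise product
almost everywhere. -/
theorem memHn_iff (n : ℕ) (f : L2R) : MemHn n f ↔ sobEnergy n (realFourier f) < ∞ := by
  set v := realFourier f with hv
  have hw : (fun ξ : ℝ => (((1 + ‖ξ‖ ^ 2) ^ ((n : ℝ) / 2) : ℝ) : ℂ))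
      = fun ξ => (sobWeight n ξ : ℂ) := by
    ext ξ
    have h : (0 : ℝ) ≤ 1 + ξ ^ 2 := by positivity
    rw [sobWeight, Real.sqrt_eq_rpow, ← Real.rpow_natCast (1 + ξ ^ 2) n, ← Real.rpow_mul h, Real.norm_eq_abs,
      sq_abs, mul_one_div]
  have hg : (fun ξ : ℝ => (((1 + ‖ξ‖ ^ 2) ^ ((n : ℝ) / 2) : ℝ) : ℂ)).HasTemperateGrowth := by
    fun_prop
  have hF : (𝓕 (Lp.toTemperedDistribution (toComplexL2 f)) : TemperedDistribution ℝ ℂ)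
      = Lp.toTemperedDistribution v := Lp.fourier_toTemperedDistribution_eq _
  have key : ∀ g : L2C, (TemperedDistribution.smulLeftCLM ℂ
      (fun ξ : ℝ => (((1 + ‖ξ‖ ^ 2) ^ ((n : ℝ) / 2) : ℝ) : ℂ))
        (Lp.toTemperedDistribution v : TemperedDistribution ℝ ℂ) = Lp.toTemperedDistribution g) ↔
      (fun ξ => (sobWeight n ξ : ℂ) * v ξ) =ᵐ[volume] g := by
    intro g
    have h₁ : ∀ φ : 𝓢(ℝ, ℂ), TemperedDistribution.smulLeftCLM ℂ
        (fun ξ : ℝ => (((1 + ‖ξ‖ ^ 2) ^ ((n : ℝ) / 2) : ℝ) : ℂ))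
        (Lp.toTemperedDistribution v : TemperedDistribution ℝ ℂ) φ
        = ∫ ξ, φ ξ * ((sobWeight n ξ : ℂ) * v ξ) := by
      intro φ
      rw [TemperedDistribution.smulLeftCLM_apply_apply, Lp.toTemperedDistribution_apply]
      refine integral_congr_ae (.of_forall fun ξ => ?_)
      simp only [SchwartzMap.smulLeftCLM_apply_apply hg, smul_eq_mul]
      rw [congrFun hw ξ]
      ring
    constructor
    · intro h
      refine ae_eq_of_integral_schwartz_mul_eq (locallyIntegrable_sobWeight_mul n v)
        (L2C.locallyIntegrable g) fun φ => ?_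
      rw [← h₁, h, Lp.toTemperedDistribution_apply]
      simp only [smul_eq_mul]
    · intro h
      ext φ
      rw [h₁, Lp.toTemperedDistribution_apply]
      refine integral_congr_ae ?_
      filter_upwards [h] with ξ hξ
      rw [hξ, smul_eq_mul]
  rw [MemHn, TemperedDistribution.memSobolev_iff_exists_smulLeftCLM_fourier, hF,
    ← memLp_sobWeight_mul_iff]
  simp only [key]
  exact ⟨fun ⟨g, hg⟩ => (memLp_congr_ae hg).mpr (Lp.memLp g), fun h => ⟨h.toLp, h.coeFn_toLp.symm⟩⟩

end

theorem mainTheorem6 (ε η a b : ℝ) (hε : 0 < ε) (hη : 0 < η) (hεη : ε + η = 1)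
    (ha : 0 < a) (hb : 0 < b) :
    -- the flow `Y^t`, hence `Z_L^t`, is well defined on `L²(ℝ)`
    (∀ u : L2R, IsBurgersMildSolution ε u (fun t => burgersFlow ε t u) ∧
      ∀ w : ℝ → L2R, IsBurgersMildSolution ε u w → ∀ t : ℝ, 0 ≤ t → w t = burgersFlow ε t u) ∧
    -- `-β₀` is the minimum of `Re φ`, and `β₀ > 0`
    IsLeast (Set.range fun ξ : ℝ => (linSymbol η a b ξ).re) (-growthRate η a b) ∧
    0 < growthRate η a b ∧
    -- the `L²` estimate
    (∀ (u : L2R) (t : ℝ), 0 < t →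
      ∃ h : MemLp (lieSplitting ε η a b t u) 2 volume,
        ‖h.toLp‖ ≤ Real.exp (growthRate η a b * t) * ‖u‖) ∧
    -- the `Hⁿ` estimate
    (∀ n : ℕ, 1 ≤ n →
      ∃ C : ℝ → ℝ → ℝ,
        (∀ T α : ℝ, 0 < T → 0 ≤ α → 0 < C T α) ∧
        (∀ T₁ T₂ α₁ α₂ : ℝ, 0 < T₁ → T₁ ≤ T₂ → 0 ≤ α₁ → α₁ ≤ α₂ → C T₁ α₁ ≤ C T₂ α₂) ∧
        ∀ (T : ℝ) (u : L2R), 0 < T → MemHn n u → ∀ t ∈ Set.Icc (0 : ℝ) T,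
          ∃ h : MemLp (lieSplitting ε η a b t u) 2 volume,
            MemHn n h.toLp ∧
            hnNorm n h.toLp ≤ ENNReal.ofReal (Real.exp (C T ‖u‖ * t)) * hnNorm n u) := by
  have hc : 0 < 4 * Real.pi ^ 2 * ε := by positivity
  refine ⟨fun u => ⟨isBurgersMildSolution_burgersFlow hε u, fun w hw t ht =>
    hw.eqOn hε (isBurgersMildSolution_burgersFlow hε u) ht⟩,
    isLeast_range_re_linSymbol hη ha b, growthRate_pos hη ha b, fun u t ht => ?_, fun n _ => ?_⟩
  · obtain ⟨h, h₁, -⟩ := exists_memLp_lieSplitting hε hη ha b u ht.le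
    exact ⟨h, h₁⟩
  -- The rate C(T, α) = β₀ + `sobRate` does not depend on T.
  · refine ⟨fun _ α => growthRate η a b + sobRate (4 * Real.pi ^ 2 * ε) n α, fun _ α _ _ => ?_,
      fun _ _ α₁ α₂ _ _ hα h => ?_, fun T u _ hu t ht => ?_⟩
    · exact add_pos_of_pos_of_nonneg (growthRate_pos hη ha b) (sobRate_nonneg hc n α)
    · exact add_le_add_right (sobRate_mono hc n hα h) _
    · obtain ⟨h, -, h₁⟩ := exists_memLp_lieSplitting hε hη ha b u ht.1
      refine ⟨h, ?_, ?_⟩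
      · rw [memHn_iff] at hu ⊢
        exact (h₁ n).trans_lt (ENNReal.mul_lt_top (by finiteness) hu)
      · refine (ENNReal.rpow_le_rpow (h₁ n) (by norm_num : (0 : ℝ) ≤ 1 / 2)).trans_eq ?_
        rw [ENNReal.mul_rpow_of_nonneg _ _ (by norm_num), ← ENNReal.rpow_natCast,
          ← ENNReal.rpow_mul]
        norm_num
        rfl
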